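/- \textbf{Setting.} Let $L\ge 1$, $n\ge 2$, widths $d_0,\dots,d_L\ge1$, and let $\sigma_l:\mathbb R^{d_l}\to\mathbb R^{d_l}$ $(1\le l\le L)$ be $1$-Lipschitz. For weights $W=(W_1,\dots,W_L)$, $W_l\in\mathbb R^{d_l\times d_{l-1}}$, put $f_0(W,x)=x$, $f_l(W,x)=\sigma_l(W_lf_{l-1}(W,x))$, $f=f_L$, $\|W\|_F^2=\sum_l\|W_l\|_F^2$ and $B_F(R)=\{W:\|W\|_F\le R\}$, where $R>0$. Let $\mathbb P$ be a probability distribution of $(x,y)\in\mathbb R^{d_0}\times\mathcal Y$, and let $S,S'$ be independent i.i.d. samples of size $n$ from $\mathbb P$; $\mathbb P_n$ is the empirical distribution of $S$. The (measurable) loss $\ell$ has values in $[0,1]$ and is $\beta$-Lipschitz in its first argument, $\beta>0$. For a sample $T$ with input matrix $X_T$ (inputs as columns) let $F_l^T(W)$ be the matrix with columns $f_l(W,x)$, $x$ a column of $X_T$, and put $\widetilde X^{S,S'}=[X_S,X_{S'}]$, $\widetilde F_l^{S,S'}(W)=[F_l^S(W),F_l^{S'}(W)]$. \emph{Local Lipschitz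 constants.} Let $\bar M_{l\to L}(W,\varepsilon)\in[0,\infty)$ be such that, for almost every sample $T$ of size $n$, for all $W,W'\in B_F(R)$ and $\varepsilon\in(0,1/\beta]$ with $\|F_L^T(W)-F_L^T(W')\|_F\le\sqrt n\,\varepsilon$ and all $l$, $$\|F_L(F_l^T(W'),W'_{l+1},\dots,W'_L)-F_L(F_l^T(W),W'_{l+1},\dots,W'_L)\|_F\le \bar M_{l\to L}(W,\varepsilon)\,\|F_l^T(W')-F_l^T(W)\|_F,$$ where $F_L(A,W'_{l+1},\dots,W'_L)$ is the result of applying the layers $l+1,\dots,L$ with weights $W'$ to the columns of $A$. Let $\overline M_l(W)=\sup_{0<\varepsilon\le1/\beta}\bar M_{l\to L}(W,\varepsilon)\in[0,\infty]$. \emph{Notation.} $\Lambda_n=1+\log\max\{2,n^5/\beta\}$, $\;T_l(W)=\prod_{i\ne l}\|W_i\|_{op}^2$, $\;r_0=\big(R/\sqrt{L-1}\big)^{2(L-1)}\max\{R,2\}^{-n}$ (the first factor is $1$ if $L=1$), $\;h_n=\beta\, n^{-5.5}\sqrt{\sum_{l}(d_l+d_{l-1})d_{l-1}}$, and for $a\ge0$,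 $t\in[0,\infty)^L$, $$\Phi_S(W,a)=\beta\,\mathbb E_{S'}\Big[\tfrac{\Lambda_n}{n}\sqrt{\textstyle\sum_{l}(d_l+d_{l-1})L\|\widetilde F_{l-1}^{S,S'}(W)\|_F^2\,a^2\,\overline M_l(W)^2}\,\Big|\,S\Big],\qquad \Psi(a,t)=\frac{\beta\Lambda_n a}{n}\sqrt{\textstyle\sum_{l}L(d_l+d_{l-1})t_l}.$$ Expectations of non-negative quantities are taken in $[0,\infty]$, with $0\cdot\infty=0$. \textbf{Statement.} There is an absolute constant $C>0$ such that, in every such setting, the following hold. (1) For every $\delta\in(0,1)$, with probability at least $1-\delta$ over $S$, for all $W\in B_F(R)$, $$(\mathbb P-\mathbb P_n)\ell(f(W,x),y)\le C\Big(\Phi_S(W,\|W\|_F)+\sqrt{\tfrac{\sum_l\log(d_{l-1}n)+\log\frac{\log(2n)}{\delta}}{n}}+h_n+\Phi_S(W,R/2^n)\Big).$$ (2) If moreover $\sigma_l(0)=0$ for all $l$, then for all samples, all $W$ and all $l$, $$\|\widetilde F_{l-1}^{S,S'}(W)\|_F\le\Big(\prod_{i<l}\|W_i\|_{op}\Big)\|\widetilde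 X^{S,S'}\|_F,$$ and for every $\delta\in(0,1)$, with probability at least $1-\delta$ over $S$, for all $W\in B_F(R)$, with $E_S=\mathbb E_{S'}[\|\widetilde X^{S,S'}\|_F\mid S]$, $$(\mathbb P-\mathbb P_n)\ell(f(W,x),y)\le C\Big(\Psi(\|W\|_F,T(W))E_S+\sqrt{\tfrac{\sum_l\log(d_{l-1}n)+L\log\frac{n\log\max\{R,2\}}{\delta}}{n}}+h_n+\Psi(R/2^n,T(W)+r_0)E_S+\Psi(\|W\|_F,r_0)E_S\Big);$$ here $\Psi(\|W\|_F,T(W))E_S=\frac{\beta\Lambda_n\|W\|_F}{n}\,E_S\sqrt{L\sum_l(d_l+d_{l-1})\prod_{i\ne l}\|W_i\|_{op}^2}$ (and $r_0$ is added in each coordinate). (3) If $\|x\|_2\le B_x$ almost surely, then $\mathbb E_{S'}[\|\widetilde X^{S,S'}\|_F\mid S]\le(\|X_S\|_F^2+nB_x^2)^{1/2}$ for all $S$, and $(\|X_S\|_F^2+nB_x^2)^{1/2}\le\sqrt{2n}\,B_x$ almost surely. If also $\sigma_l(0)=0$ for all $l$, then for every $\delta\in(0,1)$, with probability at least $1-\delta$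 over $S$, for all $W\in B_F(R)$, the bound in (2) holds with $\sqrt n\,B_x$ in place of $E_S$; its leading term is $\frac{\beta\Lambda_nB_x\|W\|_F}{\sqrt n}\sqrt{L\sum_l(d_l+d_{l-1})\prod_{i\ne l}\|W_i\|_{op}^2}$. -/

import Mathlib

open MeasureTheory Set
open scoped ENNReal NNReal

noncomputable section

namespace DNN

/-- Euclidean space of dimension `k`. -/
abbrev Vec (k : ℕ) : Type := EuclideanSpace ℝ (Fin k)

/-- Weights of a network of depth `L` with widths `d 0, …, d L`.  The index `l : Fin L` stands for
layer number `l + 1`, whose matrix has size `d (l + 1) × d l`. -/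
abbrev Weights (L : ℕ) (d : ℕ → ℕ) : Type :=
  (l : Fin L) → Matrix (Fin (d (l + 1))) (Fin (d l)) ℝ

/-- Activations; `σ l` is the activation of layer number `l + 1`. -/
abbrev Activations (L : ℕ) (d : ℕ → ℕ) : Type :=
  (l : Fin L) → Vec (d (l + 1)) → Vec (d (l + 1))

/-- Frobenius norm of a matrix. -/
def frob {ι κ : Type*} [Fintype ι] [Fintype κ] (A : Matrix ι κ ℝ) : ℝ :=
  Real.sqrt (∑ i, ∑ j, A i j ^ 2)

/-- Spectral norm of a matrix: operator norm between Euclidean spaces. -/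
def spec {p q : ℕ} (A : Matrix (Fin p) (Fin q) ℝ) : ℝ :=
  ‖(Matrix.toEuclideanLin A).toContinuousLinearMap‖

/-- Frobenius norm of a whole collection of weights. -/
def wnorm {L : ℕ} {d : ℕ → ℕ} (W : Weights L d) : ℝ :=
  Real.sqrt (∑ l, frob (W l) ^ 2)

section Network

variable {L : ℕ} {d : ℕ → ℕ} (σ : Activations L d) (W : Weights L d)

/-- One layer `u ↦ σ (W u)`. -/
def layer (l : Fin L) (u : Vec (d l)) : Vec (d (l + 1)) :=
  σ l (Matrix.toEuclideanLin (W l) u)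

/-- The depth-`k` map `f_k (W, ·)`, for `k ≤ L`; `f_0` is the identity. -/
def feat : (k : ℕ) → k ≤ L → Vec (d 0) → Vec (d k)
  | 0, _, x => x
  | k + 1, h, x => layer σ W ⟨k, h⟩ (feat k (Nat.le_of_succ_le h) x)

/-- The network `f_L (W, ·)`. -/
def net (x : Vec (d 0)) : Vec (d L) := feat σ W L le_rfl x

/-- The outer layers `l + 1, …, L` applied to an output `u` of layer number `l`, where `l + m = L`. -/
def outer : (m l : ℕ) → l + m = L → Vec (d l) → Vec (d L)
  | 0, _, h, u => h ▸ u
  | m + 1, l, h, u => outer m (l + 1) (by omega) (layer σ W ⟨l, by omega⟩ u)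

/-- Feature matrix `F_k (W, X)`: the columns are the features of the columns of `X`. -/
def featMat {n : ℕ} (k : ℕ) (hk : k ≤ L) (X : Fin n → Vec (d 0)) :
    Matrix (Fin (d k)) (Fin n) ℝ :=
  Matrix.of fun a i => feat σ W k hk (X i) a

/-- `F_L (F, W_{l+1}, …, W_L)` where the columns of `F` are outputs of layer number `l`. -/
def outerMat {n : ℕ} (l : ℕ) (hl : l ≤ L) (F : Matrix (Fin (d l)) (Fin n) ℝ) :
    Matrix (Fin (d L)) (Fin n) ℝ :=
  Matrix.of fun a i => outer σ W (L - l) l (by omega) (WithLp.toLp 2 fun b => F b i) a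

/-- The concatenated feature matrix `[F_k (W, X), F_k (W, X')]`. -/
def mixedFeat {n : ℕ} (k : ℕ) (hk : k ≤ L) (X X' : Fin n → Vec (d 0)) :
    Matrix (Fin (d k)) (Fin n ⊕ Fin n) ℝ :=
  Matrix.fromCols (featMat σ W k hk X) (featMat σ W k hk X')

end Network

/-- The matrix with columns `X 0, …, X (n - 1)`. -/
def inputMat {n p : ℕ} (X : Fin n → Vec p) : Matrix (Fin p) (Fin n) ℝ :=
  Matrix.of fun a i => X i a

/-- The concatenated input matrix `[X, X']`. -/
def mixedInput {n p : ℕ} (X X' : Fin n → Vec p) : Matrix (Fin p) (Fin n ⊕ Fin n) ℝ :=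
  Matrix.fromCols (inputMat X) (inputMat X')

/-- Empirical distance `‖F_L (W, X) - F_L (W', X)‖_F / √n`. -/
def empDist {L : ℕ} {d : ℕ → ℕ} (σ : Activations L d) {n : ℕ} (X : Fin n → Vec (d 0))
    (W W' : Weights L d) : ℝ :=
  Real.sqrt (frob (featMat σ W L le_rfl X - featMat σ W' L le_rfl X) ^ 2 / n)

/-- `M l W ε` is an outer local Lipschitz constant on the sample `X`, for all layers, all centres `W`
in the Frobenius ball of radius `R` and all scales `ε ∈ (0, ε₀]`: it bounds the sensitivity of the
output of the network to the output of layer number `l + 1`, for all `W'` in the ball of radius `ε`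
around `W` of the hypothesis class (with respect to the empirical distance). -/
def IsLocalLipschitz {L : ℕ} {d : ℕ → ℕ} (σ : Activations L d) {n : ℕ} (X : Fin n → Vec (d 0))
    (R ε₀ : ℝ) (M : Fin L → Weights L d → ℝ → ℝ≥0) : Prop :=
  ∀ W : Weights L d, wnorm W ≤ R → ∀ ε ∈ Ioc 0 ε₀, ∀ W' : Weights L d, wnorm W' ≤ R →
    empDist σ X W W' ≤ ε → ∀ l : Fin L,
      frob (outerMat σ W' (l + 1) l.isLt (featMat σ W' (l + 1) l.isLt X)
          - outerMat σ W' (l + 1) l.isLt (featMat σ W (l + 1) l.isLt X))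
        ≤ M l W ε * frob (featMat σ W' (l + 1) l.isLt X - featMat σ W (l + 1) l.isLt X)

/-- Generalization gap `(ℙ - ℙ_n) ℓ (f (x), y)` of a predictor on the sample `S`. -/
def gap {p q n : ℕ} {Y : Type*} [MeasurableSpace Y] (P : Measure (Vec p × Y))
    (loss : Vec q → Y → ℝ) (f : Vec p → Vec q) (S : Fin n → Vec p × Y) : ℝ :=
  (∫ z, loss (f z.1) z.2 ∂P) - (∑ i, loss (f (S i).1) (S i).2) / n

/-- The inputs of a labelled sample. -/
def inputs {n p : ℕ} {Y : Type*} (S : Fin n → Vec p × Y) : Fin n → Vec p := fun i => (S i).1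

/-- `𝔼_{S'} [ ‖[X_S, X_{S'}]‖_F | S ]`, with values in `[0, ∞]`. -/
def expInput {n p : ℕ} {Y : Type*} [MeasurableSpace Y] (P : Measure (Vec p × Y))
    (S : Fin n → Vec p × Y) : ℝ≥0∞ :=
  ∫⁻ S', ENNReal.ofReal (frob (mixedInput (inputs S) (inputs S'))) ∂Measure.pi fun _ : Fin n => P

/-- The factor `Λ_n = 1 + log max {2, n⁵ / β}`. -/
def Lam (n : ℕ) (β : ℝ) : ℝ := 1 + Real.log (max 2 ((n : ℝ) ^ 5 / β))

/-- `sup_{0 < ε ≤ 1/β} M l W ε`, with values in `[0, ∞]`. -/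
def supLip {L : ℕ} {d : ℕ → ℕ} (M : Fin L → Weights L d → ℝ → ℝ≥0) (β : ℝ) (l : Fin L)
    (W : Weights L d) : ℝ≥0∞ :=
  ⨆ ε ∈ Ioc (0 : ℝ) (1 / β), (M l W ε : ℝ≥0∞)

/-- `β 𝔼_{S'} [ (Λ_n / n) √(∑_l (d_l + d_{l-1}) L ‖F̃_{l-1}‖_F² a² M̄_l²) | S ]`,
with values in `[0, ∞]`. -/
def rankFree {L : ℕ} {d : ℕ → ℕ} (σ : Activations L d) {n : ℕ} {Y : Type*} [MeasurableSpace Y]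
    (P : Measure (Vec (d 0) × Y)) (β : ℝ) (M : Fin L → Weights L d → ℝ → ℝ≥0)
    (S : Fin n → Vec (d 0) × Y) (W : Weights L d) (a : ℝ) : ℝ≥0∞ :=
  ENNReal.ofReal β * ∫⁻ S', ENNReal.ofReal (Lam n β / n) *
    (∑ l : Fin L, ((d (l + 1) + d l : ℕ) : ℝ≥0∞) * (L : ℝ≥0∞)
      * ENNReal.ofReal (frob (mixedFeat σ W l l.isLt.le (inputs S) (inputs S'))) ^ 2
      * ENNReal.ofReal a ^ 2 * supLip M β l W ^ 2) ^ (1 / 2 : ℝ) ∂Measure.pi fun _ : Fin n => P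

/-- `∏_{i ≠ l} ‖W_i‖_op²`. -/
def specProd {L : ℕ} {d : ℕ → ℕ} (W : Weights L d) (l : Fin L) : ℝ :=
  ∏ i ∈ Finset.univ.erase l, spec (W i) ^ 2

/-- `(β Λ_n a / n) √(∑_l L (d_l + d_{l-1}) t_l)`. -/
def specCoef (L : ℕ) (d : ℕ → ℕ) (n : ℕ) (β a : ℝ) (t : Fin L → ℝ) : ℝ :=
  β * Lam n β * a / n * Real.sqrt (∑ l : Fin L, (L : ℝ) * ((d (l + 1) : ℝ) + d l) * t l)

/-- The dyadic floor `r₀ = (R / √(L-1))^{2(L-1)} / max {R, 2}^n`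
(equal to `max {R, 2}^{-n}` if `L = 1`). -/
def specFloor (L n : ℕ) (R : ℝ) : ℝ :=
  (R / Real.sqrt (L - 1)) ^ (2 * (L - 1)) / max R 2 ^ n

/-- The small-scale remainder `β √(∑_l (d_l + d_{l-1}) d_{l-1}) / n^{5.5}`. -/
def smallScale (L : ℕ) (d : ℕ → ℕ) (n : ℕ) (β : ℝ) : ℝ :=
  β * Real.sqrt (∑ l : Fin L, ((d (l + 1) : ℝ) + d l) * d l) / (n : ℝ) ^ (11 / 2 : ℝ)

/-- `√((∑_l log (d_{l-1} n) + log (log (2n) / δ)) / n)`. -/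
def conf (L : ℕ) (d : ℕ → ℕ) (n : ℕ) (δ : ℝ) : ℝ :=
  Real.sqrt ((∑ l : Fin L, Real.log (d l * n) + Real.log (Real.log (2 * n) / δ)) / n)

/-- `√((∑_l log (d_{l-1} n) + L log (n log max {R, 2} / δ)) / n)`. -/
def confSpec (L : ℕ) (d : ℕ → ℕ) (n : ℕ) (R δ : ℝ) : ℝ :=
  Real.sqrt ((∑ l : Fin L, Real.log (d l * n)
    + L * Real.log (n * Real.log (max R 2) / δ)) / n)

end DNN

end

open MeasureTheory Set
open scoped ENNReal NNReal

noncomputable section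

namespace DNN

/-! ### Packing numbers from Gaussian measure. -/

section Packing

variable {V : Type*} [NormedAddCommGroup V] [InnerProductSpace ℝ V] [FiniteDimensional ℝ V]
  [MeasurableSpace V] [BorelSpace V]

/-! The gap at `W` is the mean over a ghost sample `S'` of the empirical difference of the loss
between `S'` and `S`. It is bounded for a fixed pair of samples by chaining over a finite family of
networks fixed before the data, and then only `S'` is integrated out.

Probability: exchanging a point with its ghost copy shows that `exp (t X - t ^ 2 X ^ 2 / 2)` has
mean at most one for every increment `X`, because `cosh x ≤ exp (x ^ 2 / 2)`. A weighted sum over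
all links of the family inherits this. Markov's inequality, applied after integration over `S'`,
gives a good event depending on `S` alone (`exists_chaining_event`).

Entropy: a packing argument for Gaussian measure (`card_le_of_seminorm_separated`) covers the
Frobenius ball of `p × q` matrices in spectral norm at scale `2 ^ (-k)` with log-cardinality of
order `(p + q) 4 ^ k`, without the factor `p q`. Shrinking the packed bodies by `2 ^ (-m)` divides
this by `4 ^ m` and adds a volumetric cost of order `(p + q) q m`. The nets run over dyadic radii
and accuracies in each layer (`exists_net_family`), so the chain can be adapted to `W`, `S` and `S'`
afterwards; the price is a multiple of `L log (2 n + 1)`, absorbed in the confidence term. Scale `j`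
of the chain contributes `2 ^ (-j) √(U 4 ^ j)`, the same amount at every scale. The dimension-free
bound serves up to a scale `j₀` of order `log (n ^ 5 / β)`, which produces `Λ_n`; beyond it the
volumetric costs sum to `h_n`.

Perturbation: layers are replaced one at a time, the last one first. For local Lipschitz constants,
closeness to `W` is not assumed but follows by continuity: along a segment in one layer the distance
to `W` cannot jump over an interval of forbidden values
(`norm_stack_net_sub_le_of_isLocalLipschitz`). The segment stays in the Frobenius ball because net
points are chosen with Frobenius norm at most that of `W` in every layer. For the spectral bound
they are chosen with smaller spectral norm instead, and a product of norms replaces the local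
constants. -/

/-- Unnormalised Gaussian density. -/
def gaussWeight (x : V) : ℝ≥0∞ := ENNReal.ofReal (Real.exp (-(‖x‖ ^ 2) / 2))

/-- Unnormalised standard Gaussian measure on a Euclidean space. -/
def gaussMeasure (V : Type*) [NormedAddCommGroup V] [InnerProductSpace ℝ V]
    [FiniteDimensional ℝ V] [MeasurableSpace V] [BorelSpace V] : Measure V :=
  (volume : Measure V).withDensity gaussWeight

theorem measurable_gaussWeight : Measurable (gaussWeight (V := V)) := by
  unfold gaussWeight
  fun_prop

theorem gaussMeasure_univ_ne_top : gaussMeasure V univ ≠ ∞ := by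
  have h := GaussianFourier.integral_rexp_neg_mul_sq_norm (V := V) (b := 1 / 2) (by norm_num)
  have hi : Integrable (fun v : V => Real.exp (-(1 / 2) * ‖v‖ ^ 2)) := by
    by_contra hc
    rw [integral_undef hc] at h
    have : (0 : ℝ) < (Real.pi / (1 / 2)) ^ (Module.finrank ℝ V / 2 : ℝ) := by positivity
    linarith
  rw [gaussMeasure, withDensity_apply _ MeasurableSet.univ, setLIntegral_univ]
  have := hi.lintegral_lt_top
  refine ne_of_lt (lt_of_eq_of_lt ?_ this)
  refine lintegral_congr fun x => ?_
  unfold gaussWeight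
  congr 2
  ring

theorem gaussMeasure_univ_ne_zero : gaussMeasure V univ ≠ 0 := by
  rw [gaussMeasure, withDensity_apply _ MeasurableSet.univ, setLIntegral_univ]
  intro h
  rw [lintegral_eq_zero_iff measurable_gaussWeight] at h
  have h2 : ∀ᵐ x : V, False := by
    filter_upwards [h] with x hx
    simp only [gaussWeight, Pi.zero_apply, ENNReal.ofReal_eq_zero] at hx
    exact absurd (Real.exp_pos _) (not_lt.2 hx)
  rw [Filter.eventually_false_iff_eq_bot, ae_eq_bot] at h2
  exact NeZero.ne (volume : Measure V) h2

/-- Averaging over `x + y` and `x - y` turns the cross term `exp (∓ ⟪x, y⟫)` into a hyperbolic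
cosine, which is at least one. -/
theorem gaussWeight_shift (x y : V) :
    ENNReal.ofReal (Real.exp (-(‖x‖ ^ 2) / 2)) * (2 * gaussWeight y) ≤
      gaussWeight (x + y) + gaussWeight (x - y) := by
  unfold gaussWeight
  rw [show (2 : ℝ≥0∞) = ENNReal.ofReal 2 by simp, ← ENNReal.ofReal_mul (by norm_num),
    ← ENNReal.ofReal_mul (by positivity), ← ENNReal.ofReal_add (by positivity) (by positivity)]
  apply ENNReal.ofReal_le_ofReal
  rw [norm_add_sq_real, norm_sub_sq_real]
  have h1 : Real.exp (-(‖x‖ ^ 2 + 2 * inner ℝ x y + ‖y‖ ^ 2) / 2) =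
      Real.exp (-(‖x‖ ^ 2) / 2) * Real.exp (-(‖y‖ ^ 2) / 2) * Real.exp (-inner ℝ x y) := by
    rw [← Real.exp_add, ← Real.exp_add]; congr 1; ring
  have h2 : Real.exp (-(‖x‖ ^ 2 - 2 * inner ℝ x y + ‖y‖ ^ 2) / 2) =
      Real.exp (-(‖x‖ ^ 2) / 2) * Real.exp (-(‖y‖ ^ 2) / 2) * Real.exp (inner ℝ x y) := by
    rw [← Real.exp_add, ← Real.exp_add]; congr 1; ring
  rw [h1, h2]
  have h3 := Real.one_le_cosh (inner ℝ x y)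
  rw [Real.cosh_eq] at h3
  have h4 : 0 < Real.exp (-(‖x‖ ^ 2) / 2) * Real.exp (-(‖y‖ ^ 2) / 2) := by positivity
  nlinarith

/-- By symmetry of `K` the integrals of the two shifted densities over `K` agree, so
`gaussWeight_shift` integrates to a bound for a single translate. Convexity plays no role. -/
theorem gaussMeasure_translate (K : Set V) (hK : MeasurableSet K) (hs : ∀ y, -y ∈ K ↔ y ∈ K)
    (x : V) :
    ENNReal.ofReal (Real.exp (-(‖x‖ ^ 2) / 2)) * gaussMeasure V K ≤
      gaussMeasure V {y | y - x ∈ K} := by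
  have e1 : gaussMeasure V {y | y - x ∈ K} = ∫⁻ y in K, gaussWeight (x + y) := by
    have hm : MeasurableSet {y : V | y - x ∈ K} := (measurable_id.sub_const x) hK
    rw [gaussMeasure, withDensity_apply _ hm, ← lintegral_indicator hm, ← lintegral_indicator hK,
      ← lintegral_add_left_eq_self _ x]
    refine lintegral_congr fun y => ?_
    by_cases hy : y ∈ K <;> simp [indicator, hy]
  have e2 : ∫⁻ y in K, gaussWeight (x + y) = ∫⁻ y in K, gaussWeight (x - y) := by
    rw [← lintegral_indicator hK, ← lintegral_indicator hK,
      ← lintegral_neg_eq_self (fun y => K.indicator (fun y => gaussWeight (x + y)) y)]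
    refine lintegral_congr fun y => ?_
    by_cases hy : y ∈ K <;> simp [indicator, hs, hy, sub_eq_add_neg]
  have e3 : ENNReal.ofReal (Real.exp (-(‖x‖ ^ 2) / 2)) * (2 * gaussMeasure V K) ≤
      2 * gaussMeasure V {y | y - x ∈ K} := by
    calc ENNReal.ofReal (Real.exp (-(‖x‖ ^ 2) / 2)) * (2 * gaussMeasure V K)
        = ∫⁻ y in K, ENNReal.ofReal (Real.exp (-(‖x‖ ^ 2) / 2)) * (2 * gaussWeight y) := by
          rw [lintegral_const_mul _ (measurable_gaussWeight.const_mul _),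
            lintegral_const_mul _ measurable_gaussWeight, gaussMeasure, withDensity_apply _ hK]
      _ ≤ ∫⁻ y in K, (gaussWeight (x + y) + gaussWeight (x - y)) :=
          lintegral_mono fun y => gaussWeight_shift x y
      _ = 2 * gaussMeasure V {y | y - x ∈ K} := by
          rw [lintegral_add_left (f := fun y => gaussWeight (x + y))
            (measurable_gaussWeight.comp (measurable_const_add x)), ← e2,
            ← e1, two_mul]
  rw [mul_left_comm] at e3
  exact (ENNReal.mul_le_mul_iff_right (by norm_num) (by norm_num)).1 e3

/-- Change of variables: the Jacobian gives `t ^ dim`, and the density at `t • y` is at least the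
density at `y` as `t ≤ 1`. -/
theorem gaussMeasure_scale (K : Set V) (hK : MeasurableSet K) {t : ℝ} (ht : 0 < t) (ht1 : t ≤ 1) :
    ENNReal.ofReal (t ^ Module.finrank ℝ V) * gaussMeasure V K ≤
      gaussMeasure V {y | t⁻¹ • y ∈ K} := by
  have hm : MeasurableSet {y : V | t⁻¹ • y ∈ K} := (measurable_const_smul t⁻¹) hK
  have hmap := Measure.map_addHaar_smul (volume : Measure V) (r := t⁻¹) (inv_ne_zero ht.ne')
  have e1 : gaussMeasure V {y | t⁻¹ • y ∈ K} =
      ENNReal.ofReal (t ^ Module.finrank ℝ V) * ∫⁻ y in K, gaussWeight (t • y) := by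
    rw [gaussMeasure, withDensity_apply _ hm, ← lintegral_indicator hm, ← lintegral_indicator hK]
    have : ∀ y : V, {y : V | t⁻¹ • y ∈ K}.indicator gaussWeight y =
        (K.indicator fun y => gaussWeight (t • y)) (t⁻¹ • y) := by
      intro y
      by_cases hy : t⁻¹ • y ∈ K <;> simp [indicator, hy, smul_smul, ht.ne']
    rw [lintegral_congr this, ← lintegral_map (f := K.indicator fun y => gaussWeight (t • y))
      (g := fun y : V => t⁻¹ • y) _ (measurable_const_smul t⁻¹), hmap, lintegral_smul_measure]
    · congr 2
      rw [inv_pow, inv_inv, abs_of_pos (by positivity)]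
    · exact (measurable_gaussWeight.comp (measurable_const_smul t)).indicator hK
  rw [e1]
  gcongr
  rw [gaussMeasure, withDensity_apply _ hK]
  refine lintegral_mono fun y => ENNReal.ofReal_le_ofReal (Real.exp_le_exp.2 ?_)
  rw [norm_smul, Real.norm_of_nonneg ht.le]
  have : t ^ 2 ≤ 1 := pow_le_one₀ ht.le ht1
  nlinarith [sq_nonneg ‖y‖]

/-- Exponential tilting: on the half-space the density is dominated by the density recentred at `s •
θ`. The choice `s = T / c ^ 2` optimises the factor. -/
theorem gaussMeasure_tail (θ : V) {c T : ℝ} (hc : 0 < c) (hT : 0 < T) (hθ : ‖θ‖ ≤ c) :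
    gaussMeasure V {y | T ≤ inner ℝ θ y} ≤
      ENNReal.ofReal (Real.exp (-(T ^ 2) / (2 * c ^ 2))) * gaussMeasure V univ := by
  have hm : MeasurableSet {y : V | T ≤ inner ℝ θ y} :=
    measurableSet_le measurable_const (by fun_prop)
  set s : ℝ := T / c ^ 2 with hs
  have hs0 : 0 < s := by positivity
  rw [gaussMeasure, withDensity_apply _ hm, withDensity_apply _ MeasurableSet.univ,
    setLIntegral_univ, ← lintegral_indicator hm,
    ← lintegral_sub_right_eq_self (gaussWeight (V := V)) (s • θ),
    ← lintegral_const_mul (f := fun x => gaussWeight (x - s • θ)) _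
      (measurable_gaussWeight.comp (measurable_id.sub_const _))]
  refine lintegral_mono fun y => ?_
  by_cases hy : T ≤ inner ℝ θ y
  · rw [indicator_of_mem (by exact hy)]
    unfold gaussWeight
    rw [← ENNReal.ofReal_mul (by positivity), ← Real.exp_add]
    refine ENNReal.ofReal_le_ofReal (Real.exp_le_exp.2 ?_)
    rw [norm_sub_sq_real, norm_smul, Real.norm_of_nonneg hs0.le, inner_smul_right,
      real_inner_comm]
    have h1 : s * T ≤ s * inner ℝ θ y := by gcongr
    have h2 : (s * ‖θ‖) ^ 2 ≤ (s * c) ^ 2 := by gcongr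
    have h3 : s * c ^ 2 = T := by rw [hs]; field_simp
    have h4 : -T ^ 2 / (2 * c ^ 2) = -(s * T / 2) := by rw [hs]; field_simp
    have h5 : (s * c) ^ 2 = s * T := by rw [← h3]; ring
    rw [h4]
    linarith
  · rw [indicator_of_notMem (by exact hy)]
    exact zero_le

/-- Dual Sudakov / volumetric bound for sets separated with respect to a seminorm. -/
theorem card_le_of_seminorm_separated (N : Seminorm ℝ V) (hN : Continuous N) {T : ℝ}
    (hG : gaussMeasure V univ ≤ 2 * gaussMeasure V {x | N x ≤ T}) (s : Finset V)
    (hs : ∀ x ∈ s, ‖x‖ ≤ 1) {ρ : ℝ} (hsep : ∀ x ∈ s, ∀ y ∈ s, x ≠ y → ρ < N (x - y))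
    {v t : ℝ} (hv : 0 < v) (ht : 0 < t) (ht1 : t ≤ 1) (hρ : T * t ≤ v * ρ / 2) :
    (s.card : ℝ) ≤ 2 * (t ^ Module.finrank ℝ V)⁻¹ * Real.exp (v ^ 2 / 2) := by
  set K : Set V := {x | N x ≤ T} with hKdef
  have hK : MeasurableSet K := (isClosed_le hN continuous_const).measurableSet
  set K' : Set V := {y | t⁻¹ • y ∈ K} with hK'def
  have hK' : MeasurableSet K' := (measurable_const_smul t⁻¹) hK
  have hmem : ∀ y, y ∈ K' ↔ N y ≤ T * t := by
    intro y
    simp only [hK'def, hKdef, mem_ofPred_eq, map_smul_eq_mul, norm_inv, Real.norm_of_nonneg ht.le]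
    rw [inv_mul_le_iff₀ ht, mul_comm]
  have hsym : ∀ y, -y ∈ K' ↔ y ∈ K' := by
    intro y; rw [hmem, hmem, map_neg_eq_map]
  -- The points are dilated by `v`, so their `N`-distance exceeds `v ρ`, at least twice the
  -- `N`-radius `T t` of `K'`. Disjoint translates of `K'`, each of mass at least `exp (-v ^ 2 / 2)
  -- t ^ dim / 2` of the total, can then be counted.
  have hdisj : Set.PairwiseDisjoint (s : Set V) fun x => {y | y - v • x ∈ K'} := by
    intro x hx y hy hxy
    rw [Function.onFun, Set.disjoint_left]
    intro z hzx hzy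
    simp only [mem_ofPred_eq, hmem] at hzx hzy
    have h1 : N (v • (x - y)) ≤ N (z - v • y) + N (z - v • x) := by
      have : v • (x - y) = (z - v • y) - (z - v • x) := by rw [smul_sub]; abel
      rw [this]; exact map_sub_le_add N _ _
    rw [map_smul_eq_mul, Real.norm_of_nonneg hv.le] at h1
    have h2 := hsep x hx y hy hxy
    have h3 : v * ρ < v * N (x - y) := by gcongr
    linarith
  have hsum : ∑ x ∈ s, gaussMeasure V {y | y - v • x ∈ K'} ≤ gaussMeasure V univ := by
    rw [← measure_biUnion_finset hdisj (fun x _ => (measurable_id.sub_const _) hK')]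
    exact measure_mono (subset_univ _)
  have hlow : ∀ x ∈ s, ENNReal.ofReal (Real.exp (-(v ^ 2) / 2) * t ^ Module.finrank ℝ V / 2)
      * gaussMeasure V univ ≤ gaussMeasure V {y | y - v • x ∈ K'} := by
    intro x hx
    refine le_trans ?_ (gaussMeasure_translate K' hK' hsym (v • x))
    have h1 := gaussMeasure_scale K hK ht ht1
    have h2 : ENNReal.ofReal (Real.exp (-(v ^ 2) / 2)) ≤
        ENNReal.ofReal (Real.exp (-(‖v • x‖ ^ 2) / 2)) := by
      refine ENNReal.ofReal_le_ofReal (Real.exp_le_exp.2 ?_)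
      rw [norm_smul, Real.norm_of_nonneg hv.le]
      have := hs x hx
      have : (v * ‖x‖) ^ 2 ≤ (v * 1) ^ 2 := by gcongr
      linarith
    calc _ ≤ ENNReal.ofReal (Real.exp (-(v ^ 2) / 2) * t ^ Module.finrank ℝ V / 2)
          * (2 * gaussMeasure V K) := by gcongr
      _ = ENNReal.ofReal (Real.exp (-(v ^ 2) / 2)) *
          (ENNReal.ofReal (t ^ Module.finrank ℝ V) * gaussMeasure V K) := by
          rw [← mul_assoc, ← mul_assoc, ← ENNReal.ofReal_mul (by positivity),
            show (2 : ℝ≥0∞) = ENNReal.ofReal 2 by simp, ← ENNReal.ofReal_mul (by positivity)]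
          congr 2; ring
      _ ≤ _ := mul_le_mul' h2 h1
  have hfin := (Finset.sum_le_sum hlow).trans hsum
  rw [Finset.sum_const, nsmul_eq_mul, ← mul_assoc] at hfin
  have h1 : (s.card : ℝ≥0∞) *
      ENNReal.ofReal (Real.exp (-(v ^ 2) / 2) * t ^ Module.finrank ℝ V / 2) ≤ 1 := by
    rw [← ENNReal.mul_le_mul_iff_left gaussMeasure_univ_ne_zero
      (gaussMeasure_univ_ne_top (V := V)), one_mul]
    exact hfin
  rw [← ENNReal.ofReal_natCast, ← ENNReal.ofReal_mul (by positivity), ← ENNReal.ofReal_one,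
    ENNReal.ofReal_le_ofReal_iff (by norm_num)] at h1
  have h2 : Real.exp (-(v ^ 2) / 2) = (Real.exp (v ^ 2 / 2))⁻¹ := by
    rw [← Real.exp_neg]; congr 1; ring
  rw [h2] at h1
  have h3 : 0 < Real.exp (v ^ 2 / 2) := Real.exp_pos _
  have h4 : 0 < t ^ Module.finrank ℝ V := by positivity
  field_simp at h1 ⊢
  linarith

end Packing

/-! ### Spectral and Frobenius norms; nets of matrices. -/

section MatrixNorms

variable {p q : ℕ}

theorem frob_nonneg {ι κ : Type*} [Fintype ι] [Fintype κ] (A : Matrix ι κ ℝ) : 0 ≤ frob A :=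
  Real.sqrt_nonneg _

theorem frob_sq {ι κ : Type*} [Fintype ι] [Fintype κ] (A : Matrix ι κ ℝ) :
    frob A ^ 2 = ∑ i, ∑ j, A i j ^ 2 :=
  Real.sq_sqrt (Finset.sum_nonneg fun _ _ => Finset.sum_nonneg fun _ _ => sq_nonneg _)

theorem frob_zero {ι κ : Type*} [Fintype ι] [Fintype κ] : frob (0 : Matrix ι κ ℝ) = 0 := by
  simp [frob]

theorem continuous_frob {ι κ : Type*} [Fintype ι] [Fintype κ] :
    Continuous (frob : Matrix ι κ ℝ → ℝ) := by
  unfold frob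
  refine Real.continuous_sqrt.comp (continuous_finsetSum _ fun i _ => continuous_finsetSum _
    fun j _ => (continuous_id.matrix_elem i j).pow 2)

theorem spec_nonneg (A : Matrix (Fin p) (Fin q) ℝ) : 0 ≤ spec A := norm_nonneg _

theorem spec_zero : spec (0 : Matrix (Fin p) (Fin q) ℝ) = 0 := by simp [spec]

theorem spec_smul (c : ℝ) (A : Matrix (Fin p) (Fin q) ℝ) : spec (c • A) = |c| * spec A := by
  simp [spec, norm_smul]

theorem norm_toEuclideanLin_le (A : Matrix (Fin p) (Fin q) ℝ) (u : Vec q) :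
    ‖Matrix.toEuclideanLin A u‖ ≤ spec A * ‖u‖ :=
  (Matrix.toEuclideanLin A).toContinuousLinearMap.le_opNorm u

theorem continuous_spec : Continuous (spec : Matrix (Fin p) (Fin q) ℝ → ℝ) := by
  have h : Continuous ((LinearMap.toContinuousLinearMap (𝕜 := ℝ) (E := Vec q) (F' := Vec p)).toLinearMap
      ∘ₗ (Matrix.toEuclideanLin (𝕜 := ℝ) (m := Fin p) (n := Fin q)).toLinearMap) :=
    LinearMap.continuous_of_finiteDimensional _
  exact continuous_norm.comp h

/-- The matrix with given entries, as a linear map on the Euclidean space of all entries. -/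
def matOfVec (p q : ℕ) : EuclideanSpace ℝ (Fin p × Fin q) →ₗ[ℝ] Matrix (Fin p) (Fin q) ℝ where
  toFun x := Matrix.of fun i j => x (i, j)
  map_add' x y := by ext; simp
  map_smul' c x := by ext; simp

/-- The entries of a matrix. -/
def vecOfMat (A : Matrix (Fin p) (Fin q) ℝ) : EuclideanSpace ℝ (Fin p × Fin q) :=
  WithLp.toLp 2 fun ij => A ij.1 ij.2

theorem matOfVec_vecOfMat (A : Matrix (Fin p) (Fin q) ℝ) : matOfVec p q (vecOfMat A) = A := by
  ext i j; simp [matOfVec, vecOfMat]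

theorem frob_matOfVec (x : EuclideanSpace ℝ (Fin p × Fin q)) : frob (matOfVec p q x) = ‖x‖ := by
  rw [frob, EuclideanSpace.norm_eq, Fintype.sum_prod_type]
  simp [matOfVec]

theorem norm_vecOfMat (A : Matrix (Fin p) (Fin q) ℝ) : ‖vecOfMat A‖ = frob A := by
  rw [← frob_matOfVec, matOfVec_vecOfMat]

/-- The spectral norm as a seminorm on the Euclidean space of all entries. -/
def specSeminorm (p q : ℕ) : Seminorm ℝ (EuclideanSpace ℝ (Fin p × Fin q)) :=
  (normSeminorm ℝ (Vec q →L[ℝ] Vec p)).comp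
    ((LinearMap.toContinuousLinearMap (𝕜 := ℝ) (E := Vec q) (F' := Vec p)).toLinearMap
      ∘ₗ (Matrix.toEuclideanLin (𝕜 := ℝ) (m := Fin p) (n := Fin q)).toLinearMap ∘ₗ matOfVec p q)

theorem specSeminorm_apply (x : EuclideanSpace ℝ (Fin p × Fin q)) :
    specSeminorm p q x = spec (matOfVec p q x) := rfl

theorem continuous_matOfVec : Continuous (matOfVec p q) :=
  LinearMap.continuous_of_finiteDimensional _

theorem continuous_specSeminorm : Continuous (specSeminorm p q) :=
  continuous_spec.comp continuous_matOfVec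

theorem inner_toEuclideanLin (x : EuclideanSpace ℝ (Fin p × Fin q)) (u : Vec p) (v : Vec q) :
    inner ℝ u (Matrix.toEuclideanLin (matOfVec p q x) v) =
      inner ℝ (vecOfMat (Matrix.of fun i j => u i * v j)) x := by
  simp only [PiLp.inner_apply, Fintype.sum_prod_type, vecOfMat, Matrix.of_apply, matOfVec]
  refine Finset.sum_congr rfl fun i _ => ?_
  simp only [RCLike.inner_apply, conj_trivial, Matrix.toLpLin_apply, Matrix.mulVec, dotProduct,
    LinearMap.coe_mk, AddHom.coe_mk, Matrix.of_apply]
  rw [Finset.sum_mul]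
  refine Finset.sum_congr rfl fun j _ => ?_
  ring

theorem frob_outer (u : Vec p) (v : Vec q) :
    frob (Matrix.of fun i j => u i * v j) = ‖u‖ * ‖v‖ := by
  rw [frob, EuclideanSpace.norm_eq, EuclideanSpace.norm_eq, ← Real.sqrt_mul (by positivity),
    Finset.sum_mul_sum]
  congr 1
  refine Finset.sum_congr rfl fun i _ => Finset.sum_congr rfl fun j _ => ?_
  simp [mul_pow]

/-- If a net of the ball of radius `2` controls the inner products, it controls the
norm. -/
theorem norm_le_of_forall_inner_le {V : Type*} [NormedAddCommGroup V] [InnerProductSpace ℝ V]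
    {N : Set V} (hN : ∀ x : V, ‖x‖ ≤ 2 → ∃ c ∈ N, ‖x - c‖ < 1) {y : V} {M : ℝ}
    (h : ∀ c ∈ N, inner ℝ c y ≤ M) : ‖y‖ ≤ M := by
  by_cases hy : y = 0
  · obtain ⟨c, hc, -⟩ := hN 0 (by simp)
    simpa [hy] using h c hc
  have hy' : 0 < ‖y‖ := norm_pos_iff.2 hy
  obtain ⟨c, hc, hlt⟩ := hN ((2 / ‖y‖) • y) (by
    rw [norm_smul, Real.norm_of_nonneg (by positivity)]; field_simp; rfl)
  have h1 : inner ℝ ((2 / ‖y‖) • y) y = 2 * ‖y‖ := by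
    rw [inner_smul_left, real_inner_self_eq_norm_sq]; simp; field_simp
  have h2 : inner ℝ ((2 / ‖y‖) • y - c) y ≤ 1 * ‖y‖ :=
    (real_inner_le_norm _ _).trans (by gcongr)
  rw [inner_sub_left, h1] at h2
  linarith [h c hc]

/-- A finite family with bounded separated subsets has a maximal separated subset. -/
theorem exists_maximal_separated {V : Type*} (B : Set V) (r : V → V → Prop) (m : ℕ)
    (hrefl : ∀ x, ¬ r x x) (hsymm : ∀ x y, r x y → r y x)
    (hm : ∀ s : Finset V, (∀ x ∈ s, x ∈ B) → (∀ x ∈ s, ∀ y ∈ s, x ≠ y → r x y) → s.card ≤ m) :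
    ∃ s : Finset V, (∀ x ∈ s, x ∈ B) ∧ (∀ x ∈ s, ∀ y ∈ s, x ≠ y → r x y) ∧
      ∀ x ∈ B, ∃ c ∈ s, ¬ r x c := by
  classical
  let Q : ℕ → Prop := fun k => ∃ s : Finset V, (∀ x ∈ s, x ∈ B) ∧
    (∀ x ∈ s, ∀ y ∈ s, x ≠ y → r x y) ∧ s.card = k
  have h0 : Q 0 := ⟨∅, by simp, by simp, rfl⟩
  obtain ⟨s, hsB, hss, hsc⟩ := Nat.findGreatest_spec (P := Q) (Nat.zero_le m) h0
  refine ⟨s, hsB, hss, fun x hx => ?_⟩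
  by_contra! hcon
  have hxs : x ∉ s := fun h => hrefl x (hcon x h)
  have hQ : Q (s.card + 1) := by
    refine ⟨insert x s, ?_, ?_, Finset.card_insert_of_notMem hxs⟩
    · intro y hy
      rcases Finset.mem_insert.1 hy with rfl | hy
      exacts [hx, hsB y hy]
    · intro y hy z hz hyz
      rcases Finset.mem_insert.1 hy with hyx | hys <;>
        rcases Finset.mem_insert.1 hz with hzx | hzs
      · exact absurd (hyx.trans hzx.symm) hyz
      · exact hyx ▸ hcon z hzs
      · exact hzx ▸ hsymm _ _ (hcon y hys)
      · exact hss y hys z hzs hyz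
  have hle : s.card + 1 ≤ m := by
    obtain ⟨s', h1, h2, h3⟩ := hQ
    exact h3 ▸ hm s' h1 h2
  have := Nat.le_findGreatest hle hQ
  omega

theorem exists_ball_net (k : ℕ) : ∃ N : Finset (Vec k), N.card ≤ 5 ^ k ∧ (∀ x ∈ N, ‖x‖ ≤ 2) ∧
    ∀ x : Vec k, ‖x‖ ≤ 2 → ∃ c ∈ N, ‖x - c‖ < 1 := by
  have hcard : ∀ s : Finset (Vec k), (∀ x ∈ s, ‖x‖ ≤ 2) →
      (∀ x ∈ s, ∀ y ∈ s, x ≠ y → 1 ≤ ‖x - y‖) → s.card ≤ 5 ^ k := by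
    intro s h1 h2
    simpa using Besicovitch.card_le_of_separated s h1 h2
  obtain ⟨s, h1, h2, h3⟩ := exists_maximal_separated {x : Vec k | ‖x‖ ≤ 2}
    (fun x y => 1 ≤ ‖x - y‖) (5 ^ k) (by simp) (fun x y h => by rwa [norm_sub_rev]) hcard
  exact ⟨s, hcard s h1 h2, h1, fun x hx => by simpa using h3 x hx⟩

/-- A Gaussian matrix has spectral norm of order `√p + √q`. -/
theorem gaussMeasure_spec_le (hpq : 1 ≤ p + q) :
    gaussMeasure (EuclideanSpace ℝ (Fin p × Fin q)) univ ≤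
      2 * gaussMeasure _ {x | specSeminorm p q x ≤ 16 * Real.sqrt (p + q)} := by
  set T : ℝ := 16 * Real.sqrt (p + q) with hTdef
  have hpq' : (1 : ℝ) ≤ (p : ℝ) + q := by exact_mod_cast hpq
  have hT : 0 < T := by positivity
  obtain ⟨N, hNc, hN2, hN⟩ := exists_ball_net p
  obtain ⟨N', hNc', hN2', hN'⟩ := exists_ball_net q
  set E := EuclideanSpace ℝ (Fin p × Fin q)
  set K : Set E := {x | specSeminorm p q x ≤ T} with hK
  let bad : Vec p × Vec q → Set E := fun uv =>
    {y | T ≤ inner ℝ (vecOfMat (Matrix.of fun i j => uv.1 i * uv.2 j)) y}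
  have hcov : Kᶜ ⊆ ⋃ uv ∈ N ×ˢ N', bad uv := by
    intro x hx
    by_contra hcon
    apply hx
    simp only [mem_iUnion, not_exists, bad, mem_ofPred_eq, not_le, Finset.mem_product] at hcon
    have hA : ∀ u ∈ N, ∀ v ∈ N',
        inner ℝ u (Matrix.toEuclideanLin (matOfVec p q x) v) ≤ T := by
      intro u hu v hv
      rw [inner_toEuclideanLin]
      exact (hcon (u, v) ⟨hu, hv⟩).le
    rw [hK, mem_ofPred_eq, specSeminorm_apply]
    refine ContinuousLinearMap.opNorm_le_bound _ hT.le fun v => ?_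
    set A := (Matrix.toEuclideanLin (matOfVec p q x)).toContinuousLinearMap
    -- The discretisation is applied twice: to the output `A v` here, and then to the adjoint image
    -- of each net point `u`.
    refine norm_le_of_forall_inner_le (N := (N : Set (Vec p))) hN fun u hu => ?_
    rw [← ContinuousLinearMap.adjoint_inner_left]
    refine (real_inner_le_norm _ _).trans ?_
    gcongr
    refine norm_le_of_forall_inner_le (N := (N' : Set (Vec q))) hN' fun w hw => ?_
    rw [real_inner_comm, ContinuousLinearMap.adjoint_inner_left]
    exact hA u hu w hw
  have hbad : ∀ uv ∈ N ×ˢ N', gaussMeasure E (bad uv) ≤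
      ENNReal.ofReal (Real.exp (-(8 * ((p : ℝ) + q)))) * gaussMeasure E univ := by
    intro uv huv
    rw [Finset.mem_product] at huv
    have h1 : ‖vecOfMat (Matrix.of fun i j => uv.1 i * uv.2 j)‖ ≤ 4 := by
      rw [norm_vecOfMat, frob_outer]
      have := mul_le_mul (hN2 _ huv.1) (hN2' _ huv.2) (norm_nonneg _) (by norm_num)
      linarith
    have h2 := gaussMeasure_tail (V := E) _ (by norm_num : (0 : ℝ) < 4) hT h1
    refine h2.trans_eq ?_
    congr 3
    rw [hTdef, mul_pow, Real.sq_sqrt (by positivity)]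
    ring
  -- Union bound: at most `5 ^ (p + q)` pairs of net points. As `‖u vᵀ‖ ≤ 4` and `T = 16 √(p + q)`,
  -- each has relative mass at most `exp (-T ^ 2 / 32) = exp (-8 (p + q))`.
  have hsmall : ((N ×ˢ N').card : ℝ) * Real.exp (-(8 * ((p : ℝ) + q))) ≤ 1 / 2 := by
    have h1 : ((N ×ˢ N').card : ℝ) ≤ 5 ^ (p + q) := by
      rw [Finset.card_product, pow_add]
      exact_mod_cast Nat.mul_le_mul hNc hNc'
    have h2 : (5 : ℝ) ^ (p + q) ≤ Real.exp (7 * ((p : ℝ) + q)) := by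
      rw [mul_comm, ← Nat.cast_add, Real.exp_nat_mul]
      gcongr
      linarith [Real.add_one_le_exp (7 : ℝ)]
    have h3 : Real.exp (-((p : ℝ) + q)) ≤ 1 / 2 := by
      have := Real.add_one_le_exp ((p : ℝ) + q)
      rw [Real.exp_neg, one_div]
      exact inv_anti₀ (by norm_num) (by linarith)
    calc _ ≤ Real.exp (7 * ((p : ℝ) + q)) * Real.exp (-(8 * ((p : ℝ) + q))) := by
          gcongr; exact h1.trans h2
      _ = Real.exp (-((p : ℝ) + q)) := by rw [← Real.exp_add]; congr 1; ring
      _ ≤ _ := h3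
  have hKm : MeasurableSet K :=
    (isClosed_le continuous_specSeminorm continuous_const).measurableSet
  have hcompl : gaussMeasure E Kᶜ ≤ 2⁻¹ * gaussMeasure E univ := by
    calc gaussMeasure E Kᶜ ≤ ∑ uv ∈ N ×ˢ N', gaussMeasure E (bad uv) :=
          (measure_mono hcov).trans (measure_biUnion_finset_le _ _)
      _ ≤ ∑ uv ∈ N ×ˢ N', ENNReal.ofReal (Real.exp (-(8 * ((p : ℝ) + q)))) *
          gaussMeasure E univ := Finset.sum_le_sum hbad
      _ = ENNReal.ofReal (((N ×ˢ N').card : ℝ) * Real.exp (-(8 * ((p : ℝ) + q)))) *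
          gaussMeasure E univ := by
          rw [Finset.sum_const, nsmul_eq_mul, ← mul_assoc, ENNReal.ofReal_mul (by positivity),
            ENNReal.ofReal_natCast]
      _ ≤ 2⁻¹ * gaussMeasure E univ := by
          gcongr
          refine (ENNReal.ofReal_le_ofReal hsmall).trans_eq ?_
          rw [one_div, ENNReal.ofReal_inv_of_pos (by norm_num)]; simp
  have hsplit := measure_add_measure_compl (μ := gaussMeasure E) hKm
  have hfin : 2⁻¹ * gaussMeasure E univ ≠ ∞ :=
    ENNReal.mul_ne_top (by simp) gaussMeasure_univ_ne_top
  have h3 : 2⁻¹ * gaussMeasure E univ + 2⁻¹ * gaussMeasure E univ ≤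
      gaussMeasure E K + 2⁻¹ * gaussMeasure E univ := by
    rw [← add_mul, ENNReal.inv_two_add_inv_two, one_mul]
    exact hsplit.symm.le.trans (by gcongr)
  have h4 := (ENNReal.add_le_add_iff_right hfin).1 h3
  calc gaussMeasure E univ = 2 * (2⁻¹ * gaussMeasure E univ) := by
        rw [← mul_assoc, ENNReal.mul_inv_cancel (by norm_num) (by norm_num), one_mul]
    _ ≤ _ := by gcongr

theorem spec_le_frob (A : Matrix (Fin p) (Fin q) ℝ) : spec A ≤ frob A := by
  refine ContinuousLinearMap.opNorm_le_bound _ (frob_nonneg A) fun v => ?_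
  refine le_of_sq_le_sq ?_ (by have := frob_nonneg A; positivity)
  rw [mul_pow, frob_sq, EuclideanSpace.real_norm_sq_eq, EuclideanSpace.real_norm_sq_eq,
    Finset.sum_mul]
  refine Finset.sum_le_sum fun i _ => ?_
  simpa [Matrix.mulVec, dotProduct] using
    Finset.sum_mul_sq_le_sq_mul_sq Finset.univ (fun j => A i j) (fun j => v j)

theorem spec_sub_comm (A B : Matrix (Fin p) (Fin q) ℝ) : spec (A - B) = spec (B - A) := by
  simp only [spec, map_sub]
  exact norm_sub_rev _ _

/-- A finite cover of the Frobenius ball by sets of small spectral diameter. -/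
theorem exists_spec_separated (hp : 1 ≤ p) (hq : 1 ≤ q) (k : ℕ) :
    ∃ s : Finset (EuclideanSpace ℝ (Fin p × Fin q)), (∀ x ∈ s, ‖x‖ ≤ 1) ∧
      (∀ x, ‖x‖ ≤ 1 → ∃ c ∈ s, specSeminorm p q (x - c) ≤ (2 ^ (k + 1))⁻¹) ∧
      ∀ m : ℕ, Real.log s.card ≤ 4100 * (((p : ℝ) + q) * (4 ^ k / 4 ^ m + q * m)) := by
  have hp' : (1 : ℝ) ≤ p := by exact_mod_cast hp
  have hq' : (1 : ℝ) ≤ q := by exact_mod_cast hq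
  set E := EuclideanSpace ℝ (Fin p × Fin q)
  have hfr : Module.finrank ℝ E = p * q := by simp [E]
  have hcard : ∀ s : Finset E, (∀ x ∈ s, ‖x‖ ≤ 1) →
      (∀ x ∈ s, ∀ y ∈ s, x ≠ y → (2 ^ (k + 1))⁻¹ < specSeminorm p q (x - y)) →
      ∀ m ≤ k, (s.card : ℝ) ≤ 2 * 2 ^ (m * (p * q)) *
        Real.exp (2048 * (((p : ℝ) + q) * (4 ^ k / 4 ^ m))) := by
    intro s h1 h2 m hm
    -- With `T = 16 √(p + q)` and `ρ = 2 ^ (-(k + 1))` these `v` and `t` give equality in `T t = v ρ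
    -- / 2`. The exponent `v ^ 2 / 2` is `2048 (p + q) 4 ^ k / 4 ^ m`, and `t` contributes `2 ^ (m p
    -- q)`.
    have h := card_le_of_seminorm_separated (specSeminorm p q) continuous_specSeminorm
      (gaussMeasure_spec_le (by omega)) s h1 h2
      (v := 64 * Real.sqrt (p + q) * (2 ^ k / 2 ^ m)) (t := (2 ^ m)⁻¹) (by positivity)
      (by positivity) (inv_le_one_of_one_le₀ (one_le_pow₀ (by norm_num))) (by
        apply le_of_eq; field_simp; ring)
    refine h.trans_eq ?_
    rw [hfr, inv_pow, inv_inv, ← pow_mul]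
    congr 2
    rw [mul_pow, mul_pow, Real.sq_sqrt (by positivity), div_pow, ← pow_mul, ← pow_mul,
      mul_comm k, mul_comm m, pow_mul, pow_mul]
    norm_num
    ring
  obtain ⟨N, hN⟩ := exists_nat_ge (2 * 2 ^ (0 * (p * q)) *
        Real.exp (2048 * (((p : ℝ) + q) * (4 ^ k / 4 ^ 0))))
  obtain ⟨s, h1, h2, h3⟩ := exists_maximal_separated {x : E | ‖x‖ ≤ 1}
    (fun x y => (2 ^ (k + 1))⁻¹ < specSeminorm p q (x - y)) N
    (by intro x; simp) (fun x y h => by rwa [map_sub_rev]) (fun s h1 h2 => by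
      exact_mod_cast (hcard s h1 h2 0 (Nat.zero_le _)).trans hN)
  refine ⟨s, h1, fun x hx => by simpa using h3 x hx, fun m => ?_⟩
  have hpos : (0 : ℝ) < s.card := by
    obtain ⟨c, hc, -⟩ := h3 0 (by simp)
    exact_mod_cast Finset.card_pos.2 ⟨c, hc⟩
  have hlog : ∀ m ≤ k, Real.log s.card ≤ 2049 * (((p : ℝ) + q) * (4 ^ k / 4 ^ m + q * m)) := by
    intro m hm
    have h := Real.log_le_log hpos (hcard s h1 h2 m hm)
    rw [Real.log_mul (by positivity) (by positivity), Real.log_mul (by positivity) (by positivity),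
      Real.log_exp, Real.log_pow] at h
    have h2l : Real.log 2 ≤ 1 := by have := Real.log_two_lt_d9; linarith
    have h5 : (1 : ℝ) ≤ 4 ^ k / 4 ^ m := by
      rw [one_le_div (by positivity)]
      exact pow_le_pow_right₀ (by norm_num) hm
    have h6 : ((m * (p * q) : ℕ) : ℝ) * Real.log 2 ≤ ((p : ℝ) + q) * (q * m) := by
      push_cast
      calc (m : ℝ) * (p * q) * Real.log 2 ≤ (m : ℝ) * (p * q) * 1 := by gcongr
        _ ≤ (m : ℝ) * ((p + q) * q) * 1 := by gcongr; linarith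
        _ = _ := by ring
    have h7 : (1 : ℝ) * 1 ≤ ((p : ℝ) + q) * (4 ^ k / 4 ^ m) := by gcongr; linarith
    have h8 : 0 ≤ ((p : ℝ) + q) * (q * m) := by positivity
    linarith
  have hnn : ∀ m : ℕ, (0 : ℝ) ≤ ((p : ℝ) + q) * (4 ^ k / 4 ^ m + q * m) := fun m => by positivity
  rcases le_or_gt m k with hm | hm
  · linarith [hlog m hm, hnn m]
  -- For `m > k` the bound at `m = k` is enough, up to a factor two; this is why 2049 becomes 4100.
  · refine (hlog k le_rfl).trans ?_
    have h1m : (1 : ℝ) ≤ m := by exact_mod_cast (by omega : 1 ≤ m)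
    have hkm : (k : ℝ) ≤ m := by exact_mod_cast hm.le
    rw [div_self (by positivity)]
    have h9 : (1 : ℝ) + q * k ≤ 2 * (4 ^ k / 4 ^ m + q * m) := by
      have : (q : ℝ) * k ≤ q * m := by gcongr
      have : (1 : ℝ) * 1 ≤ q * m := by gcongr
      have : (0 : ℝ) ≤ 4 ^ k / 4 ^ m := by positivity
      linarith
    have := mul_le_mul_of_nonneg_left h9 (by positivity : (0 : ℝ) ≤ (p : ℝ) + q)
    have := hnn m
    linarith

/-- Nets of Frobenius balls in the spectral norm, of dimension-free size at large scales, whose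
points do not increase a given continuous function. -/
theorem exists_matrix_nets (hp : 1 ≤ p) (hq : 1 ≤ q) :
    ∃ c : ℕ → ℕ, (∀ k, 1 ≤ c k) ∧ c 0 = 1 ∧
      (∀ k m : ℕ, Real.log (c k) ≤ 4100 * (((p : ℝ) + q) * (4 ^ k / 4 ^ m + q * m))) ∧
      ∀ (φ : Matrix (Fin p) (Fin q) ℝ → ℝ), Continuous φ → (∀ V, φ 0 ≤ φ V) →
        ∀ r : ℝ, 0 < r → ∀ k : ℕ, ∃ rep : Fin (c k) → Matrix (Fin p) (Fin q) ℝ,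
          ∀ V, frob V ≤ r → ∃ t, φ (rep t) ≤ φ V ∧ spec (rep t - V) ≤ r / 2 ^ k := by
  choose s hs1 hs2 hs3 using exists_spec_separated (p := p) (q := q) hp hq
  have hpos : ∀ k, 1 ≤ (s k).card := by
    intro k
    obtain ⟨c, hc, -⟩ := hs2 k 0 (by simp)
    exact Finset.card_pos.2 ⟨c, hc⟩
  refine ⟨fun k => if k = 0 then 1 else (s k).card, ?_, by simp, ?_, ?_⟩
  · intro k
    dsimp only
    split_ifs
    exacts [le_rfl, hpos k]
  · intro k m
    dsimp only
    split_ifs with hk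
    · simp only [Nat.cast_one, Real.log_one]
      positivity
    · exact hs3 k m
  · intro φ hφ h0 r hr k
    -- At scale zero the single net point is the zero matrix. It costs no entropy, so layers that
    -- need no accuracy are free later on.
    by_cases hk : k = 0
    · subst hk
      refine ⟨fun _ => 0, fun V hV => ⟨⟨0, by simp⟩, h0 V, ?_⟩⟩
      rw [spec_sub_comm, sub_zero, pow_zero, div_one]
      exact (spec_le_frob V).trans hV
    · have hck : (if k = 0 then 1 else (s k).card) = (s k).card := if_neg hk
      dsimp only
      rw [hck]
      -- In each cell the representative minimises `φ` over the compact part of the cell in the ball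
      -- of radius `r`. It depends on the cell alone and has `φ`-value at most that of any `V` in
      -- the cell. The cell radius `r / 2 ^ (k + 1)` is half the accuracy aimed at, since the
      -- minimiser may move away from the centre.
      have hmin : ∀ c : s k, ∃ y : EuclideanSpace ℝ (Fin p × Fin q), specSeminorm p q (y - r • c.1) ≤ r / 2 ^ (k + 1) ∧
          ∀ x : EuclideanSpace ℝ (Fin p × Fin q), ‖x‖ ≤ r → specSeminorm p q (x - r • c.1) ≤ r / 2 ^ (k + 1) →
            φ (matOfVec p q y) ≤ φ (matOfVec p q x) := by
        intro c
        have hcl : IsClosed {x : EuclideanSpace ℝ (Fin p × Fin q) | specSeminorm p q (x - r • c.1) ≤ r / 2 ^ (k + 1)} :=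
          isClosed_le (continuous_specSeminorm.comp (continuous_id.sub continuous_const))
            continuous_const
        have hcomp := (isCompact_closedBall (0 : EuclideanSpace ℝ (Fin p × Fin q)) r).inter_right hcl
        obtain ⟨y, hy, hym⟩ := hcomp.exists_isMinOn (f := fun x => φ (matOfVec p q x))
          ⟨r • c.1, by
            rw [mem_closedBall_zero_iff, norm_smul, Real.norm_of_nonneg hr.le]
            have := hs1 k c c.2
            nlinarith, by
            simp only [mem_ofPred_eq, sub_self, map_zero]
            positivity⟩ (hφ.comp continuous_matOfVec).continuousOn
        exact ⟨y, hy.2, fun x hx1 hx2 => hym ⟨by simpa using hx1, hx2⟩⟩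
      choose y hy1 hy2 using hmin
      refine ⟨fun t => matOfVec p q (y ((s k).equivFin.symm t)), fun V hV => ?_⟩
      obtain ⟨c, hc, hcV⟩ := hs2 k (r⁻¹ • vecOfMat V) (by
        rw [norm_smul, norm_vecOfMat, norm_inv, Real.norm_of_nonneg hr.le, inv_mul_le_iff₀ hr]
        linarith)
      have hcV' : specSeminorm p q (vecOfMat V - r • c) ≤ r / 2 ^ (k + 1) := by
        have : vecOfMat V - r • c = r • (r⁻¹ • vecOfMat V - c) := by
          rw [smul_sub, smul_smul, mul_inv_cancel₀ hr.ne', one_smul]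
        rw [this, map_smul_eq_mul, Real.norm_of_nonneg hr.le, div_eq_mul_inv]
        gcongr
      refine ⟨(s k).equivFin ⟨c, hc⟩, ?_, ?_⟩
      · simp only [Equiv.symm_apply_apply]
        conv_rhs => rw [← matOfVec_vecOfMat V]
        exact hy2 ⟨c, hc⟩ _ (by rwa [norm_vecOfMat]) hcV'
      · simp only [Equiv.symm_apply_apply]
        conv_lhs => rw [← matOfVec_vecOfMat V]
        rw [← map_sub, ← specSeminorm_apply]
        have h1 := hy1 ⟨c, hc⟩
        have h2 : specSeminorm p q (y ⟨c, hc⟩ - vecOfMat V) ≤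
            specSeminorm p q (y ⟨c, hc⟩ - r • c) + specSeminorm p q (vecOfMat V - r • c) := by
          have : y ⟨c, hc⟩ - vecOfMat V = (y ⟨c, hc⟩ - r • c) - (vecOfMat V - r • c) := by abel
          rw [this]; exact map_sub_le_add _ _ _
        have h3 : r / 2 ^ (k + 1) + r / 2 ^ (k + 1) = r / 2 ^ k := by
          rw [pow_succ]; field_simp; norm_num
        linarith

end MatrixNorms

/-! ### Symmetrized exponential moments and the chaining event. -/

section Symmetrization

variable {Z : Type*} [MeasurableSpace Z] (P : Measure Z) [IsProbabilityMeasure P]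

/-- Sub-Gaussian compensated exponent of the symmetrized increments of `h`. -/
def compExponent {n : ℕ} (t : ℝ) (h : Z → ℝ) (S S' : Fin n → Z) : ℝ :=
  ∑ i, (t * (h (S' i) - h (S i)) - (t * (h (S' i) - h (S i))) ^ 2 / 2)

/-- The integrand plus its value with `z` and `z'` exchanged is `2 cosh x · exp (-x ^ 2 / 2) ≤ 2`.
The quadratic compensation replaces any variance bound on `h`. -/
theorem lintegral_exp_symm_le_one (t : ℝ) {h : Z → ℝ} (hh : Measurable h) :
    ∫⁻ z, ∫⁻ z', ENNReal.ofReal (Real.exp (t * (h z' - h z) - (t * (h z' - h z)) ^ 2 / 2)) ∂P ∂P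
      ≤ 1 := by
  set f : Z → Z → ℝ≥0∞ := fun z z' =>
    ENNReal.ofReal (Real.exp (t * (h z' - h z) - (t * (h z' - h z)) ^ 2 / 2)) with hf
  have hm : Measurable (Function.uncurry f) := by
    simp only [hf, Function.uncurry_def]
    fun_prop
  have hm' : Measurable fun z => ∫⁻ z', f z z' ∂P := hm.lintegral_prod_right'
  have hswap : ∫⁻ z, ∫⁻ z', f z z' ∂P ∂P = ∫⁻ z, ∫⁻ z', f z' z ∂P ∂P :=
    lintegral_lintegral_swap hm.aemeasurable
  have hpt : ∀ z z', f z z' + f z' z ≤ 2 := by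
    intro z z'
    rw [hf, ← ENNReal.ofReal_add (by positivity) (by positivity),
      show (2 : ℝ≥0∞) = ENNReal.ofReal 2 by simp]
    refine ENNReal.ofReal_le_ofReal ?_
    set x := t * (h z' - h z) with hx
    have hx' : t * (h z - h z') = -x := by rw [hx]; ring
    rw [hx', neg_sq, sub_eq_add_neg, sub_eq_add_neg, Real.exp_add, Real.exp_add]
    have h1 := Real.cosh_le_exp_half_sq x
    rw [Real.cosh_eq] at h1
    have h2 : Real.exp (x ^ 2 / 2) * Real.exp (-(x ^ 2 / 2)) = 1 := by
      rw [← Real.exp_add]; simp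
    have h3 := Real.exp_pos (-(x ^ 2 / 2))
    nlinarith
  have h2 : 2 * ∫⁻ z, ∫⁻ z', f z z' ∂P ∂P ≤ 2 * 1 := by
    calc 2 * ∫⁻ z, ∫⁻ z', f z z' ∂P ∂P
        = ∫⁻ z, ∫⁻ z', f z z' ∂P ∂P + ∫⁻ z, ∫⁻ z', f z' z ∂P ∂P := by rw [← hswap, two_mul]
      _ = ∫⁻ z, ∫⁻ z', (f z z' + f z' z) ∂P ∂P := by
          rw [← lintegral_add_left hm']
          refine lintegral_congr fun z => ?_
          rw [lintegral_add_left (f := f z) (hm.comp measurable_prodMk_left)]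
      _ ≤ ∫⁻ _, ∫⁻ _, 2 ∂P ∂P := lintegral_mono fun z => lintegral_mono fun z' => hpt z z'
      _ = 2 * 1 := by simp
  exact (ENNReal.mul_le_mul_iff_right (by norm_num) (by norm_num)).1 h2

theorem lintegral_pi_prod {n : ℕ} {f : Fin n → Z → ℝ≥0∞} (hf : ∀ i, Measurable (f i)) :
    ∫⁻ S, ∏ i, f i (S i) ∂Measure.pi (fun _ : Fin n => P) = ∏ i, ∫⁻ z, f i z ∂P := by
  have hind := ProbabilityTheory.iIndepFun_pi (μ := fun _ : Fin n => P) (X := f)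
    (fun i => (hf i).aemeasurable)
  rw [ProbabilityTheory.lintegral_prod_eq_prod_lintegral_of_indepFun Finset.univ _ hind
    (fun i => (hf i).comp (measurable_pi_apply i))]
  refine Finset.prod_congr rfl fun i _ => ?_
  exact (measurePreserving_eval (fun _ : Fin n => P) i).lintegral_comp (hf i)

theorem measurable_compExponent {n : ℕ} (t : ℝ) {h : Z → ℝ} (hh : Measurable h) :
    Measurable fun p : (Fin n → Z) × (Fin n → Z) => compExponent t h p.1 p.2 := by
  unfold compExponent
  fun_prop

theorem lintegral_exp_compExponent_le_one {n : ℕ} (t : ℝ) {h : Z → ℝ} (hh : Measurable h) :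
    ∫⁻ S, ∫⁻ S', ENNReal.ofReal (Real.exp (compExponent t h S S'))
      ∂Measure.pi (fun _ : Fin n => P) ∂Measure.pi (fun _ : Fin n => P) ≤ 1 := by
  set f : Z → Z → ℝ≥0∞ := fun z z' =>
    ENNReal.ofReal (Real.exp (t * (h z' - h z) - (t * (h z' - h z)) ^ 2 / 2)) with hf
  have hm : Measurable (Function.uncurry f) := by
    simp only [hf, Function.uncurry_def]
    fun_prop
  have h1 : ∀ S S' : Fin n → Z, ENNReal.ofReal (Real.exp (compExponent t h S S')) =
      ∏ i, f (S i) (S' i) := by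
    intro S S'
    rw [compExponent, Real.exp_sum, ENNReal.ofReal_prod_of_nonneg fun _ _ => (Real.exp_pos _).le]
  simp_rw [h1]
  calc _ = ∫⁻ S : Fin n → Z, ∏ i, ∫⁻ z', f (S i) z' ∂P ∂Measure.pi (fun _ : Fin n => P) :=
        lintegral_congr fun S => lintegral_pi_prod P (f := fun i z' => f (S i) z')
          fun i => hm.comp measurable_prodMk_left
    _ = ∏ _i : Fin n, ∫⁻ z, ∫⁻ z', f z z' ∂P ∂P :=
        lintegral_pi_prod P (f := fun _ z => ∫⁻ z', f z z' ∂P) fun _ => hm.lintegral_prod_right'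
    _ ≤ 1 := Finset.prod_le_one' fun _ _ => lintegral_exp_symm_le_one P t hh

/-- Weighted sum of exponentials of compensated exponents. -/
def expSum {κ : Type*} [Fintype κ] {n : ℕ} (w t : κ → ℝ) (h : κ → Z → ℝ) (S S' : Fin n → Z) : ℝ :=
  ∑ e, w e * Real.exp (compExponent (t e) (h e) S S')

theorem measurable_expSum {κ : Type*} [Fintype κ] {n : ℕ} (w t : κ → ℝ) {h : κ → Z → ℝ}
    (hh : ∀ e, Measurable (h e)) :
    Measurable fun p : (Fin n → Z) × (Fin n → Z) => expSum w t h p.1 p.2 :=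
  Finset.measurable_sum _ fun e _ => ((measurable_compExponent (t e) (hh e)).exp).const_mul _

theorem measurable_expSum_right {κ : Type*} [Fintype κ] {n : ℕ} (w t : κ → ℝ) {h : κ → Z → ℝ}
    (hh : ∀ e, Measurable (h e)) (S : Fin n → Z) : Measurable (expSum w t h S) := by
  unfold expSum compExponent
  fun_prop

theorem lintegral_lintegral_finsetSum {κ α : Type*} [Fintype κ] [MeasurableSpace α]
    (μ : Measure α) [SFinite μ] {F : κ → α × α → ℝ≥0∞} (hF : ∀ e, Measurable (F e)) :
    ∫⁻ x, ∫⁻ y, ∑ e, F e (x, y) ∂μ ∂μ = ∑ e, ∫⁻ x, ∫⁻ y, F e (x, y) ∂μ ∂μ := by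
  have h : ∀ x, ∫⁻ y, ∑ e, F e (x, y) ∂μ = ∑ e, ∫⁻ y, F e (x, y) ∂μ := fun x =>
    lintegral_finsetSum _ fun e _ => (hF e).comp measurable_prodMk_left
  simp_rw [h]
  exact lintegral_finsetSum _ fun e _ => (hF e).lintegral_prod_right'

theorem lintegral_expSum_le {κ : Type*} [Fintype κ] {n : ℕ} (w t : κ → ℝ) (hw : ∀ e, 0 ≤ w e)
    (hsum : ∑ e, w e ≤ 1) {h : κ → Z → ℝ} (hh : ∀ e, Measurable (h e)) :
    ∫⁻ S, ∫⁻ S', ENNReal.ofReal (expSum w t h S S')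
      ∂Measure.pi (fun _ : Fin n => P) ∂Measure.pi (fun _ : Fin n => P) ≤ 1 := by
  have hm : ∀ e, Measurable fun p : (Fin n → Z) × (Fin n → Z) =>
      ENNReal.ofReal (w e * Real.exp (compExponent (t e) (h e) p.1 p.2)) := fun e =>
    (((measurable_compExponent (t e) (hh e)).exp).const_mul _).ennreal_ofReal
  have h1 : ∀ S S' : Fin n → Z, ENNReal.ofReal (expSum w t h S S') =
      ∑ e, ENNReal.ofReal (w e * Real.exp (compExponent (t e) (h e) S S')) := fun S S' =>
    ENNReal.ofReal_sum_of_nonneg fun e _ => mul_nonneg (hw e) (Real.exp_pos _).le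
  simp_rw [h1]
  rw [lintegral_lintegral_finsetSum _ hm]
  have h3 : ∀ e, ∫⁻ S, ∫⁻ S', ENNReal.ofReal (w e * Real.exp (compExponent (t e) (h e) S S'))
      ∂Measure.pi (fun _ : Fin n => P) ∂Measure.pi (fun _ : Fin n => P) ≤
      ENNReal.ofReal (w e) := by
    intro e
    simp_rw [ENNReal.ofReal_mul (hw e), lintegral_const_mul' _ _ ENNReal.ofReal_ne_top]
    exact (mul_le_mul_right (lintegral_exp_compExponent_le_one P (t e) (hh e)) _).trans_eq
      (mul_one _)
  refine (Finset.sum_le_sum fun e _ => h3 e).trans ?_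
  rw [← ENNReal.ofReal_sum_of_nonneg fun e _ => hw e]
  exact (ENNReal.ofReal_le_ofReal hsum).trans_eq ENNReal.ofReal_one

/-- Markov's inequality for the function of `S` obtained by integrating `S'` out. The ghost sample
thus remains available for an integration inside the good event. -/
theorem measure_compl_lintegral_expSum_le {κ : Type*} [Fintype κ] {n : ℕ} (w t : κ → ℝ)
    (hw : ∀ e, 0 ≤ w e) (hsum : ∑ e, w e ≤ 1) {h : κ → Z → ℝ} (hh : ∀ e, Measurable (h e))
    {δ : ℝ} (hδ0 : 0 < δ) :
    Measure.pi (fun _ : Fin n => P) {S | ∫⁻ S', ENNReal.ofReal (δ * expSum w t h S S')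
      ∂Measure.pi (fun _ : Fin n => P) ≤ 1}ᶜ ≤ ENNReal.ofReal δ := by
  set μ := Measure.pi (fun _ : Fin n => P) with hμ
  have hδE : ENNReal.ofReal δ ≠ 0 := by simpa using hδ0
  have hsub : {S | ∫⁻ S', ENNReal.ofReal (δ * expSum w t h S S') ∂μ ≤ 1}ᶜ ⊆
      {S | (ENNReal.ofReal δ)⁻¹ ≤ ∫⁻ S', ENNReal.ofReal (expSum w t h S S') ∂μ} := by
    intro S hS
    simp only [mem_compl_iff, mem_ofPred_eq, not_le, ENNReal.ofReal_mul hδ0.le] at hS ⊢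
    rw [lintegral_const_mul' _ _ ENNReal.ofReal_ne_top] at hS
    rw [ENNReal.inv_le_iff_le_mul (fun _ => hδE) (by simp)]
    exact hS.le
  refine (measure_mono hsub).trans ?_
  have hM := mul_meas_ge_le_lintegral (μ := μ)
    (f := fun S => ∫⁻ S', ENNReal.ofReal (expSum w t h S S') ∂μ)
    ((measurable_expSum w t hh).ennreal_ofReal.lintegral_prod_right') (ENNReal.ofReal δ)⁻¹
  have h6 := hM.trans (lintegral_expSum_le P w t hw hsum hh)
  calc _ = ENNReal.ofReal δ * ((ENNReal.ofReal δ)⁻¹ *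
        μ {S | (ENNReal.ofReal δ)⁻¹ ≤ ∫⁻ S', ENNReal.ofReal (expSum w t h S S') ∂μ}) := by
        rw [← mul_assoc, ENNReal.mul_inv_cancel hδE ENNReal.ofReal_ne_top, one_mul]
    _ ≤ ENNReal.ofReal δ * 1 := by gcongr
    _ = _ := mul_one _

/-- A link consists of a scale and two elements of the family: `exp (-pen)` pays for each element
and `(1 / 2) ^ (j + 1)` for the scale. -/
theorem sum_links_le_one {ι : Type*} [Fintype ι] (J : ℕ) (pen : ι → ℝ)
    (hsum : ∑ v, Real.exp (-pen v) ≤ 1) :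
    ∑ e : Fin J × ι × ι, Real.exp (-pen e.2.1) * Real.exp (-pen e.2.2) * (1 / 2) ^ (e.1.1 + 1)
      ≤ 1 := by
  have h0 : 0 ≤ ∑ v, Real.exp (-pen v) := Finset.sum_nonneg fun _ _ => (Real.exp_pos _).le
  have h2 : ∀ J : ℕ, ∑ j ∈ Finset.range J, (1 / 2 : ℝ) ^ (j + 1) = 1 - (1 / 2) ^ J := by
    intro J
    induction J with
    | zero => simp
    | succ J ih => rw [Finset.sum_range_succ, ih, pow_succ]; ring
  have h1 : ∑ e : Fin J × ι × ι,
      Real.exp (-pen e.2.1) * Real.exp (-pen e.2.2) * (1 / 2) ^ (e.1.1 + 1) =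
      ((∑ v, Real.exp (-pen v)) * ∑ v, Real.exp (-pen v)) * (1 - (1 / 2) ^ J) := by
    rw [← h2 J, Finset.sum_range, Fintype.sum_prod_type, Finset.mul_sum]
    refine Finset.sum_congr rfl fun j _ => ?_
    rw [Fintype.sum_prod_type, Finset.sum_mul_sum, Finset.sum_mul]
    refine Finset.sum_congr rfl fun v _ => ?_
    rw [Finset.sum_mul]
  rw [h1]
  have h3 : (0 : ℝ) ≤ (1 / 2) ^ J := by positivity
  have h4 : (1 / 2 : ℝ) ^ J ≤ 1 := pow_le_one₀ (by norm_num) (by norm_num)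
  calc _ ≤ (1 * 1 : ℝ) * 1 := by gcongr; linarith
    _ = 1 := by norm_num

/-- With `T = 2 ^ j √(θ / n)` the compensation `T ^ 2 Q / 2` is at most `2 θ`, so `T X ≤ 3 θ + B`.
Division by `T n` gives the claim, as `θ ≥ 1`. -/
theorem increment_le_of_exponent_le {n θ X B Q : ℝ} {j : ℕ} (hn' : 1 ≤ n) (hθ1 : 1 ≤ θ)
    (hB : 0 ≤ B) (hsq : Q ≤ 4 * n * (1 / 4) ^ j)
    (hkey : 2 ^ j * Real.sqrt (θ / n) * X - (2 ^ j * Real.sqrt (θ / n)) ^ 2 / 2 * Q ≤ θ + B) :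
    X / n ≤ 3 * (1 / 2) ^ j * (Real.sqrt (θ / n) + B / Real.sqrt n) := by
  set T : ℝ := 2 ^ j * Real.sqrt (θ / n) with hT
  have hTpos : 0 < T := by positivity
  have hT2 : T ^ 2 * (4 * n * (1 / 4) ^ j) = 4 * θ := by
    rw [mul_pow, Real.sq_sqrt (by positivity), ← pow_mul, mul_comm j 2, pow_mul]
    have : (2 ^ 2 : ℝ) ^ j * (1 / 4) ^ j = 1 := by rw [← mul_pow]; norm_num
    calc _ = ((2 ^ 2) ^ j * (1 / 4) ^ j) * (4 * θ) := by field_simp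
      _ = 4 * θ := by rw [this, one_mul]
  have h1 : T * X ≤ 3 * θ + B := by
    have := mul_le_mul_of_nonneg_left hsq (by positivity : 0 ≤ T ^ 2 / 2)
    linarith
  have hsn : 0 < Real.sqrt n := Real.sqrt_pos.2 (by linarith)
  have hnn : Real.sqrt n * Real.sqrt n = n := Real.mul_self_sqrt (by linarith)
  have hst : Real.sqrt (θ / n) = Real.sqrt θ / Real.sqrt n := Real.sqrt_div (by linarith) _
  have hsθ : 1 ≤ Real.sqrt θ := Real.one_le_sqrt.2 hθ1
  have hθθ : Real.sqrt θ * Real.sqrt θ = θ := Real.mul_self_sqrt (by linarith)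
  have h2 : X ≤ (3 * θ + B) / T := by
    rw [le_div_iff₀ hTpos]; linarith
  have hTe : T = 2 ^ j * (Real.sqrt θ / Real.sqrt n) := by rw [← hst]
  calc X / n ≤ (3 * θ + B) / T / n := by gcongr
    _ = (1 / 2) ^ j * (3 * (Real.sqrt θ / Real.sqrt n)
          + B / Real.sqrt n / Real.sqrt θ) := by
        rw [hTe]
        nth_rewrite 1 [← hθθ]
        nth_rewrite 2 [← hnn]
        rw [one_div, inv_pow]
        field_simp
    _ ≤ (1 / 2) ^ j * (3 * (Real.sqrt θ / Real.sqrt n) + B / Real.sqrt n) := by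
        have : B / Real.sqrt n / Real.sqrt θ ≤ B / Real.sqrt n :=
          div_le_self (by positivity) hsθ
        gcongr (1 / 2) ^ j * (_ + ?_)
    _ ≤ 3 * (1 / 2) ^ j * (Real.sqrt (θ / n) + B / Real.sqrt n) := by
        rw [hst]
        have : 0 ≤ (1 / 2 : ℝ) ^ j * (B / Real.sqrt n) := by positivity
        nlinarith

/-- Simultaneous control of all increments of a finite weighted family of functions at all dyadic
scales, on an event which only depends on the first sample. -/
theorem exists_chaining_event {ι : Type*} [Fintype ι] {n : ℕ} (hn : 1 ≤ n) (J : ℕ)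
    (h : ι → Z → ℝ) (hh : ∀ v, Measurable (h v)) (pen : ι → ℝ) (hpen : ∀ v, 0 ≤ pen v)
    (hsum : ∑ v, Real.exp (-pen v) ≤ 1) {δ : ℝ} (hδ : δ ∈ Ioo (0 : ℝ) 1) :
    ∃ (G : Set (Fin n → Z)) (ξ : (Fin n → Z) → (Fin n → Z) → ℝ),
      Measure.pi (fun _ : Fin n => P) Gᶜ ≤ ENNReal.ofReal δ ∧
      (∀ S, Measurable (ξ S)) ∧ (∀ S S', 0 ≤ ξ S S') ∧
      (∀ S ∈ G, ∫⁻ S', ENNReal.ofReal (δ * ξ S S') ∂Measure.pi (fun _ : Fin n => P) ≤ 1) ∧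
      ∀ S S', ∀ j < J, ∀ v v',
        ∑ i, ((h v (S' i) - h v' (S' i)) - (h v (S i) - h v' (S i))) ^ 2 ≤ 4 * n * (1 / 4) ^ j →
        (∑ i, ((h v (S' i) - h v' (S' i)) - (h v (S i) - h v' (S i)))) / n ≤
          3 * (1 / 2) ^ j * (Real.sqrt ((pen v + pen v' + (j + 1) + (1 + Real.log δ⁻¹)) / n)
            + δ * ξ S S' / Real.sqrt n) := by
  obtain ⟨hδ0, hδ1⟩ := hδ
  have hn' : (1 : ℝ) ≤ n := by exact_mod_cast hn
  have hlog : 0 ≤ Real.log δ⁻¹ := Real.log_nonneg ((one_le_inv₀ hδ0).2 hδ1.le)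
  obtain ⟨t, ht⟩ : ∃ t : Fin J × ι × ι → ℝ, ∀ e, t e = 2 ^ e.1.1 * Real.sqrt
      ((pen e.2.1 + pen e.2.2 + (e.1.1 + 1) + (1 + Real.log δ⁻¹)) / n) := ⟨_, fun _ => rfl⟩
  obtain ⟨w, hw⟩ : ∃ w : Fin J × ι × ι → ℝ, ∀ e, w e =
      Real.exp (-pen e.2.1) * Real.exp (-pen e.2.2) * (1 / 2) ^ (e.1.1 + 1) := ⟨_, fun _ => rfl⟩
  obtain ⟨H, hHd⟩ : ∃ H : Fin J × ι × ι → Z → ℝ, ∀ e z, H e z = h e.2.1 z - h e.2.2 z :=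
    ⟨_, fun _ _ => rfl⟩
  have hH : ∀ e, Measurable (H e) := fun e => by
    rw [show H e = fun z => h e.2.1 z - h e.2.2 z from funext (hHd e)]
    exact (hh _).sub (hh _)
  have hw0 : ∀ e, 0 ≤ w e := fun e => by rw [hw]; positivity
  have hwsum : ∑ e, w e ≤ 1 := by
    simp_rw [hw]
    exact sum_links_le_one J pen hsum
  have hterm0 : ∀ e, ∀ S S' : Fin n → Z, 0 ≤ w e * Real.exp (compExponent (t e) (H e) S S') :=
    fun e S S' => mul_nonneg (hw0 _) (Real.exp_pos _).le
  have hξ0 : ∀ S S' : Fin n → Z, 0 ≤ expSum w t H S S' := fun S S' =>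
    Finset.sum_nonneg fun e _ => hterm0 e S S'
  have hev := measure_compl_lintegral_expSum_le P (n := n) w t hw0 hwsum hH hδ0
  have hξm : ∀ S : Fin n → Z, Measurable (expSum w t H S) := measurable_expSum_right w t hH
  refine ⟨{S | ∫⁻ S', ENNReal.ofReal (δ * expSum w t H S S')
    ∂Measure.pi (fun _ : Fin n => P) ≤ 1}, expSum w t H, hev, hξm, hξ0, fun S hS => hS, ?_⟩
  intro S S' j hj v v' hsq
  set D : Fin n → ℝ := fun i => (h v (S' i) - h v' (S' i)) - (h v (S i) - h v' (S i)) with hD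
  set ξ : ℝ := expSum w t H S S' with hξ
  have hle : w ⟨⟨j, hj⟩, v, v'⟩ * Real.exp (compExponent (t ⟨⟨j, hj⟩, v, v'⟩)
      (H ⟨⟨j, hj⟩, v, v'⟩) S S') ≤ ξ :=
    Finset.single_le_sum (f := fun e => w e * Real.exp (compExponent (t e) (H e) S S'))
      (fun e _ => hterm0 e S S') (Finset.mem_univ (⟨⟨j, hj⟩, v, v'⟩ : Fin J × ι × ι))
  set θ : ℝ := pen v + pen v' + (j + 1) + (1 + Real.log δ⁻¹) with hθ
  have hθ1 : 1 ≤ θ := by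
    have := hpen v
    have := hpen v'
    have : (0 : ℝ) ≤ j := Nat.cast_nonneg j
    linarith
  set T : ℝ := 2 ^ j * Real.sqrt (θ / n) with hT
  have hexp : compExponent (t ⟨⟨j, hj⟩, v, v'⟩) (H ⟨⟨j, hj⟩, v, v'⟩) S S' =
      T * ∑ i, D i - T ^ 2 / 2 * ∑ i, D i ^ 2 := by
    rw [compExponent, Finset.mul_sum, Finset.mul_sum, ← Finset.sum_sub_distrib]
    refine Finset.sum_congr rfl fun i _ => ?_
    simp only [hD, hHd, ht, hT, hθ]; ring
  rw [hexp, hw] at hle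
  have hkey : T * ∑ i, D i - T ^ 2 / 2 * ∑ i, D i ^ 2 ≤ θ + δ * ξ := by
    set X := T * ∑ i, D i - T ^ 2 / 2 * ∑ i, D i ^ 2
    have h1 : Real.exp (-((j : ℝ) + 1)) ≤ (1 / 2) ^ (j + 1) := by
      have h3 : (2 : ℝ) ≤ Real.exp 1 := by have := Real.add_one_le_exp (1 : ℝ); linarith
      have h4 : Real.exp ((j : ℝ) + 1) = Real.exp 1 ^ (j + 1) := by
        rw [← Real.exp_nat_mul]; push_cast; congr 1; ring
      rw [Real.exp_neg, h4, one_div, inv_pow]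
      gcongr
    have h2 : Real.exp (X - (pen v + pen v' + (j + 1)) + Real.log δ) ≤ δ * ξ := by
      calc Real.exp (X - (pen v + pen v' + (j + 1)) + Real.log δ)
          = δ * (Real.exp (-pen v) * Real.exp (-pen v') * Real.exp (-((j : ℝ) + 1)) *
              Real.exp X) := by
            nth_rewrite 2 [← Real.exp_log hδ0]
            rw [← Real.exp_add, ← Real.exp_add, ← Real.exp_add, ← Real.exp_add]
            congr 1; ring
        _ ≤ δ * (Real.exp (-pen v) * Real.exp (-pen v') * (1 / 2) ^ (j + 1) * Real.exp X) := by
            gcongr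
        _ ≤ δ * ξ := by gcongr
    -- Taking logarithms would give `log ξ`; the inequality `1 + x ≤ exp x` gives the linear term `δ
    -- ξ` instead, whose integral over `S'` is at most one on the event.
    have h3 := Real.add_one_le_exp (X - (pen v + pen v' + (j + 1)) + Real.log δ)
    rw [hθ, Real.log_inv]
    linarith
  exact increment_le_of_exponent_le hn' hθ1 (mul_nonneg hδ0.le (hξ0 S S')) hsq hkey

end Symmetrization

/-! ### Euclidean norm of a family of vectors. -/

section Stack

variable {n k : ℕ}

/-- A finite family of vectors, with the Euclidean norm of the whole family. -/
def stack (v : Fin n → Vec k) : PiLp 2 (fun _ : Fin n => Vec k) := WithLp.toLp 2 v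

theorem norm_stack_sq (v : Fin n → Vec k) : ‖stack v‖ ^ 2 = ∑ i, ‖v i‖ ^ 2 :=
  PiLp.norm_sq_eq_of_L2 _ _

theorem stack_sub (u v : Fin n → Vec k) :
    stack u - stack v = stack fun i => u i - v i := rfl

theorem frob_of_eq_norm_stack (v : Fin n → Vec k) :
    frob (Matrix.of fun a i => v i a) = ‖stack v‖ := by
  refine (sq_eq_sq₀ (frob_nonneg _) (norm_nonneg _)).1 ?_
  rw [frob_sq, norm_stack_sq, Finset.sum_comm]
  exact Finset.sum_congr rfl fun i _ => (EuclideanSpace.real_norm_sq_eq (v i)).symm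

theorem norm_stack_le {k' : ℕ} {v : Fin n → Vec k} {u : Fin n → Vec k'} {c : ℝ} (hc : 0 ≤ c)
    (h : ∀ i, ‖v i‖ ≤ c * ‖u i‖) : ‖stack v‖ ≤ c * ‖stack u‖ := by
  refine le_of_sq_le_sq ?_ (by positivity)
  rw [mul_pow, norm_stack_sq, norm_stack_sq, Finset.mul_sum]
  refine Finset.sum_le_sum fun i _ => ?_
  rw [← mul_pow]
  exact pow_le_pow_left₀ (norm_nonneg _) (h i) 2

theorem continuous_stack {α : Type*} [TopologicalSpace α] {v : α → Fin n → Vec k}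
    (h : ∀ i, Continuous fun a => v a i) : Continuous fun a => stack (v a) :=
  (PiLp.continuous_toLp 2 _).comp (continuous_pi h)

end Stack

/-! ### Perturbation of networks, layer by layer. -/

section Network

variable {L : ℕ} {d : ℕ → ℕ} {σ : Activations L d}

theorem continuous_toEuclideanLin {p q : ℕ} :
    Continuous fun z : Matrix (Fin p) (Fin q) ℝ × Vec q => Matrix.toEuclideanLin z.1 z.2 := by
  have h : Continuous fun z : Matrix (Fin p) (Fin q) ℝ × Vec q =>
      WithLp.toLp 2 (z.1.mulVec (WithLp.ofLp z.2)) :=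
    (PiLp.continuous_toLp 2 _).comp
      (continuous_fst.matrix_mulVec ((PiLp.continuous_ofLp 2 _).comp continuous_snd))
  exact h

theorem continuous_feat (hσ : ∀ l, Continuous (σ l)) (k : ℕ) (hk : k ≤ L) :
    Continuous fun z : Weights L d × Vec (d 0) => feat σ z.1 k hk z.2 := by
  induction k with
  | zero => exact continuous_snd
  | succ k ih =>
    have h1 : Continuous fun z : Weights L d × Vec (d 0) =>
        (z.1 ⟨k, hk⟩, feat σ z.1 k (Nat.le_of_succ_le hk) z.2) :=
      ((continuous_apply (⟨k, hk⟩ : Fin L)).comp continuous_fst).prodMk (ih _)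
    exact (hσ ⟨k, hk⟩).comp (continuous_toEuclideanLin.comp h1)

theorem feat_congr {W W' : Weights L d} (k : ℕ) (hk : k ≤ L)
    (h : ∀ i : Fin L, (i : ℕ) < k → W i = W' i) (x : Vec (d 0)) :
    feat σ W k hk x = feat σ W' k hk x := by
  induction k with
  | zero => rfl
  | succ k ih =>
    simp only [feat, layer]
    rw [ih _ fun i hi => h i (by omega), h ⟨k, hk⟩ (by simp)]

theorem outer_congr {W W' : Weights L d} (m l : ℕ) (hl : l + m = L)
    (h : ∀ i : Fin L, l ≤ (i : ℕ) → W i = W' i) (u : Vec (d l)) :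
    outer σ W m l hl u = outer σ W' m l hl u := by
  induction m generalizing l with
  | zero => rfl
  | succ m ih =>
    simp only [outer, layer]
    rw [ih (l + 1) _ fun i hi => h i (by omega), h ⟨l, by omega⟩ le_rfl]

theorem outer_feat (W : Weights L d) (m l : ℕ) (hl : l + m = L) (x : Vec (d 0)) :
    outer σ W m l hl (feat σ W l (by omega) x) = net σ W x := by
  induction m generalizing l with
  | zero =>
    obtain rfl : l = L := hl
    rfl
  | succ m ih => exact ih (l + 1) (by omega)

theorem norm_layer_sub_le (hσ : ∀ l, LipschitzWith 1 (σ l)) (W W' : Weights L d) (l : Fin L)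
    (u : Vec (d l)) : ‖layer σ W l u - layer σ W' l u‖ ≤ spec (W l - W' l) * ‖u‖ := by
  have h := (hσ l).dist_le_mul (Matrix.toEuclideanLin (W l) u) (Matrix.toEuclideanLin (W' l) u)
  rw [NNReal.coe_one, one_mul, dist_eq_norm, dist_eq_norm, ← LinearMap.sub_apply, ← map_sub] at h
  exact h.trans (norm_toEuclideanLin_le _ _)

theorem norm_layer_sub_layer_le (hσ : ∀ l, LipschitzWith 1 (σ l)) (W : Weights L d) (l : Fin L)
    (u v : Vec (d l)) : ‖layer σ W l u - layer σ W l v‖ ≤ spec (W l) * ‖u - v‖ := by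
  have h := (hσ l).dist_le_mul (Matrix.toEuclideanLin (W l) u) (Matrix.toEuclideanLin (W l) v)
  rw [NNReal.coe_one, one_mul, dist_eq_norm, dist_eq_norm, ← map_sub] at h
  exact h.trans (norm_toEuclideanLin_le _ _)

theorem norm_outer_sub_le (hσ : ∀ l, LipschitzWith 1 (σ l)) (W : Weights L d) (m l : ℕ)
    (hl : l + m = L) (u v : Vec (d l)) :
    ‖outer σ W m l hl u - outer σ W m l hl v‖ ≤
      (∏ i : Fin L with l ≤ i.1, spec (W i)) * ‖u - v‖ := by
  induction m generalizing l with
  | zero =>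
    obtain rfl : l = L := hl
    have : (Finset.univ.filter fun i : Fin l => l ≤ i.1) = ∅ :=
      Finset.filter_eq_empty_iff.2 fun i _ => not_le.2 i.2
    rw [this, Finset.prod_empty, one_mul]
    rfl
  | succ m ih =>
    have hlL : l < L := by omega
    have hins : (Finset.univ.filter fun i : Fin L => l ≤ i.1) =
        insert ⟨l, hlL⟩ (Finset.univ.filter fun i : Fin L => l + 1 ≤ i.1) := by
      ext i
      simp only [Finset.mem_filter, Finset.mem_univ, true_and, Finset.mem_insert, Fin.ext_iff]
      omega
    rw [hins, Finset.prod_insert (by simp)]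
    refine (ih (l + 1) (by omega) _ _).trans ?_
    have h1 := norm_layer_sub_layer_le hσ W ⟨l, hlL⟩ u v
    have h2 : 0 ≤ ∏ i : Fin L with l + 1 ≤ i.1, spec (W i) :=
      Finset.prod_nonneg fun i _ => spec_nonneg _
    calc _ ≤ (∏ i : Fin L with l + 1 ≤ i.1, spec (W i)) * (spec (W ⟨l, hlL⟩) * ‖u - v‖) := by
          gcongr
      _ = _ := by ring

theorem norm_feat_le (hσ : ∀ l, LipschitzWith 1 (σ l)) (h0 : ∀ l, σ l 0 = 0) (W : Weights L d)
    (k : ℕ) (hk : k ≤ L) (x : Vec (d 0)) :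
    ‖feat σ W k hk x‖ ≤ (∏ i : Fin L with i.1 < k, spec (W i)) * ‖x‖ := by
  induction k with
  | zero => simp [feat]
  | succ k ih =>
    have hins : (Finset.univ.filter fun i : Fin L => i.1 < k + 1) =
        insert ⟨k, hk⟩ (Finset.univ.filter fun i : Fin L => i.1 < k) := by
      ext i
      simp only [Finset.mem_filter, Finset.mem_univ, true_and, Finset.mem_insert, Fin.ext_iff]
      omega
    rw [hins, Finset.prod_insert (by simp)]
    have h1 := norm_layer_sub_layer_le hσ W ⟨k, hk⟩ (feat σ W k (Nat.le_of_succ_le hk) x) 0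
    have h2 : layer σ W ⟨k, hk⟩ 0 = 0 := by rw [layer, map_zero, h0]
    rw [h2, sub_zero, sub_zero] at h1
    calc _ ≤ spec (W ⟨k, hk⟩) * ‖feat σ W k (Nat.le_of_succ_le hk) x‖ := h1
      _ ≤ spec (W ⟨k, hk⟩) * ((∏ i : Fin L with i.1 < k, spec (W i)) * ‖x‖) := by
          gcongr
          exacts [spec_nonneg _, ih _]
      _ = _ := by ring

variable {n : ℕ}

theorem frob_featMat (W : Weights L d) (k : ℕ) (hk : k ≤ L) (X : Fin n → Vec (d 0)) :
    frob (featMat σ W k hk X) = ‖stack fun i => feat σ W k hk (X i)‖ :=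
  frob_of_eq_norm_stack _

theorem frob_featMat_sub (W W' : Weights L d) (k : ℕ) (hk : k ≤ L) (X : Fin n → Vec (d 0)) :
    frob (featMat σ W k hk X - featMat σ W' k hk X) =
      ‖stack fun i => feat σ W k hk (X i) - feat σ W' k hk (X i)‖ := by
  rw [← frob_of_eq_norm_stack]
  rfl

theorem frob_outerMat_sub (W W' V : Weights L d) (l : ℕ) (hl : l ≤ L) (X : Fin n → Vec (d 0)) :
    frob (outerMat σ V l hl (featMat σ W l hl X) - outerMat σ V l hl (featMat σ W' l hl X)) =
      ‖stack fun i => outer σ V (L - l) l (by omega) (feat σ W l hl (X i)) -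
        outer σ V (L - l) l (by omega) (feat σ W' l hl (X i))‖ := by
  rw [← frob_of_eq_norm_stack]
  rfl

theorem empDist_eq (W W' : Weights L d) (X : Fin n → Vec (d 0)) :
    empDist σ X W W' =
      ‖stack fun i => net σ W (X i) - net σ W' (X i)‖ / Real.sqrt n := by
  rw [empDist, frob_featMat_sub, Real.sqrt_div (sq_nonneg _), Real.sqrt_sq (norm_nonneg _)]
  rfl

theorem frob_fromCols_sq {ι κ κ' : Type*} [Fintype ι] [Fintype κ] [Fintype κ']
    (A : Matrix ι κ ℝ) (B : Matrix ι κ' ℝ) :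
    frob (Matrix.fromCols A B) ^ 2 = frob A ^ 2 + frob B ^ 2 := by
  simp only [frob_sq, Fintype.sum_sum_type, Matrix.fromCols_apply_inl, Matrix.fromCols_apply_inr,
    Finset.sum_add_distrib]

/-- The weights which agree with `W` up to layer number `l` and with `W'` beyond. -/
def hybrid (W W' : Weights L d) (l : ℕ) : Weights L d := fun i => if i.1 < l then W i else W' i

theorem hybrid_zero (W W' : Weights L d) : hybrid W W' 0 = W' := by
  funext i; simp [hybrid]

theorem hybrid_top (W W' : Weights L d) : hybrid W W' L = W := by
  funext i; simp [hybrid]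

theorem frob_segment_le {p q : ℕ} (A B : Matrix (Fin p) (Fin q) ℝ) (h : frob B ≤ frob A) {t : ℝ}
    (ht : t ∈ Icc (0 : ℝ) 1) : frob (A + t • (B - A)) ≤ frob A := by
  have h1 : vecOfMat (A + t • (B - A)) = (1 - t) • vecOfMat A + t • vecOfMat B := by
    ext ij
    simp only [vecOfMat, Matrix.add_apply, Matrix.smul_apply, Matrix.sub_apply, PiLp.add_apply,
      PiLp.smul_apply, smul_eq_mul]
    ring
  rw [← norm_vecOfMat, h1]
  refine (norm_add_le _ _).trans ?_
  rw [norm_smul, norm_smul, norm_vecOfMat, norm_vecOfMat, Real.norm_of_nonneg ht.1,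
    Real.norm_of_nonneg (by linarith [ht.2])]
  nlinarith [ht.1]

theorem wnorm_le_of_frob_le {W W' : Weights L d} (h : ∀ l, frob (W' l) ≤ frob (W l)) :
    wnorm W' ≤ wnorm W := by
  refine Real.sqrt_le_sqrt (Finset.sum_le_sum fun l _ => ?_)
  exact pow_le_pow_left₀ (frob_nonneg _) (h l) 2

/-- A continuous path cannot jump over a forbidden interval. -/
theorem le_of_forbidden_interval {g : ℝ → ℝ} (hg : Continuous g) {b c : ℝ} (hbc : b < c)
    (h0 : g 0 ≤ b) (h : ∀ t ∈ Icc (0 : ℝ) 1, g t ≤ c → g t ≤ b) : g 1 ≤ b := by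
  by_contra! hcon
  have hy : min (g 1) c ∈ Icc (g 0) (g 1) :=
    ⟨h0.trans (le_min hcon.le hbc.le), min_le_left _ _⟩
  obtain ⟨t, ht, hgt⟩ := intermediate_value_Icc zero_le_one hg.continuousOn hy
  have := h t ht (hgt.trans_le (min_le_right _ _))
  rw [hgt] at this
  exact absurd this (not_le.2 (lt_min hcon hbc))

/-- Perturbation of the whole network from a chain of one-layer perturbations. -/
theorem norm_stack_net_sub_le_sum (W W' : Weights L d) (X : Fin n → Vec (d 0)) (c : Fin L → ℝ)
    (hstep : ∀ l : Fin L, ‖stack fun i => net σ (hybrid W W' (l + 1)) (X i) - net σ W (X i)‖ ≤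
        ∑ i : Fin L with l.1 + 1 ≤ i.1, c i →
      ‖stack fun i => net σ (hybrid W W' l) (X i) - net σ W (X i)‖ ≤
        (∑ i : Fin L with l.1 + 1 ≤ i.1, c i) + c l) :
    ‖stack fun i => net σ W' (X i) - net σ W (X i)‖ ≤ ∑ l, c l := by
  -- Downward induction on `l`, from `hybrid W W' L = W` to `hybrid W W' 0 = W'`. Each step may use
  -- the bound accumulated so far, which is what the localisation argument needs.
  have key : ∀ m l : ℕ, l + m = L →
      ‖stack fun i => net σ (hybrid W W' l) (X i) - net σ W (X i)‖ ≤
        ∑ i : Fin L with l ≤ i.1, c i := by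
    intro m
    induction m with
    | zero =>
      intro l hl
      obtain rfl : l = L := hl
      have : (Finset.univ.filter fun i : Fin l => l ≤ i.1) = ∅ :=
        Finset.filter_eq_empty_iff.2 fun i _ => not_le.2 i.2
      rw [this, hybrid_top, Finset.sum_empty]
      simp only [sub_self]
      have h0 := norm_stack_sq (fun _ : Fin n => (0 : Vec (d l)))
      simp only [norm_zero, ne_eq, OfNat.ofNat_ne_zero, not_false_eq_true, zero_pow,
        Finset.sum_const_zero, pow_eq_zero_iff] at h0
      exact h0.le
    | succ m ih =>
      intro l hl
      have hlL : l < L := by omega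
      have hins : (Finset.univ.filter fun i : Fin L => l ≤ i.1) =
          insert ⟨l, hlL⟩ (Finset.univ.filter fun i : Fin L => l + 1 ≤ i.1) := by
        ext i
        simp only [Finset.mem_filter, Finset.mem_univ, true_and, Finset.mem_insert, Fin.ext_iff]
        omega
      rw [hins, Finset.sum_insert (by simp)]
      have h1 := ih (l + 1) (by omega)
      rw [add_comm]
      exact hstep ⟨l, hlL⟩ h1
  have := key L 0 (by omega)
  rw [hybrid_zero] at this
  simpa using this

theorem norm_stack_feat_succ_le (hσ : ∀ l, LipschitzWith 1 (σ l)) {W V : Weights L d} (l : Fin L)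
    (hV : ∀ i : Fin L, i.1 < l.1 → V i = W i) (X : Fin n → Vec (d 0)) :
    ‖stack fun i => feat σ V (l + 1) l.isLt (X i) - feat σ W (l + 1) l.isLt (X i)‖ ≤
      spec (V l - W l) * frob (featMat σ W l l.isLt.le X) := by
  rw [frob_featMat]
  refine norm_stack_le (spec_nonneg _) fun i => ?_
  simp only [feat]
  rw [feat_congr (W := V) (W' := W) l.1 l.isLt.le hV]
  exact norm_layer_sub_le hσ V W l _

theorem net_eq_outer_feat (W : Weights L d) (l : Fin L) (x : Vec (d 0)) :
    net σ W x = outer σ W (L - (l + 1)) (l + 1) (by omega) (feat σ W (l + 1) l.isLt x) :=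
  (outer_feat W _ _ _ x).symm

/-- Writes the previous hybrid as the outer layers of `V` applied to features of `W`. Two successive
hybrids then differ only in the input of a common outer map, the situation of the local Lipschitz
condition. -/
theorem net_hybrid_succ {W W' V : Weights L d} (l : Fin L)
    (hV : ∀ i : Fin L, l.1 < i.1 → V i = W' i) (x : Vec (d 0)) :
    net σ (hybrid W W' (l + 1)) x =
      outer σ V (L - (l + 1)) (l + 1) (by omega) (feat σ W (l + 1) l.isLt x) := by
  rw [net_eq_outer_feat _ l, feat_congr (W := hybrid W W' (l + 1)) (W' := W),
    outer_congr (W := hybrid W W' (l + 1)) (W' := V)]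
  · intro i hi
    rw [hV i (by omega)]
    simp [hybrid]
    omega
  · intro i hi
    simp [hybrid, hi]

/-- Perturbation bound from outer local Lipschitz constants: the localisation hypothesis is
verified along a path by a continuity argument. -/
theorem norm_stack_net_sub_le_of_isLocalLipschitz (hn : 1 ≤ n)
    (hσ : ∀ l, LipschitzWith 1 (σ l)) {X : Fin n → Vec (d 0)} {R ε : ℝ} (hε : 0 < ε)
    {M : Fin L → Weights L d → ℝ → ℝ≥0} (hM : IsLocalLipschitz σ X R ε M) {W W' : Weights L d}
    (hW : wnorm W ≤ R) (hle : ∀ l, frob (W' l) ≤ frob (W l))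
    (hsmall : ∑ l, M l W ε * (spec (W' l - W l) * frob (featMat σ W l l.isLt.le X)) <
      Real.sqrt n * ε) :
    ‖stack fun i => net σ W' (X i) - net σ W (X i)‖ ≤
      ∑ l, M l W ε * (spec (W' l - W l) * frob (featMat σ W l l.isLt.le X)) := by
  have hsn : 0 < Real.sqrt n := Real.sqrt_pos.2 (by exact_mod_cast hn)
  set c : Fin L → ℝ := fun l =>
    M l W ε * (spec (W' l - W l) * frob (featMat σ W l l.isLt.le X)) with hc
  have hc0 : ∀ l, 0 ≤ c l := fun l => mul_nonneg (M l W ε).2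
    (mul_nonneg (spec_nonneg _) (frob_nonneg _))
  refine norm_stack_net_sub_le_sum W W' X c fun l hprev => ?_
  set H := hybrid W W' (l + 1) with hH
  -- A path that moves layer `l` along the segment from `W l` to `W' l`, between two successive
  -- hybrids.
  set V : ℝ → Weights L d := fun t => Function.update H l (W l + t • (W' l - W l)) with hV
  have hVl : ∀ t, V t l = W l + t • (W' l - W l) := fun t => by simp [hV]
  have hVlt : ∀ t, ∀ i : Fin L, i.1 < l.1 → V t i = W i := by
    intro t i hi
    have hne : i ≠ l := by rintro rfl; omega
    simp only [hV, hH, Function.update_of_ne hne, hybrid]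
    rw [if_pos (by omega)]
  have hVgt : ∀ t, ∀ i : Fin L, l.1 < i.1 → V t i = W' i := by
    intro t i hi
    have hne : i ≠ l := by rintro rfl; omega
    simp only [hV, hH, Function.update_of_ne hne, hybrid]
    rw [if_neg (by omega)]
  have hV0 : V 0 = H := by
    simp only [hV, zero_smul, add_zero]
    refine Function.update_eq_self_iff.2 ?_
    simp [hH, hybrid]
  have hV1 : V 1 = hybrid W W' l := by
    funext i
    rcases lt_trichotomy i.1 l.1 with hi | hi | hi
    · rw [hVlt 1 i hi]; simp [hybrid, hi]
    · obtain rfl : i = l := Fin.ext hi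
      rw [hVl]; simp [hybrid]
    · rw [hVgt 1 i hi, hybrid, if_neg (by omega)]
  set g : ℝ → ℝ := fun t => ‖stack fun i => net σ (V t) (X i) - net σ W (X i)‖ with hg
  have hgc : Continuous g := by
    refine continuous_norm.comp (continuous_stack fun i => ?_)
    refine Continuous.sub ?_ continuous_const
    have h1 : Continuous fun t : ℝ => (V t, X i) := by
      refine Continuous.prodMk ?_ continuous_const
      exact (continuous_const.update l (continuous_const.add
        (continuous_id.smul continuous_const)))
    exact (continuous_feat (fun l => (hσ l).continuous) L le_rfl).comp h1
  set b : ℝ := (∑ i : Fin L with l.1 + 1 ≤ i.1, c i) + c l with hb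
  have hbc : b < Real.sqrt n * ε := by
    refine lt_of_le_of_lt ?_ hsmall
    rw [hb, add_comm, ← Finset.sum_insert (s := Finset.univ.filter fun i : Fin L => l.1 + 1 ≤ i.1)
      (by simp)]
    exact Finset.sum_le_univ_sum_of_nonneg hc0
  -- Whenever `g t ≤ √n ε`, the local Lipschitz constant applies to `V t` and improves this to `g t
  -- ≤ b < √n ε`. By continuity `g` never leaves `[0, b]`.
  have hfin : g 1 ≤ b := by
    refine le_of_forbidden_interval hgc hbc ?_ ?_
    · simp only [hg, hV0]
      linarith [hc0 l]
    · intro t ht hgt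
      have hnorm : wnorm (V t) ≤ R := by
        refine (wnorm_le_of_frob_le fun i => ?_).trans hW
        rcases lt_trichotomy i.1 l.1 with hi | hi | hi
        · rw [hVlt t i hi]
        · obtain rfl : i = l := Fin.ext hi
          rw [hVl]
          exact frob_segment_le _ _ (hle _) ht
        · rw [hVgt t i hi]; exact hle i
      have hdist : empDist σ X W (V t) ≤ ε := by
        rw [empDist_eq, div_le_iff₀ hsn, mul_comm]
        refine le_trans (le_of_eq ?_) hgt
        simp only [hg]
        rw [← stack_sub, ← stack_sub, norm_sub_rev]
      have hloc := hM W hW ε ⟨hε, le_rfl⟩ (V t) hnorm hdist l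
      rw [frob_outerMat_sub, frob_featMat_sub] at hloc
      have h1 := norm_stack_feat_succ_le hσ l (hVlt t) X
      have h2 : spec (V t l - W l) ≤ spec (W' l - W l) := by
        rw [hVl, add_sub_cancel_left, spec_smul, abs_of_nonneg ht.1]
        exact mul_le_of_le_one_left (spec_nonneg _) ht.2
      have h3 : ‖stack fun i => net σ (V t) (X i) - net σ H (X i)‖ ≤ c l := by
        have h4 : ∀ i, net σ (V t) (X i) - net σ H (X i) =
            outer σ (V t) (L - (l + 1)) (l + 1) (by omega)
              (feat σ (V t) (l + 1) l.isLt (X i)) -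
            outer σ (V t) (L - (l + 1)) (l + 1) (by omega)
              (feat σ W (l + 1) l.isLt (X i)) := by
          intro i
          rw [hH, net_hybrid_succ l (hVgt t), net_eq_outer_feat (V t) l]
        simp_rw [h4]
        refine hloc.trans ?_
        simp only [hc]
        gcongr
        refine h1.trans ?_
        gcongr
        exact frob_nonneg _
      have h5 : g t ≤ ‖stack fun i => net σ (V t) (X i) - net σ H (X i)‖ +
          ‖stack fun i => net σ H (X i) - net σ W (X i)‖ := by
        simp only [hg, ← stack_sub]
        exact norm_sub_le_norm_sub_add_norm_sub _ _ _
      linarith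
  have : ‖stack fun i => net σ (hybrid W W' l) (X i) - net σ W (X i)‖ = g 1 := by
    simp only [hg, hV1]
  rw [this]
  exact hfin

/-- Perturbation bound from the product of the spectral norms. -/
theorem norm_stack_net_sub_le_of_spec_le (hσ : ∀ l, LipschitzWith 1 (σ l))
    (X : Fin n → Vec (d 0)) {W W' : Weights L d} (hle : ∀ l, spec (W' l) ≤ spec (W l)) :
    ‖stack fun i => net σ W' (X i) - net σ W (X i)‖ ≤
      ∑ l : Fin L, (∏ i : Fin L with l.1 < i.1, spec (W i)) *
        (spec (W' l - W l) * frob (featMat σ W l l.isLt.le X)) := by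
  refine norm_stack_net_sub_le_sum W W' X _ fun l hprev => ?_
  set H := hybrid W W' (l + 1) with hH
  set V := hybrid W W' l with hV
  have hVlt : ∀ i : Fin L, i.1 < l.1 → V i = W i := fun i hi => by simp [hV, hybrid, hi]
  have hVge : ∀ i : Fin L, l.1 ≤ i.1 → V i = W' i := fun i hi => by
    rw [hV, hybrid, if_neg (by omega)]
  have h3 : ‖stack fun i => net σ V (X i) - net σ H (X i)‖ ≤
      (∏ i : Fin L with l.1 < i.1, spec (W i)) *
        (spec (W' l - W l) * frob (featMat σ W l l.isLt.le X)) := by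
    have h1 := norm_stack_feat_succ_le hσ l hVlt X
    rw [hVge l le_rfl] at h1
    have hprod : ∏ i : Fin L with l.1 + 1 ≤ i.1, spec (V i) ≤
        ∏ i : Fin L with l.1 < i.1, spec (W i) := by
      refine Finset.prod_le_prod (fun i _ => spec_nonneg _) fun i hi => ?_
      rw [hVge i (by have := (Finset.mem_filter.1 hi).2; omega)]
      exact hle i
    refine (norm_stack_le (Finset.prod_nonneg fun i _ => spec_nonneg (V i)) fun i => ?_).trans
      (mul_le_mul hprod h1 (norm_nonneg _) (Finset.prod_nonneg fun i _ => spec_nonneg _))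
    rw [hH, net_hybrid_succ l (V := V) (fun i hi => hVge i hi.le), net_eq_outer_feat V l]
    exact norm_outer_sub_le hσ V _ _ _ _ _
  have h5 : ‖stack fun i => net σ V (X i) - net σ W (X i)‖ ≤
      ‖stack fun i => net σ V (X i) - net σ H (X i)‖ +
        ‖stack fun i => net σ H (X i) - net σ W (X i)‖ := by
    simp only [← stack_sub]
    exact norm_sub_le_norm_sub_add_norm_sub _ _ _
  linarith

theorem frob_featMat_le (hσ : ∀ l, LipschitzWith 1 (σ l)) (h0 : ∀ l, σ l 0 = 0) (W : Weights L d)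
    (k : ℕ) (hk : k ≤ L) (X : Fin n → Vec (d 0)) :
    frob (featMat σ W k hk X) ≤ (∏ i : Fin L with i.1 < k, spec (W i)) * frob (inputMat X) := by
  rw [frob_featMat, inputMat, frob_of_eq_norm_stack]
  exact norm_stack_le (Finset.prod_nonneg fun i _ => spec_nonneg _) fun i =>
    norm_feat_le hσ h0 W k hk (X i)

theorem frob_mixedFeat_le (hσ : ∀ l, LipschitzWith 1 (σ l)) (h0 : ∀ l, σ l 0 = 0)
    (X X' : Fin n → Vec (d 0)) (W : Weights L d) (l : Fin L) :
    frob (mixedFeat σ W l l.isLt.le X X') ≤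
      (∏ i ∈ Finset.Iio l, spec (W i)) * frob (mixedInput X X') := by
  have hI : Finset.Iio l = Finset.univ.filter fun i : Fin L => i.1 < l.1 := by
    ext i; simp
  rw [hI]
  have hp : 0 ≤ ∏ i : Fin L with i.1 < l.1, spec (W i) :=
    Finset.prod_nonneg fun i _ => spec_nonneg _
  refine le_of_sq_le_sq ?_ (mul_nonneg hp (frob_nonneg _))
  rw [mul_pow, mixedFeat, mixedInput, frob_fromCols_sq, frob_fromCols_sq, mul_add, ← mul_pow,
    ← mul_pow]
  exact add_le_add (pow_le_pow_left₀ (frob_nonneg _) (frob_featMat_le hσ h0 W _ _ X) 2)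
    (pow_le_pow_left₀ (frob_nonneg _) (frob_featMat_le hσ h0 W _ _ X') 2)

/-- Sensitivity of the network on a pair of samples to perturbations of the weights which do not
increase the functions `φ`. -/
def PerturbBound (σ : Activations L d) (φ : (l : Fin L) → Matrix (Fin (d (l + 1))) (Fin (d l)) ℝ → ℝ)
    (β : ℝ) (X X' : Fin n → Vec (d 0)) (W : Weights L d) (b : Fin L → ℝ) : Prop :=
  ∀ W' : Weights L d, (∀ l, φ l (W' l) ≤ φ l (W l)) →
    ∑ l, b l * spec (W' l - W l) ≤ Real.sqrt n / (2 * β) →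
      ∑ i, ‖net σ W' (X i) - net σ W (X i)‖ ^ 2 + ∑ i, ‖net σ W' (X' i) - net σ W (X' i)‖ ^ 2 ≤
        2 * (∑ l, b l * spec (W' l - W l)) ^ 2

theorem frob_left_le_mixedFeat (W : Weights L d) (k : ℕ) (hk : k ≤ L) (X X' : Fin n → Vec (d 0)) :
    frob (featMat σ W k hk X) ≤ frob (mixedFeat σ W k hk X X') := by
  refine le_of_sq_le_sq ?_ (frob_nonneg _)
  rw [mixedFeat, frob_fromCols_sq]
  exact le_add_of_nonneg_right (sq_nonneg _)

theorem frob_right_le_mixedFeat (W : Weights L d) (k : ℕ) (hk : k ≤ L) (X X' : Fin n → Vec (d 0)) :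
    frob (featMat σ W k hk X') ≤ frob (mixedFeat σ W k hk X X') := by
  refine le_of_sq_le_sq ?_ (frob_nonneg _)
  rw [mixedFeat, frob_fromCols_sq]
  exact le_add_of_nonneg_left (sq_nonneg _)

theorem perturbBound_of_stack {φ : (l : Fin L) → Matrix (Fin (d (l + 1))) (Fin (d l)) ℝ → ℝ}
    {β : ℝ} {X X' : Fin n → Vec (d 0)} {W : Weights L d} {b : Fin L → ℝ}
    (h : ∀ W' : Weights L d, (∀ l, φ l (W' l) ≤ φ l (W l)) →
      ∑ l, b l * spec (W' l - W l) ≤ Real.sqrt n / (2 * β) →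
      ‖stack fun i => net σ W' (X i) - net σ W (X i)‖ ≤ ∑ l, b l * spec (W' l - W l) ∧
      ‖stack fun i => net σ W' (X' i) - net σ W (X' i)‖ ≤ ∑ l, b l * spec (W' l - W l)) :
    PerturbBound σ φ β X X' W b := by
  intro W' hle hsmall
  obtain ⟨h1, h2⟩ := h W' hle hsmall
  rw [← norm_stack_sq, ← norm_stack_sq, two_mul]
  exact add_le_add (pow_le_pow_left₀ (norm_nonneg _) h1 2) (pow_le_pow_left₀ (norm_nonneg _) h2 2)

theorem perturbBound_of_isLocalLipschitz (hn : 1 ≤ n) (hσ : ∀ l, LipschitzWith 1 (σ l))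
    {X X' : Fin n → Vec (d 0)} {R β : ℝ} (hβ : 0 < β) {M : Fin L → Weights L d → ℝ → ℝ≥0}
    (hM : IsLocalLipschitz σ X R (1 / β) M) (hM' : IsLocalLipschitz σ X' R (1 / β) M)
    {W : Weights L d} (hW : wnorm W ≤ R) :
    PerturbBound σ (fun _ => frob) β X X' W
      (fun l => M l W (1 / β) * frob (mixedFeat σ W l l.isLt.le X X')) := by
  have hsn : 0 < Real.sqrt n := Real.sqrt_pos.2 (by exact_mod_cast hn)
  refine perturbBound_of_stack fun W' hle hsmall => ?_
  have aux : ∀ T : Fin n → Vec (d 0), IsLocalLipschitz σ T R (1 / β) M →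
      (∀ l : Fin L, frob (featMat σ W l l.isLt.le T) ≤ frob (mixedFeat σ W l l.isLt.le X X')) →
      ‖stack fun i => net σ W' (T i) - net σ W (T i)‖ ≤
        ∑ l : Fin L, M l W (1 / β) * frob (mixedFeat σ W l l.isLt.le X X') *
          spec (W' l - W l) := by
    intro T hT hfr
    have hsum : ∑ l : Fin L, M l W (1 / β) *
        (spec (W' l - W l) * frob (featMat σ W l l.isLt.le T)) ≤
        ∑ l : Fin L, M l W (1 / β) * frob (mixedFeat σ W l l.isLt.le X X') *
          spec (W' l - W l) := by
      refine Finset.sum_le_sum fun l _ => ?_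
      rw [mul_assoc, mul_comm (frob _)]
      exact mul_le_mul_of_nonneg_left (mul_le_mul_of_nonneg_left (hfr l) (spec_nonneg _))
        (M l W (1 / β)).2
    refine (norm_stack_net_sub_le_of_isLocalLipschitz hn hσ (one_div_pos.2 hβ) hT hW hle
      ?_).trans hsum
    -- The factor 2 in the threshold `√n / (2 β)` of `PerturbBound` leaves the strict margin below
    -- `√n · (1 / β)` that the continuity argument requires.
    refine (hsum.trans hsmall).trans_lt ?_
    rw [mul_one_div]
    exact div_lt_div_of_pos_left hsn hβ (by linarith)
  exact ⟨aux X hM fun l => frob_left_le_mixedFeat W _ _ X X',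
    aux X' hM' fun l => frob_right_le_mixedFeat W _ _ X X'⟩

/-- Product of the spectral norms of all layers but one. -/
theorem specProd_eq_sq (W : Weights L d) (l : Fin L) :
    specProd W l = (∏ i ∈ Finset.univ.erase l, spec (W i)) ^ 2 := by
  rw [specProd, Finset.prod_pow]

/-- Layers below `l` bound the features and layers above `l` bound the outer map, so together they
give the product over `i ≠ l`. Taking `φ = spec` keeps the outer product bounded by that of `W`. -/
theorem perturbBound_spec (hσ : ∀ l, LipschitzWith 1 (σ l)) (h0 : ∀ l, σ l 0 = 0)
    (X X' : Fin n → Vec (d 0)) (β : ℝ) (W : Weights L d) :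
    PerturbBound σ (fun _ => spec) β X X' W
      (fun l => (∏ i ∈ Finset.univ.erase l, spec (W i)) * frob (mixedInput X X')) := by
  refine perturbBound_of_stack fun W' hle _ => ?_
  have aux : ∀ T : Fin n → Vec (d 0), (∀ l : Fin L, frob (featMat σ W l l.isLt.le T) ≤
        frob (mixedFeat σ W l l.isLt.le X X')) →
      ‖stack fun i => net σ W' (T i) - net σ W (T i)‖ ≤
        ∑ l : Fin L, (∏ i ∈ Finset.univ.erase l, spec (W i)) * frob (mixedInput X X') *
          spec (W' l - W l) := by
    intro T hfr
    refine (norm_stack_net_sub_le_of_spec_le hσ T hle).trans (Finset.sum_le_sum fun l _ => ?_)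
    have h1 := (hfr l).trans (frob_mixedFeat_le hσ h0 X X' W l)
    have h2 : (∏ i : Fin L with l.1 < i.1, spec (W i)) * ∏ i ∈ Finset.Iio l, spec (W i) =
        ∏ i ∈ Finset.univ.erase l, spec (W i) := by
      rw [← Finset.prod_union]
      · congr 1
        ext i
        simp only [Finset.mem_union, Finset.mem_filter, Finset.mem_univ, true_and, Finset.mem_Iio,
          Finset.mem_erase, and_true, Fin.lt_def, ne_eq, Fin.ext_iff]
        omega
      · rw [Finset.disjoint_left]
        intro i hi hi'
        simp only [Finset.mem_filter, Finset.mem_univ, true_and, Finset.mem_Iio, Fin.lt_def] at hi hi'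
        omega
    rw [← h2]
    have h3 : 0 ≤ ∏ i : Fin L with l.1 < i.1, spec (W i) :=
      Finset.prod_nonneg fun i _ => spec_nonneg _
    calc _ ≤ (∏ i : Fin L with l.1 < i.1, spec (W i)) * (spec (W' l - W l) *
          ((∏ i ∈ Finset.Iio l, spec (W i)) * frob (mixedInput X X'))) := by
          gcongr
          exact spec_nonneg _
      _ = _ := by ring
  exact ⟨aux X fun l => frob_left_le_mixedFeat W _ _ X X',
    aux X' fun l => frob_right_le_mixedFeat W _ _ X X'⟩

end Network

/-! ### Dyadic scales and geometric sums. -/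

section Scales

/-- The largest admissible index is taken. Either it is below `N` and the radius is within a factor
two of `x`, or it equals `N` and the radius is the floor `R / 2 ^ N`. -/
theorem exists_dyadic_radius {x R : ℝ} (hx0 : 0 ≤ x) (hx : x ≤ R) (N : ℕ) :
    ∃ i ≤ N, x ≤ R / 2 ^ i ∧ R / 2 ^ i ≤ 2 * x + R / 2 ^ N := by
  have hR : 0 ≤ R := hx0.trans hx
  obtain ⟨i, hi⟩ : ∃ i, i = Nat.findGreatest (fun i => x ≤ R / 2 ^ i) N := ⟨_, rfl⟩
  have hiN : i ≤ N := hi ▸ Nat.findGreatest_le N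
  have hxi : x ≤ R / 2 ^ i := by
    rw [hi]
    exact Nat.findGreatest_spec (P := fun i => x ≤ R / 2 ^ i) (Nat.zero_le N) (by simpa using hx)
  refine ⟨i, hiN, hxi, ?_⟩
  rcases hiN.eq_or_lt with h | h
  · rw [h]; linarith
  · have h1 := Nat.findGreatest_is_greatest (P := fun i => x ≤ R / 2 ^ i) (n := N) (k := i + 1)
      (by omega) (by omega)
    rw [pow_succ, ← div_div] at h1
    have h2 : 0 ≤ R / 2 ^ N := by positivity
    linarith

/-- The least admissible `k`. The alternative `k = 0` has no upper bound on `2 ^ k`, but corresponds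
to the net with one point. -/
theorem exists_dyadic_scale {u : ℝ} {n j : ℕ} (hu : u ≤ 2 ^ n) (hj : j ≤ n) :
    ∃ k ≤ 2 * n, u * 2 ^ j ≤ 2 ^ k ∧ (k = 0 ∨ (2 : ℝ) ^ k ≤ 2 * (u * 2 ^ j)) := by
  have hex : ∃ k : ℕ, u * 2 ^ j ≤ 2 ^ k := ⟨n + j, by
    rw [pow_add]; gcongr⟩
  refine ⟨Nat.find hex, ?_, Nat.find_spec hex, ?_⟩
  · refine (Nat.find_min' hex (m := n + j) ?_).trans (by omega)
    rw [pow_add]; gcongr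
  · rcases Nat.eq_zero_or_pos (Nat.find hex) with h | h
    · exact Or.inl h
    · right
      obtain ⟨m, hm⟩ := Nat.exists_eq_succ_of_ne_zero h.ne'
      have h1 := Nat.find_min hex (m := m) (by omega)
      rw [hm, Nat.succ_eq_add_one, pow_succ]
      push Not at h1
      linarith

theorem sum_half_pow_le (N : ℕ) : ∑ j ∈ Finset.range N, (1 / 2 : ℝ) ^ j ≤ 2 := by
  have h : ∀ N : ℕ, ∑ j ∈ Finset.range N, (1 / 2 : ℝ) ^ j = 2 - 2 * (1 / 2) ^ N := by
    intro N
    induction N with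
    | zero => simp
    | succ N ih => rw [Finset.sum_range_succ, ih, pow_succ]; ring
  rw [h]
  have : (0 : ℝ) ≤ (1 / 2) ^ N := by positivity
  linarith

theorem sum_half_pow_mul_le (N : ℕ) :
    ∑ j ∈ Finset.range N, (1 / 2 : ℝ) ^ j * ((j : ℝ) + 1) ≤ 4 := by
  have h : ∀ N : ℕ, ∑ j ∈ Finset.range N, (1 / 2 : ℝ) ^ j * ((j : ℝ) + 1) =
      4 - (1 / 2) ^ N * (2 * N + 4) := by
    intro N
    induction N with
    | zero => simp
    | succ N ih => rw [Finset.sum_range_succ, ih, pow_succ]; push_cast; ring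
  rw [h]
  have : (0 : ℝ) ≤ (1 / 2) ^ N * (2 * N + 4) := by positivity
  linarith

/-- The truncated subtraction makes each of the first `j₀` terms equal to one; a geometric series
follows. This count of scales is the source of the logarithmic factor `Λ_n`. -/
theorem sum_half_pow_tsub_le (j₀ N : ℕ) :
    ∑ j ∈ Finset.range N, (1 / 2 : ℝ) ^ (j - j₀) ≤ j₀ + 2 := by
  have h1 : ∀ j, (1 / 2 : ℝ) ^ (j - j₀) ≤
      (if j < j₀ then 1 else 0) + if j₀ ≤ j then (1 / 2 : ℝ) ^ (j - j₀) else 0 := by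
    intro j
    rcases lt_or_ge j j₀ with h | h
    · simp [h, not_le.2 h, Nat.sub_eq_zero_of_le h.le]
    · simp [h, not_lt.2 h]
  refine (Finset.sum_le_sum fun j _ => h1 j).trans ?_
  rw [Finset.sum_add_distrib]
  gcongr
  · rw [← Finset.sum_filter, Finset.sum_const, nsmul_eq_mul, mul_one]
    have : (Finset.range N).filter (fun j => j < j₀) ⊆ Finset.range j₀ := fun j hj => by
      simpa using (Finset.mem_filter.1 hj).2
    exact_mod_cast (Finset.card_le_card this).trans_eq (Finset.card_range j₀)
  · have h2 : ∀ N : ℕ, ∑ j ∈ Finset.range N, (if j₀ ≤ j then (1 / 2 : ℝ) ^ (j - j₀) else 0) =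
        ∑ m ∈ Finset.range (N - j₀), (1 / 2 : ℝ) ^ m := by
      intro N
      induction N with
      | zero => simp
      | succ N ih =>
        rw [Finset.sum_range_succ, ih]
        by_cases h : j₀ ≤ N
        · rw [if_pos h, Nat.succ_sub h, Finset.sum_range_succ]
        · rw [if_neg h, add_zero, Nat.sub_eq_zero_of_le (by omega : N ≤ j₀),
            Nat.sub_eq_zero_of_le (by omega : N + 1 ≤ j₀)]
    rw [h2]
    exact sum_half_pow_le _

theorem sum_half_pow_mul_tsub_le (j₀ N : ℕ) :
    ∑ j ∈ Finset.range N, (1 / 2 : ℝ) ^ j * ((j - j₀ : ℕ) : ℝ) ≤ 4 * (1 / 2) ^ j₀ := by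
  have h2 : ∀ N : ℕ, ∑ j ∈ Finset.range N, (1 / 2 : ℝ) ^ j * ((j - j₀ : ℕ) : ℝ) =
      (1 / 2) ^ j₀ * ∑ m ∈ Finset.range (N - j₀), (1 / 2 : ℝ) ^ m * m := by
    intro N
    induction N with
    | zero => simp
    | succ N ih =>
      rw [Finset.sum_range_succ, ih]
      by_cases h : j₀ ≤ N
      · rw [Nat.succ_sub h, Finset.sum_range_succ, mul_add, ← mul_assoc, ← pow_add]
        congr 4
        omega
      · rw [Nat.sub_eq_zero_of_le (by omega : N ≤ j₀),
            Nat.sub_eq_zero_of_le (by omega : N + 1 ≤ j₀)]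
        simp
  rw [h2, mul_comm]
  gcongr
  refine le_trans (Finset.sum_le_sum fun m _ => ?_) (sum_half_pow_mul_le (N - j₀))
  gcongr
  linarith

/-- The scale at which volumetric entropy bounds take over. -/
theorem exists_switch_scale {n : ℕ} {β : ℝ} (hn : 1 ≤ n) (hβ : 0 < β) :
    ∃ j₀ : ℕ, (j₀ : ℝ) + 3 ≤ 5 * Lam n β ∧ (1 / 2 : ℝ) ^ j₀ ≤ β / n ^ 5 ∧ 1 ≤ Lam n β := by
  have hn' : (1 : ℝ) ≤ n := by exact_mod_cast hn
  set y : ℝ := max 2 ((n : ℝ) ^ 5 / β) with hy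
  have hy2 : 2 ≤ y := le_max_left _ _
  have hl2 : (0.69 : ℝ) < Real.log 2 := by have := Real.log_two_gt_d9; linarith
  have hly : Real.log 2 ≤ Real.log y := Real.log_le_log (by norm_num) hy2
  have hLam : Lam n β = 1 + Real.log y := rfl
  refine ⟨⌈Real.log y / Real.log 2⌉₊, ?_, ?_, ?_⟩
  · have h1 := Nat.ceil_lt_add_one (a := Real.log y / Real.log 2)
      (div_nonneg (by linarith) (by linarith))
    have h2 : Real.log y / Real.log 2 ≤ 2 * Real.log y := by
      rw [div_le_iff₀ (by linarith)]
      nlinarith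
    rw [hLam]
    linarith
  · have h1 := Nat.le_ceil (Real.log y / Real.log 2)
    rw [div_le_iff₀ (by linarith), ← Real.log_pow] at h1
    have h2 : y ≤ 2 ^ ⌈Real.log y / Real.log 2⌉₊ :=
      (Real.log_le_log_iff (by linarith) (by positivity)).1 h1
    have h3 : (n : ℝ) ^ 5 / β ≤ 2 ^ ⌈Real.log y / Real.log 2⌉₊ := (le_max_right _ _).trans h2
    rw [one_div, inv_pow, ← inv_div ((n : ℝ) ^ 5) β]
    exact inv_anti₀ (by positivity) h3
  · rw [hLam]; linarith

end Scales

/-! ### A data-independent weighted family of networks. -/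

section NetFamily

theorem frob_le_wnorm {L : ℕ} {d : ℕ → ℕ} (W : Weights L d) (l : Fin L) : frob (W l) ≤ wnorm W := by
  refine Real.le_sqrt_of_sq_le ?_
  exact Finset.single_le_sum (f := fun l => frob (W l) ^ 2) (fun _ _ => sq_nonneg _)
    (Finset.mem_univ l)

theorem sum_frob_le {L : ℕ} {d : ℕ → ℕ} (W : Weights L d) :
    ∑ l, frob (W l) ≤ Real.sqrt L * wnorm W := by
  have h := sq_sum_le_card_mul_sum_sq (s := (Finset.univ : Finset (Fin L)))
    (f := fun l => frob (W l))
  rw [Finset.card_univ, Fintype.card_fin] at h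
  rw [wnorm, ← Real.sqrt_mul (Nat.cast_nonneg L)]
  exact Real.le_sqrt_of_sq_le h

/-- One `log N` pays for the radius index, one for the accuracy index, and `log (c k)` for the point
of the net. -/
theorem sum_exp_neg_layer {N : ℕ} (hN : 0 < N) (c : ℕ → ℕ) (hc : ∀ k, 1 ≤ c k) :
    ∑ x : Fin N × (Σ k : Fin N, Fin (c k)),
      Real.exp (-(2 * Real.log N + Real.log (c x.2.1))) = 1 := by
  have hN' : (0 : ℝ) < N := by exact_mod_cast hN
  have h1 : ∀ k, Real.exp (-(2 * Real.log N + Real.log (c k))) =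
      (N : ℝ)⁻¹ * (N : ℝ)⁻¹ * (c k : ℝ)⁻¹ := by
    intro k
    have hck : (0 : ℝ) < c k := by exact_mod_cast hc k
    rw [two_mul, Real.exp_neg, Real.exp_add, Real.exp_add, Real.exp_log hN', Real.exp_log hck,
      mul_inv, mul_inv]
  simp_rw [Fintype.sum_prod_type, Fintype.sum_sigma, h1, Finset.sum_const, Finset.card_univ,
    Fintype.card_fin, nsmul_eq_mul]
  have h2 : ∀ k : Fin N, (c k : ℝ) * ((N : ℝ)⁻¹ * (N : ℝ)⁻¹ * (c k : ℝ)⁻¹) =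
      (N : ℝ)⁻¹ * (N : ℝ)⁻¹ := by
    intro k
    have hck : (c k : ℝ) ≠ 0 := by have := hc k; positivity
    field_simp
  simp_rw [h2, Finset.sum_const, Finset.card_univ, Fintype.card_fin, nsmul_eq_mul]
  field_simp

/-- A finite weighted family of networks which approximates every network of the Frobenius ball at
all dyadic scales, with relative accuracies prescribed layer by layer. -/
theorem exists_net_family {L : ℕ} {d : ℕ → ℕ} (n : ℕ) (hd : ∀ k ≤ L, 1 ≤ d k)
    (φ : (l : Fin L) → Matrix (Fin (d (l + 1))) (Fin (d l)) ℝ → ℝ) (hφ : ∀ l, Continuous (φ l))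
    (hφ0 : ∀ l V, φ l 0 ≤ φ l V) {R : ℝ} (hR : 0 < R) :
    ∃ (ι : Type) (_ : Fintype ι) (V : ι → Weights L d) (H : ι → ℝ), (∀ v, 0 ≤ H v) ∧
      ∑ v, Real.exp (-(2 * L * Real.log (2 * n + 1 : ℕ) + H v)) ≤ 1 ∧
      ∀ W : Weights L d, wnorm W ≤ R → ∀ u : Fin L → ℝ, (∀ l, 0 ≤ u l) → (∀ l, u l ≤ 2 ^ n) →
        ∀ j ≤ n, ∃ v, (∀ l, φ l (V v l) ≤ φ l (W l)) ∧
          (∀ l, u l * 2 ^ j * spec (V v l - W l) ≤ 2 * frob (W l) + R / 4 ^ n) ∧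
          ∀ m : ℕ, H v ≤ 4100 * (4 * (∑ l : Fin L, ((d (l + 1) : ℝ) + d l) * u l ^ 2) * 4 ^ j / 4 ^ m
            + (∑ l : Fin L, ((d (l + 1) : ℝ) + d l) * d l) * m) := by
  have hnets := fun l : Fin L => exists_matrix_nets (p := d (l + 1)) (q := d l)
    (hd _ l.isLt) (hd _ l.isLt.le)
  choose c hc1 hc0 hclog hrep using hnets
  have hrep' : ∀ l : Fin L, ∀ i k : ℕ, ∃ rep : Fin (c l k) →
      Matrix (Fin (d (l + 1))) (Fin (d l)) ℝ, ∀ V, frob V ≤ R / 2 ^ i →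
        ∃ t, φ l (rep t) ≤ φ l V ∧ spec (rep t - V) ≤ R / 2 ^ i / 2 ^ k :=
    fun l i k => hrep l (φ l) (hφ l) (hφ0 l) (R / 2 ^ i) (by positivity) k
  choose rep hrep2 using hrep'
  set N : ℕ := 2 * n + 1 with hN
  refine ⟨(l : Fin L) → Fin N × (Σ k : Fin N, Fin (c l k)), inferInstance,
    fun v l => rep l (v l).1 (v l).2.1 (v l).2.2,
    fun v => ∑ l, Real.log (c l (v l).2.1), ?_, ?_, ?_⟩
  · intro v
    refine Finset.sum_nonneg fun l _ => Real.log_nonneg ?_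
    exact_mod_cast hc1 l _
  · have h1 : ∀ v : (l : Fin L) → Fin N × (Σ k : Fin N, Fin (c l k)),
        Real.exp (-(2 * L * Real.log (N : ℕ) + ∑ l, Real.log (c l (v l).2.1))) =
          ∏ l, Real.exp (-(2 * Real.log N + Real.log (c l (v l).2.1))) := by
      intro v
      rw [← Real.exp_sum, Finset.sum_neg_distrib, Finset.sum_add_distrib, Finset.sum_const,
        Finset.card_univ, Fintype.card_fin, nsmul_eq_mul]
      congr 2; ring
    simp_rw [h1]
    have h2 := Finset.prod_univ_sum (fun l : Fin L => (Finset.univ :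
      Finset (Fin N × (Σ k : Fin N, Fin (c l k)))))
      (fun l x => Real.exp (-(2 * Real.log N + Real.log (c l x.2.1))))
    rw [Fintype.piFinset_univ] at h2
    rw [← h2]
    exact (Finset.prod_eq_one fun l _ => sum_exp_neg_layer (by omega) (c l) (hc1 l)).le
  · intro W hW u hu0 hu j hj
    have hsel : ∀ l : Fin L, ∃ x : Fin N × (Σ k : Fin N, Fin (c l k)),
        φ l (rep l x.1 x.2.1 x.2.2) ≤ φ l (W l) ∧
        u l * 2 ^ j * spec (rep l x.1 x.2.1 x.2.2 - W l) ≤ 2 * frob (W l) + R / 4 ^ n ∧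
        ∀ m : ℕ, Real.log (c l x.2.1) ≤ 4100 * (((d (l + 1) : ℝ) + d l) *
          (4 * u l ^ 2 * 4 ^ j / 4 ^ m + d l * m)) := by
      intro l
      obtain ⟨i, hi, hi1, hi2⟩ := exists_dyadic_radius (frob_nonneg (W l))
        ((frob_le_wnorm W l).trans hW) (2 * n)
      obtain ⟨k, hk, hk1, hk2⟩ := exists_dyadic_scale (hu l) hj
      obtain ⟨t, ht1, ht2⟩ := hrep2 l i k (W l) hi1
      refine ⟨⟨⟨i, by omega⟩, ⟨⟨k, by omega⟩, t⟩⟩, ht1, ?_, ?_⟩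
      -- The accuracy is relative to the dyadic radius `R / 2 ^ i`, which is comparable to `frob (W
      -- l)` up to the floor `R / 4 ^ n`.
      · calc u l * 2 ^ j * spec (rep l i k t - W l) ≤ 2 ^ k * (R / 2 ^ i / 2 ^ k) :=
              mul_le_mul hk1 ht2 (spec_nonneg _) (by positivity)
          _ = R / 2 ^ i := by field_simp
          _ ≤ 2 * frob (W l) + R / 2 ^ (2 * n) := hi2
          _ = _ := by rw [pow_mul]; norm_num
      · intro m
        simp only
        -- For `k = 0` the entropy vanishes as `c l 0 = 1`; otherwise `2 ^ k ≤ 2 u l 2 ^ j`, so `4 ^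
        -- k` is controlled by `u l ^ 2 4 ^ j`.
        rcases hk2 with rfl | hk2
        · rw [hc0, Nat.cast_one, Real.log_one]
          positivity
        · refine (hclog l k m).trans ?_
          have h4 : (4 : ℝ) ^ k ≤ 4 * u l ^ 2 * 4 ^ j := by
            have e1 : (4 : ℝ) ^ k = (2 ^ k) ^ 2 := by rw [← pow_mul, mul_comm, pow_mul]; norm_num
            have e2 : (4 : ℝ) ^ j = (2 ^ j) ^ 2 := by rw [← pow_mul, mul_comm, pow_mul]; norm_num
            rw [e1, e2]
            calc ((2 : ℝ) ^ k) ^ 2 ≤ (2 * (u l * 2 ^ j)) ^ 2 := by gcongr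
              _ = _ := by ring
          gcongr
    choose x hx1 hx2 hx3 using hsel
    refine ⟨x, hx1, hx2, fun m => ?_⟩
    refine (Finset.sum_le_sum fun l _ => hx3 l m).trans_eq ?_
    have e : ∀ l : Fin L, ((d (l + 1) : ℝ) + d l) * (4 * u l ^ 2 * 4 ^ j / 4 ^ m + d l * m) =
        4 * 4 ^ j / 4 ^ m * (((d (l + 1) : ℝ) + d l) * u l ^ 2) +
          m * (((d (l + 1) : ℝ) + d l) * d l) := fun l => by ring
    simp_rw [e]
    rw [← Finset.mul_sum, Finset.sum_add_distrib, ← Finset.mul_sum, ← Finset.mul_sum]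
    ring

end NetFamily

/-! ### Summation of entropies along the chain. -/

section EntropySum

theorem sqrt_le_add_four {x a b c e : ℝ} (ha : 0 ≤ a) (hb : 0 ≤ b) (hc : 0 ≤ c) (he : 0 ≤ e)
    (h : x ≤ a ^ 2 + b ^ 2 + c ^ 2 + e ^ 2) : Real.sqrt x ≤ a + b + c + e := by
  refine Real.sqrt_le_iff.2 ⟨by positivity, h.trans ?_⟩
  have : 0 ≤ a * b + a * c + a * e + b * c + b * e + c * e := by positivity
  linarith [this, (by ring : (a + b + c + e) ^ 2 = a ^ 2 + b ^ 2 + c ^ 2 + e ^ 2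
    + 2 * (a * b + a * c + a * e + b * c + b * e + c * e))]

/-- Summation of the dyadic entropy bounds. -/
theorem chain_sum_le {n : ℕ} (j₀ : ℕ) {U Q A E : ℝ} (hU : 0 ≤ U) (hQ : 0 ≤ Q)
    (hA : 0 ≤ A) (hE : 0 ≤ E) (H : ℕ → ℝ)
    (hH : ∀ j ≤ n, ∀ m : ℕ, H j ≤ 4100 * (4 * U * 4 ^ j / 4 ^ m + Q * m)) :
    3 * (Real.sqrt ((A + H 0 + 1) / n) + E / Real.sqrt n) +
      ∑ j ∈ Finset.range n, 3 * (1 / 2) ^ j *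
        (Real.sqrt ((A + (H (j + 1) + H j) + (j + 1)) / n) + E / Real.sqrt n) ≤
      (9 * Real.sqrt A + 9 * E + 15 + 900 * Real.sqrt U * (j₀ + 3)
        + 1200 * Real.sqrt Q * (1 / 2) ^ j₀) / Real.sqrt n := by
  have hU2 : Real.sqrt U ^ 2 = U := Real.sq_sqrt hU
  have hQ2 : Real.sqrt Q ^ 2 = Q := Real.sq_sqrt hQ
  have hA2 : Real.sqrt A ^ 2 = A := Real.sq_sqrt hA
  have h0 : Real.sqrt (A + H 0 + 1) ≤ Real.sqrt A + 129 * Real.sqrt U + 0 + 1 := by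
    refine sqrt_le_add_four (by positivity) (by positivity) le_rfl (by norm_num) ?_
    have := hH 0 (Nat.zero_le _) 0
    rw [mul_pow, hU2, hA2]
    norm_num at this ⊢
    linarith
  have hj : ∀ j ∈ Finset.range n, (1 / 2 : ℝ) ^ j *
      Real.sqrt (A + (H (j + 1) + H j) + (j + 1)) ≤
      Real.sqrt A * (1 / 2) ^ j + 287 * Real.sqrt U * (1 / 2) ^ (j - j₀)
        + 91 * Real.sqrt Q * ((1 / 2) ^ j * ((j - j₀ : ℕ) : ℝ)) + (1 / 2) ^ j * ((j : ℝ) + 1) := by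
    intro j hjn
    rw [Finset.mem_range] at hjn
    -- Truncated subtraction: up to `j₀` the dimension-free entropy is used (`m = 0`); beyond it the
    -- volumetric cost `Q m` is paid and the other part decays like `(1 / 2) ^ m`.
    set m := j - j₀ with hm
    have h1 := hH j hjn.le m
    have h2 := hH (j + 1) hjn m
    have hmm : (m : ℝ) ≤ (m : ℝ) ^ 2 := by exact_mod_cast Nat.le_self_pow (by norm_num) m
    have e1 : ((2 : ℝ) ^ j / 2 ^ m) ^ 2 = 4 ^ j / 4 ^ m := by
      rw [div_pow, ← pow_mul, ← pow_mul, mul_comm j, mul_comm m, pow_mul, pow_mul]; norm_num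
    -- Both scales together cost at most `4100 · 20 · U 4 ^ j / 4 ^ m + 8200 Q m`; here `287 ^ 2 ≥
    -- 82000` and `91 ^ 2 ≥ 8200`.
    have h3 : Real.sqrt (A + (H (j + 1) + H j) + (j + 1)) ≤
        Real.sqrt A + 287 * Real.sqrt U * (2 ^ j / 2 ^ m) + 91 * Real.sqrt Q * m
          + ((j : ℝ) + 1) := by
      refine sqrt_le_add_four (by positivity) (by positivity) (by positivity) (by positivity) ?_
      rw [mul_pow, mul_pow, mul_pow, mul_pow, hU2, hA2, hQ2, e1]
      have h4 : 0 ≤ U * (4 ^ j / 4 ^ m) := by positivity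
      have h5 : Q * m ≤ Q * (m : ℝ) ^ 2 := by gcongr
      have h6 : (j : ℝ) + 1 ≤ ((j : ℝ) + 1) ^ 2 := by
        have : (0 : ℝ) ≤ j := Nat.cast_nonneg j
        nlinarith
      have h7 : 0 ≤ Q * (m : ℝ) ^ 2 := by positivity
      rw [pow_succ] at h2
      have e2 : 4 * U * 4 ^ j / 4 ^ m = 4 * (U * (4 ^ j / 4 ^ m)) := by ring
      have e3 : 4 * U * (4 ^ j * 4) / 4 ^ m = 16 * (U * (4 ^ j / 4 ^ m)) := by ring
      rw [e2] at h1
      rw [e3] at h2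
      linarith
    calc _ ≤ (1 / 2 : ℝ) ^ j * (Real.sqrt A + 287 * Real.sqrt U * (2 ^ j / 2 ^ m)
          + 91 * Real.sqrt Q * m + ((j : ℝ) + 1)) := by gcongr
      _ = _ := by
        have e4 : (1 / 2 : ℝ) ^ j * (2 ^ j / 2 ^ m) = (1 / 2) ^ m := by
          rw [one_div, inv_pow, inv_pow]; field_simp
        rw [← e4]; ring
  have hsum := Finset.sum_le_sum hj
  simp only [Finset.sum_add_distrib, ← Finset.mul_sum] at hsum
  have s1 := sum_half_pow_le n
  have s2 := sum_half_pow_mul_le n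
  have s3 := sum_half_pow_tsub_le j₀ n
  have s4 := sum_half_pow_mul_tsub_le j₀ n
  have hdiv : ∀ x : ℝ, Real.sqrt (x / n) = Real.sqrt x / Real.sqrt n := fun x =>
    Real.sqrt_div' _ (Nat.cast_nonneg n)
  have e5 : 3 * (Real.sqrt ((A + H 0 + 1) / n) + E / Real.sqrt n) +
      ∑ j ∈ Finset.range n, 3 * (1 / 2) ^ j *
        (Real.sqrt ((A + (H (j + 1) + H j) + (j + 1)) / n) + E / Real.sqrt n) =
      (3 * (Real.sqrt (A + H 0 + 1) + E) + 3 * (∑ j ∈ Finset.range n, (1 / 2) ^ j *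
        Real.sqrt (A + (H (j + 1) + H j) + (j + 1)))
        + 3 * E * ∑ j ∈ Finset.range n, (1 / 2) ^ j) / Real.sqrt n := by
    have e6 : ∀ j : ℕ, 3 * (1 / 2) ^ j *
        (Real.sqrt ((A + (H (j + 1) + H j) + (j + 1)) / n) + E / Real.sqrt n) =
        (3 * ((1 / 2) ^ j * Real.sqrt (A + (H (j + 1) + H j) + (j + 1)))
          + 3 * E * (1 / 2) ^ j) / Real.sqrt n := fun j => by rw [hdiv]; ring
    simp_rw [e6]
    rw [← Finset.sum_div, Finset.sum_add_distrib, ← Finset.mul_sum, ← Finset.mul_sum, hdiv]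
    ring
  rw [e5]
  refine div_le_div_of_nonneg_right ?_ (Real.sqrt_nonneg _)
  have t1 := mul_le_mul_of_nonneg_left s1 (Real.sqrt_nonneg A)
  have t2 := mul_le_mul_of_nonneg_left s3 (by positivity : 0 ≤ 287 * Real.sqrt U)
  have t3 := mul_le_mul_of_nonneg_left s4 (by positivity : 0 ≤ 91 * Real.sqrt Q)
  have t4 := mul_le_mul_of_nonneg_left s1 (by positivity : 0 ≤ 3 * E)
  have t5 : 0 ≤ Real.sqrt U * j₀ := by positivity
  have t6 : 0 ≤ Real.sqrt Q * (1 / 2) ^ j₀ := by positivity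
  have t7 := Real.sqrt_nonneg U
  nlinarith

end EntropySum

/-! ### The gap as a mean over ghost samples. -/

section Gap

variable {Z : Type*} [MeasurableSpace Z]

/-- The generalization gap is an average of empirical differences. -/
theorem ofReal_integral_sub_le_lintegral (P : Measure Z) [IsProbabilityMeasure P] {n : ℕ}
    (hn : 1 ≤ n) {h : Z → ℝ} (hm : Measurable h) (hb : ∀ z, h z ∈ Icc (0 : ℝ) 1) (S : Fin n → Z) :
    ENNReal.ofReal ((∫ z, h z ∂P) - (∑ i, h (S i)) / n) ≤
      ∫⁻ S', ENNReal.ofReal ((∑ i, (h (S' i) - h (S i))) / n) ∂Measure.pi (fun _ : Fin n => P) := by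
  have hn' : (n : ℝ) ≠ 0 := by positivity
  have hint : Integrable h P := Integrable.of_bound hm.aestronglyMeasurable 1
    (Filter.Eventually.of_forall fun z => by
      rw [Real.norm_of_nonneg (hb z).1]; exact (hb z).2)
  have hev : ∀ i : Fin n, Integrable (fun S' : Fin n → Z => h (S' i))
      (Measure.pi (fun _ : Fin n => P)) := fun i =>
    (measurePreserving_eval (fun _ : Fin n => P) i).integrable_comp_of_integrable hint
  have hX : Integrable (fun S' : Fin n → Z => (∑ i, (h (S' i) - h (S i))) / n)
      (Measure.pi (fun _ : Fin n => P)) :=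
    (integrable_finsetSum _ fun i _ => (hev i).sub (integrable_const _)).div_const _
  have heq : (∫ z, h z ∂P) - (∑ i, h (S i)) / n =
      ∫ S', (∑ i, (h (S' i) - h (S i))) / n ∂Measure.pi (fun _ : Fin n => P) := by
    have h0 : ∀ i ∈ (Finset.univ : Finset (Fin n)), Integrable (fun S' : Fin n → Z =>
        h (S' i) - h (S i)) (Measure.pi (fun _ : Fin n => P)) :=
      fun i _ => (hev i).sub (integrable_const _)
    rw [integral_div, integral_finsetSum _ h0]
    have h1 : ∀ i : Fin n, ∫ S' : Fin n → Z, (h (S' i) - h (S i))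
        ∂Measure.pi (fun _ : Fin n => P) = (∫ z, h z ∂P) - h (S i) := by
      intro i
      rw [integral_sub (hev i) (integrable_const _), integral_const, probReal_univ, one_smul,
        integral_comp_eval (μ := fun _ : Fin n => P) hm.aestronglyMeasurable]
    simp_rw [h1]
    rw [Finset.sum_sub_distrib, Finset.sum_const, Finset.card_univ, Fintype.card_fin,
      nsmul_eq_mul]
    field_simp
  rw [heq, integral_eq_lintegral_pos_part_sub_lintegral_neg_part hX]
  refine le_trans (ENNReal.ofReal_le_ofReal (sub_le_self _ ENNReal.toReal_nonneg)) ?_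
  exact ENNReal.ofReal_toReal_le

end Gap

/-! ### Telescoping of empirical differences. -/

section Chaining

/-- Confidence term without union bounds. -/
def confBase (L : ℕ) (d : ℕ → ℕ) (n : ℕ) (δ : ℝ) : ℝ :=
  Real.sqrt ((∑ l : Fin L, Real.log (d l * n) + Real.log δ⁻¹) / n)

theorem mul_log_le_sum_log {L : ℕ} {d : ℕ → ℕ} (hd : ∀ k ≤ L, 1 ≤ d k) {n : ℕ} (hn : 1 ≤ n) :
    L * Real.log n ≤ ∑ l : Fin L, Real.log (d l * n) := by
  have h : ∀ l ∈ (Finset.univ : Finset (Fin L)), Real.log n ≤ Real.log (d l * n) := by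
    intro l _
    have h1 : (1 : ℝ) ≤ d l := by exact_mod_cast hd l l.isLt.le
    have h2 : (1 : ℝ) ≤ n := by exact_mod_cast hn
    exact Real.log_le_log (by linarith) (le_mul_of_one_le_left (by linarith) h1)
  simpa using Finset.card_nsmul_le_sum _ _ _ h

theorem log_two_mul_add_one_le {n : ℕ} (hn : 2 ≤ n) :
    Real.log (2 * n + 1 : ℕ) ≤ 3 * Real.log n := by
  have h : (2 * n + 1 : ℕ) ≤ n ^ 3 := by
    have : n ^ 3 = n * n * n := by ring
    nlinarith [Nat.mul_le_mul hn hn]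
  have h2 := Real.log_le_log (by positivity) (by exact_mod_cast h : ((2 * n + 1 : ℕ) : ℝ) ≤ (n : ℝ) ^ 3)
  rwa [Real.log_pow] at h2

variable {L : ℕ} {d : ℕ → ℕ} {σ : Activations L d} {Y : Type*}

theorem sq_sum_sub_le {n : ℕ} {β ρ : ℝ} (hβ : 0 < β) {loss : Vec (d L) → Y → ℝ}
    (hlip : ∀ y u v, |loss u y - loss v y| ≤ β * ‖u - v‖) {W V : Weights L d}
    {S S' : Fin n → Vec (d 0) × Y}
    (h : ∑ i, ‖net σ V (inputs S i) - net σ W (inputs S i)‖ ^ 2 +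
      ∑ i, ‖net σ V (inputs S' i) - net σ W (inputs S' i)‖ ^ 2 ≤ 2 * (Real.sqrt n * ρ / (2 * β)) ^ 2) :
    ∑ i, (loss (net σ V (S i).1) (S i).2 - loss (net σ W (S i).1) (S i).2) ^ 2 +
      ∑ i, (loss (net σ V (S' i).1) (S' i).2 - loss (net σ W (S' i).1) (S' i).2) ^ 2 ≤
      n * ρ ^ 2 / 2 := by
  have h1 : ∀ T : Fin n → Vec (d 0) × Y,
      ∑ i, (loss (net σ V (T i).1) (T i).2 - loss (net σ W (T i).1) (T i).2) ^ 2 ≤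
        β ^ 2 * ∑ i, ‖net σ V (inputs T i) - net σ W (inputs T i)‖ ^ 2 := by
    intro T
    rw [Finset.mul_sum]
    refine Finset.sum_le_sum fun i _ => ?_
    rw [← mul_pow, ← sq_abs]
    exact pow_le_pow_left₀ (abs_nonneg _) (hlip _ _ _) 2
  have h2 := mul_le_mul_of_nonneg_left h (sq_nonneg β)
  have h3 : β ^ 2 * (2 * (Real.sqrt n * ρ / (2 * β)) ^ 2) = n * ρ ^ 2 / 2 := by
    rw [div_pow, mul_pow, Real.sq_sqrt (Nat.cast_nonneg n)]
    field_simp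
  rw [h3, mul_add] at h2
  linarith [h1 S, h1 S']

/-- Telescoping along a chain of approximations of the empirical difference of `g`. -/
theorem chain_telescope {Z : Type*} {n : ℕ} (hn : 1 ≤ n) {g : Z → ℝ}
    {h : ℕ → Z → ℝ} (hh : ∀ j z, h j z ∈ Icc (0 : ℝ) 1) {S S' : Fin n → Z}
    (happ : ∀ j ≤ n, ∑ i, (h j (S i) - g (S i)) ^ 2 + ∑ i, (h j (S' i) - g (S' i)) ^ 2 ≤
      n * ((1 / 2) ^ j) ^ 2 / 2) {t : ℝ} {T : ℕ → ℝ}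
    (hstart : ∑ i, (h 0 (S' i) - h 0 (S i)) ^ 2 ≤ 4 * n * (1 / 4) ^ 0 →
      (∑ i, (h 0 (S' i) - h 0 (S i))) / n ≤ t)
    (hstep : ∀ j < n,
      ∑ i, ((h (j + 1) (S' i) - h j (S' i)) - (h (j + 1) (S i) - h j (S i))) ^ 2 ≤
        4 * n * (1 / 4) ^ j →
      (∑ i, ((h (j + 1) (S' i) - h j (S' i)) - (h (j + 1) (S i) - h j (S i)))) / n ≤ T j) :
    (∑ i, (g (S' i) - g (S i))) / n ≤ t + ∑ j ∈ Finset.range n, T j + 1 / Real.sqrt n := by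
  have hn0 : (0 : ℝ) < n := by exact_mod_cast hn
  have hquarter : ∀ j : ℕ, ((1 / 2 : ℝ) ^ j) ^ 2 = (1 / 4) ^ j := fun j => by
    rw [← pow_mul, mul_comm, pow_mul]; norm_num
  have h0 : (∑ i, (h 0 (S' i) - h 0 (S i))) / n ≤ t := by
    refine hstart ?_
    have : ∀ i ∈ (Finset.univ : Finset (Fin n)), (h 0 (S' i) - h 0 (S i)) ^ 2 ≤ 1 := by
      intro i _
      have h1 := hh 0 (S' i)
      have h2 := hh 0 (S i)
      rw [sq_le_one_iff_abs_le_one, abs_le]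
      constructor <;> linarith [h1.1, h1.2, h2.1, h2.2]
    have h3 := Finset.sum_le_card_nsmul _ _ _ this
    rw [Finset.card_univ, Fintype.card_fin, nsmul_eq_mul, mul_one] at h3
    linarith
  have hall : ∀ N ≤ n, (∑ i, (h N (S' i) - h N (S i))) / n ≤ t + ∑ j ∈ Finset.range N, T j := by
    intro N
    induction N with
    | zero => intro _; simpa using h0
    | succ N ih =>
      intro hN
      have h1 := ih (by omega)
      have h2 := hstep N (by omega) (by
        have e1 := happ N (by omega)
        have e2 := happ (N + 1) hN
        rw [hquarter] at e1 e2
        -- Comparison of both approximations with `g`: after summation the right side is at most `4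
        -- · (n / 2) (1 + 1 / 4) 4 ^ (-N) ≤ 4 n 4 ^ (-N)`.
        have e3 : ∀ i, ((h (N + 1) (S' i) - h N (S' i)) - (h (N + 1) (S i) - h N (S i))) ^ 2 ≤
            4 * ((h N (S i) - g (S i)) ^ 2 + (h N (S' i) - g (S' i)) ^ 2 +
              ((h (N + 1) (S i) - g (S i)) ^ 2 + (h (N + 1) (S' i) - g (S' i)) ^ 2)) := by
          intro i
          have aux : ∀ a b c e : ℝ, (a - b - (c - e)) ^ 2 ≤
              4 * (e ^ 2 + b ^ 2 + (c ^ 2 + a ^ 2)) := fun a b c e => by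
            nlinarith [sq_nonneg (a + b), sq_nonneg (a + c), sq_nonneg (a - e), sq_nonneg (b - c),
              sq_nonneg (b + e), sq_nonneg (c + e)]
          have := aux (h (N + 1) (S' i) - g (S' i)) (h N (S' i) - g (S' i))
            (h (N + 1) (S i) - g (S i)) (h N (S i) - g (S i))
          simpa using this
        refine (Finset.sum_le_sum fun i _ => e3 i).trans ?_
        rw [← Finset.mul_sum, Finset.sum_add_distrib, Finset.sum_add_distrib,
          Finset.sum_add_distrib]
        have e4 : (0 : ℝ) ≤ n * (1 / 4) ^ N := by positivity
        rw [pow_succ] at e2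
        linarith)
      rw [Finset.sum_range_succ]
      have h3 : (∑ i, (h (N + 1) (S' i) - h (N + 1) (S i))) / n =
          (∑ i, (h N (S' i) - h N (S i))) / n +
          (∑ i, ((h (N + 1) (S' i) - h N (S' i)) - (h (N + 1) (S i) - h N (S i)))) / n := by
        rw [← add_div, ← Finset.sum_add_distrib]
        congr 1
        exact Finset.sum_congr rfl fun i _ => by ring
      rw [h3]; linarith
  -- The chain stops at scale `n`. By Cauchy–Schwarz the remaining error is at most `2 ^ (-n) ≤ 1 /
  -- √n`.
  have hlast : (∑ i, (g (S' i) - g (S i))) / n ≤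
      (∑ i, (h n (S' i) - h n (S i))) / n + 1 / Real.sqrt n := by
    set D : Fin n → ℝ := fun i => (h n (S i) - g (S i)) - (h n (S' i) - g (S' i)) with hD
    have e0 : (∑ i, (g (S' i) - g (S i))) / n = (∑ i, (h n (S' i) - h n (S i))) / n
        + (∑ i, D i) / n := by
      rw [← add_div, ← Finset.sum_add_distrib]
      congr 1
      exact Finset.sum_congr rfl fun i _ => by simp only [hD]; ring
    have e1 := happ n le_rfl
    have e2 : ∑ i, D i ^ 2 ≤ n * ((1 / 2) ^ n) ^ 2 := by
      have : ∀ i, D i ^ 2 ≤ 2 * ((h n (S i) - g (S i)) ^ 2 + (h n (S' i) - g (S' i)) ^ 2) :=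
        fun i => by
          simp only [hD]
          nlinarith [sq_nonneg ((h n (S i) - g (S i)) + (h n (S' i) - g (S' i)))]
      refine (Finset.sum_le_sum fun i _ => this i).trans ?_
      rw [← Finset.mul_sum, Finset.sum_add_distrib]
      linarith
    have e3 := sq_sum_le_card_mul_sum_sq (s := (Finset.univ : Finset (Fin n))) (f := D)
    rw [Finset.card_univ, Fintype.card_fin] at e3
    have e4 : (∑ i, D i) ^ 2 ≤ (n * (1 / 2) ^ n) ^ 2 := by
      calc _ ≤ (n : ℝ) * ∑ i, D i ^ 2 := e3
        _ ≤ n * (n * ((1 / 2) ^ n) ^ 2) := by gcongr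
        _ = _ := by ring
    have e5 : ∑ i, D i ≤ n * (1 / 2) ^ n := le_of_sq_le_sq e4 (by positivity)
    have e6 : (∑ i, D i) / n ≤ (1 / 2) ^ n := by
      rw [div_le_iff₀ hn0]; linarith
    have e7 : (1 / 2 : ℝ) ^ n ≤ 1 / Real.sqrt n := by
      rw [one_div, inv_pow, one_div]
      refine inv_anti₀ (Real.sqrt_pos.2 hn0) ?_
      rw [Real.sqrt_le_left (by positivity)]
      have : (n : ℝ) ≤ 2 ^ n := by exact_mod_cast Nat.lt_two_pow_self.le
      have h1 : (1 : ℝ) ≤ 2 ^ n := one_le_pow₀ (by norm_num)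
      nlinarith
    linarith
  linarith [hall n le_rfl]

end Chaining

/-! ### Empirical difference for a fixed pair of samples. -/

section Core

variable {L : ℕ} {d : ℕ → ℕ} {σ : Activations L d} {Y : Type*}

theorem log_sum_lower_bounds {n : ℕ} (hn : 2 ≤ n) (hL : 1 ≤ L) (hd : ∀ k ≤ L, 1 ≤ d k) {δ : ℝ}
    (hδ : δ ∈ Ioo (0 : ℝ) 1) :
    L * Real.log n ≤ ∑ l : Fin L, Real.log (d l * n) + Real.log δ⁻¹ ∧ 0 ≤ Real.log δ⁻¹ ∧
      (0.69 : ℝ) ≤ L * Real.log n ∧ (0.69 : ℝ) * L ≤ L * Real.log n := by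
  have h1 := mul_log_le_sum_log hd (by omega : 1 ≤ n)
  have h2 : 0 ≤ Real.log δ⁻¹ := Real.log_nonneg ((one_le_inv₀ hδ.1).2 hδ.2.le)
  have h3 : Real.log 2 ≤ Real.log n := Real.log_le_log (by norm_num) (by exact_mod_cast hn)
  have h4 := Real.log_two_gt_d9
  have h5 : (1 : ℝ) ≤ L := by exact_mod_cast hL
  refine ⟨by linarith, h2, ?_, ?_⟩ <;> nlinarith

theorem one_div_sqrt_le_confBase {n : ℕ} (hn : 2 ≤ n) (hL : 1 ≤ L) (hd : ∀ k ≤ L, 1 ≤ d k)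
    {δ : ℝ} (hδ : δ ∈ Ioo (0 : ℝ) 1) : 1 / Real.sqrt n ≤ 2 * confBase L d n δ := by
  obtain ⟨h1, h2, h3, -⟩ := log_sum_lower_bounds hn hL hd hδ
  have hsn : 0 < Real.sqrt n := Real.sqrt_pos.2 (by positivity)
  rw [confBase, Real.sqrt_div (by linarith), ← mul_div_assoc]
  gcongr
  rw [show (2 : ℝ) = Real.sqrt 4 by
    rw [show (4 : ℝ) = 2 ^ 2 by norm_num, Real.sqrt_sq (by norm_num)], ← Real.sqrt_mul (by norm_num)]
  exact Real.one_le_sqrt.2 (by linarith)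

/-- For depth above `n` the confidence term alone makes the bound trivial, so `L ≤ n` may be assumed
elsewhere. -/
theorem one_le_confBase {n : ℕ} (hn : 2 ≤ n) (hL : 1 ≤ L) (hd : ∀ k ≤ L, 1 ≤ d k)
    {δ : ℝ} (hδ : δ ∈ Ioo (0 : ℝ) 1) (hnL : n < L) : 1 ≤ 2 * confBase L d n δ := by
  obtain ⟨h1, h2, h3, h4⟩ := log_sum_lower_bounds hn hL hd hδ
  have hn0 : (0 : ℝ) < n := by positivity
  have hnL' : (n : ℝ) ≤ L := by exact_mod_cast hnL.le
  rw [show (2 : ℝ) = Real.sqrt 4 by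
    rw [show (4 : ℝ) = 2 ^ 2 by norm_num, Real.sqrt_sq (by norm_num)], confBase,
    ← Real.sqrt_mul (by norm_num)]
  refine Real.one_le_sqrt.2 ?_
  rw [← mul_div_assoc, le_div_iff₀ hn0]
  linarith

theorem confBase_nonneg (L : ℕ) (d : ℕ → ℕ) (n : ℕ) (δ : ℝ) : 0 ≤ confBase L d n δ :=
  Real.sqrt_nonneg _

theorem smallScale_nonneg (L : ℕ) (d : ℕ → ℕ) (n : ℕ) {β : ℝ} (hβ : 0 < β) :
    0 ≤ smallScale L d n β := by
  unfold smallScale; positivity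

theorem Lam_pos (n : ℕ) (β : ℝ) : 0 < Lam n β := by
  have : 0 ≤ Real.log (max 2 ((n : ℝ) ^ 5 / β)) :=
    Real.log_nonneg (le_trans (by norm_num) (le_max_left _ _))
  unfold Lam
  linarith

theorem specCoef_nonneg (L : ℕ) (d : ℕ → ℕ) (n : ℕ) {β a : ℝ} (hβ : 0 < β) (ha : 0 ≤ a)
    (t : Fin L → ℝ) : 0 ≤ specCoef L d n β a t := by
  have := Lam_pos n β
  unfold specCoef; positivity

/-- Relative accuracy of layer `l` needed at the coarsest scale. -/
def relAcc (L n : ℕ) (β a : ℝ) (b : Fin L → ℝ) (l : Fin L) : ℝ :=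
  2 * β * a * Real.sqrt L * b l / Real.sqrt n

/-- Total entropy at the coarsest scale. -/
def totalEntropy (L : ℕ) (d : ℕ → ℕ) (n : ℕ) (β a : ℝ) (b : Fin L → ℝ) : ℝ :=
  ∑ l : Fin L, ((d (l + 1) : ℝ) + d l) * relAcc L n β a b l ^ 2

/-- Converts the total entropy into the leading term. It serves both the chaining sum and the case
where the entropy exceeds `n`. -/
theorem two_mul_specCoef {n : ℕ} {β a : ℝ} (hβ : 0 < β) (ha : 0 ≤ a) (b : Fin L → ℝ) :
    2 * specCoef L d n β a (fun l => b l ^ 2) =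
      Lam n β * (Real.sqrt (totalEntropy L d n β a b) / Real.sqrt n) := by
  have h1 : totalEntropy L d n β a b / n = (2 * β * a / n) ^ 2 *
      ∑ l : Fin L, (L : ℝ) * ((d (l + 1) : ℝ) + d l) * b l ^ 2 := by
    rw [totalEntropy, Finset.sum_div, Finset.mul_sum]
    refine Finset.sum_congr rfl fun l _ => ?_
    rw [relAcc, div_pow, mul_pow, mul_pow, Real.sq_sqrt (Nat.cast_nonneg L),
      Real.sq_sqrt (Nat.cast_nonneg n), div_pow]
    ring
  rw [← Real.sqrt_div' _ (Nat.cast_nonneg n), h1, Real.sqrt_mul (sq_nonneg _),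
    Real.sqrt_sq (by positivity), specCoef]
  ring

/-- `relAcc` is made so that `b l = κ · relAcc · 2 ^ j` with `κ` independent of `l`. What remains is
the sum of the layer radii, at most `√L · a` by Cauchy–Schwarz; `L ≤ n` lets `√L ≤ 2 ^ n` absorb the
floors `R / 4 ^ n`. -/
theorem sum_mul_spec_le {n : ℕ} (hLn : L ≤ n) (hL : 1 ≤ L) (hn : 1 ≤ n) {β R : ℝ} (hβ : 0 < β)
    (hR : 0 < R) (W V : Weights L d) (b : Fin L → ℝ) (j : ℕ)
    (h : ∀ l, relAcc L n β (2 * wnorm W + R / 2 ^ n) b l * 2 ^ j * spec (V l - W l) ≤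
      2 * frob (W l) + R / 4 ^ n) :
    ∑ l, b l * spec (V l - W l) ≤ Real.sqrt n * (1 / 2) ^ j / (2 * β) := by
  have hw : 0 ≤ wnorm W := Real.sqrt_nonneg _
  set a := 2 * wnorm W + R / 2 ^ n with ha
  have ha0 : 0 < a := by positivity
  have hsn : 0 < Real.sqrt n := Real.sqrt_pos.2 (by exact_mod_cast hn)
  have hsL : 0 < Real.sqrt L := Real.sqrt_pos.2 (by exact_mod_cast hL)
  have hLL : Real.sqrt L * Real.sqrt L = L := Real.mul_self_sqrt (Nat.cast_nonneg L)
  set κ : ℝ := Real.sqrt n * (1 / 2) ^ j / (2 * β * a * Real.sqrt L) with hκ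
  have hκ0 : 0 < κ := by positivity
  have h1 : ∀ l, b l * spec (V l - W l) ≤ κ * (2 * frob (W l) + R / 4 ^ n) := by
    intro l
    have h2 := mul_le_mul_of_nonneg_left (h l) hκ0.le
    refine le_trans (le_of_eq ?_) h2
    rw [hκ, relAcc, one_div, inv_pow]
    field_simp
  have h3 : ∑ l, (2 * frob (W l) + R / 4 ^ n) ≤ Real.sqrt L * a := by
    rw [Finset.sum_add_distrib, ← Finset.mul_sum, Finset.sum_const, Finset.card_univ,
      Fintype.card_fin, nsmul_eq_mul]
    have h4 := sum_frob_le W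
    have h5 : Real.sqrt L ≤ 2 ^ n := by
      rw [Real.sqrt_le_left (by positivity)]
      have e1 : (L : ℝ) ≤ n := by exact_mod_cast hLn
      have e2 : (n : ℝ) ≤ 2 ^ n := by exact_mod_cast Nat.lt_two_pow_self.le
      have e3 : (1 : ℝ) ≤ 2 ^ n := one_le_pow₀ (by norm_num)
      nlinarith
    have h6 : (L : ℝ) * (R / 4 ^ n) ≤ Real.sqrt L * (R / 2 ^ n) := by
      have e4 : (4 : ℝ) ^ n = 2 ^ n * 2 ^ n := by rw [← mul_pow]; norm_num
      rw [e4]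
      calc (L : ℝ) * (R / (2 ^ n * 2 ^ n)) = Real.sqrt L * (Real.sqrt L * (R / (2 ^ n * 2 ^ n))) := by
            rw [← mul_assoc, hLL]
        _ ≤ _ := mul_le_mul_of_nonneg_left ?_ hsL.le
      rw [← mul_div_assoc, div_le_div_iff₀ (by positivity) (by positivity)]
      have : Real.sqrt L * R * 2 ^ n ≤ 2 ^ n * R * 2 ^ n := by gcongr
      linarith
    rw [ha]
    linarith
  calc ∑ l, b l * spec (V l - W l) ≤ ∑ l, κ * (2 * frob (W l) + R / 4 ^ n) :=
        Finset.sum_le_sum fun l _ => h1 l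
    _ = κ * ∑ l, (2 * frob (W l) + R / 4 ^ n) := (Finset.mul_sum ..).symm
    _ ≤ κ * (Real.sqrt L * a) := by gcongr
    _ = _ := by rw [hκ]; field_simp

theorem final_arith {n : ℕ} (hn : 2 ≤ n) (hL : 1 ≤ L) (hd : ∀ k ≤ L, 1 ≤ d k) {β δ : ℝ}
    (hβ : 0 < β) (hδ : δ ∈ Ioo (0 : ℝ) 1) {j₀ : ℕ} (hj1 : (j₀ : ℝ) + 3 ≤ 5 * Lam n β)
    (hj2 : (1 / 2 : ℝ) ^ j₀ ≤ β / n ^ 5) {a E : ℝ} (ha : 0 ≤ a) (b : Fin L → ℝ) :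
    (9 * Real.sqrt (4 * L * Real.log (2 * n + 1 : ℕ) + 4 + Real.log δ⁻¹) + 9 * E + 15 +
        900 * Real.sqrt (totalEntropy L d n β a b) * (j₀ + 3) +
        1200 * Real.sqrt (∑ l : Fin L, ((d (l + 1) : ℝ) + d l) * d l) * (1 / 2) ^ j₀) / Real.sqrt n
      + 1 / Real.sqrt n ≤
    9000 * (specCoef L d n β a (fun l => b l ^ 2) + confBase L d n δ + smallScale L d n β)
      + 9 / Real.sqrt n * E := by
  obtain ⟨h1, h2, h3, h4⟩ := log_sum_lower_bounds hn hL hd hδ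
  have hsn : 0 < Real.sqrt n := Real.sqrt_pos.2 (by positivity)
  have hconf := one_div_sqrt_le_confBase hn hL hd hδ
  have hc0 := confBase_nonneg L d n δ
  set U := totalEntropy L d n β a b with hU
  set Q := ∑ l : Fin L, ((d (l + 1) : ℝ) + d l) * d l with hQ
  have hA : Real.sqrt (4 * L * Real.log (2 * n + 1 : ℕ) + 4 + Real.log δ⁻¹) / Real.sqrt n ≤
      5 * confBase L d n δ := by
    rw [confBase, ← Real.sqrt_div' _ (Nat.cast_nonneg n),
      show (5 : ℝ) = Real.sqrt 25 by
        rw [show (25 : ℝ) = 5 ^ 2 by norm_num, Real.sqrt_sq (by norm_num)],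
      ← Real.sqrt_mul (by norm_num), ← mul_div_assoc]
    refine Real.sqrt_le_sqrt ?_
    gcongr
    have h5 := mul_le_mul_of_nonneg_left (log_two_mul_add_one_le hn)
      (by positivity : (0 : ℝ) ≤ 4 * L)
    have h0 := mul_log_le_sum_log hd (by omega : 1 ≤ n)
    have h6 : 4 * (L : ℝ) * (3 * Real.log n) = 12 * (L * Real.log n) := by ring
    linarith
  have hUb : 900 * Real.sqrt U * (j₀ + 3) / Real.sqrt n ≤
      9000 * specCoef L d n β a (fun l => b l ^ 2) := by
    have e := two_mul_specCoef (d := d) (n := n) hβ ha b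
    calc 900 * Real.sqrt U * (j₀ + 3) / Real.sqrt n
        ≤ 900 * Real.sqrt U * (5 * Lam n β) / Real.sqrt n := by gcongr
      _ = 4500 * (Lam n β * (Real.sqrt U / Real.sqrt n)) := by ring
      _ = _ := by rw [← e]; ring
  have hQb : Real.sqrt Q * (1 / 2) ^ j₀ / Real.sqrt n ≤ smallScale L d n β := by
    have e : (n : ℝ) ^ (11 / 2 : ℝ) = n ^ 5 * Real.sqrt n := by
      rw [Real.sqrt_eq_rpow, ← Real.rpow_natCast, ← Real.rpow_add (by positivity)]
      norm_num
    rw [smallScale, e, ← hQ]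
    clear_value Q
    calc Real.sqrt Q * (1 / 2) ^ j₀ / Real.sqrt n ≤ Real.sqrt Q * (β / n ^ 5) / Real.sqrt n := by
          gcongr
      _ = _ := by field_simp
  have hs0 := smallScale_nonneg L d n hβ
  have hsplit : (9 * Real.sqrt (4 * L * Real.log (2 * n + 1 : ℕ) + 4 + Real.log δ⁻¹) + 9 * E + 15 +
        900 * Real.sqrt U * (j₀ + 3) + 1200 * Real.sqrt Q * (1 / 2) ^ j₀) / Real.sqrt n
      + 1 / Real.sqrt n =
      9 * (Real.sqrt (4 * L * Real.log (2 * n + 1 : ℕ) + 4 + Real.log δ⁻¹) / Real.sqrt n)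
      + 9 / Real.sqrt n * E + 16 * (1 / Real.sqrt n) + 900 * Real.sqrt U * (j₀ + 3) / Real.sqrt n
      + 1200 * (Real.sqrt Q * (1 / 2) ^ j₀ / Real.sqrt n) := by ring
  rw [hsplit]
  linarith

/-- Penalty of the elements of a net family, with one additional element. -/
def netPen {ι : Type*} (L n : ℕ) (H : ι → ℝ) : Option ι → ℝ
  | none => Real.log 2
  | some v => 2 * L * Real.log (2 * n + 1 : ℕ) + H v + Real.log 2

/-- Losses of the elements of a net family; the additional element is the zero function. -/
def netLoss {ι : Type*} (σ : Activations L d) (loss : Vec (d L) → Y → ℝ) (V : ι → Weights L d) :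
    Option ι → Vec (d 0) × Y → ℝ
  | none, _ => 0
  | some v, z => loss (net σ (V v) z.1) z.2

/-- Bound for the empirical difference of a network on a pair of samples. -/
theorem empirical_difference_le {n : ℕ} (hn : 2 ≤ n) (hL : 1 ≤ L) (hLn : L ≤ n)
    (hd : ∀ k ≤ L, 1 ≤ d k) {β δ R : ℝ} (hβ : 0 < β) (hδ : δ ∈ Ioo (0 : ℝ) 1) (hR : 0 < R)
    {loss : Vec (d L) → Y → ℝ} (hl01 : ∀ u y, loss u y ∈ Icc (0 : ℝ) 1)
    (hlip : ∀ y u v, |loss u y - loss v y| ≤ β * ‖u - v‖)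
    {φ : (l : Fin L) → Matrix (Fin (d (l + 1))) (Fin (d l)) ℝ → ℝ} {ι : Type*}
    {V : ι → Weights L d} {H : ι → ℝ}
    (hsel : ∀ W : Weights L d, wnorm W ≤ R → ∀ u : Fin L → ℝ, (∀ l, 0 ≤ u l) →
      (∀ l, u l ≤ 2 ^ n) → ∀ j ≤ n, ∃ v, (∀ l, φ l (V v l) ≤ φ l (W l)) ∧
          (∀ l, u l * 2 ^ j * spec (V v l - W l) ≤ 2 * frob (W l) + R / 4 ^ n) ∧
          ∀ m : ℕ, H v ≤ 4100 * (4 * (∑ l : Fin L, ((d (l + 1) : ℝ) + d l) * u l ^ 2) * 4 ^ j / 4 ^ m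
            + (∑ l : Fin L, ((d (l + 1) : ℝ) + d l) * d l) * m))
    {S S' : Fin n → Vec (d 0) × Y} {E : ℝ} (hE : 0 ≤ E)
    (hch : ∀ j < n, ∀ v v',
      ∑ i, ((netLoss σ loss V v (S' i) - netLoss σ loss V v' (S' i)) -
        (netLoss σ loss V v (S i) - netLoss σ loss V v' (S i))) ^ 2 ≤ 4 * n * (1 / 4) ^ j →
      (∑ i, ((netLoss σ loss V v (S' i) - netLoss σ loss V v' (S' i)) -
        (netLoss σ loss V v (S i) - netLoss σ loss V v' (S i)))) / n ≤
        3 * (1 / 2) ^ j * (Real.sqrt ((netPen L n H v + netPen L n H v' + (j + 1)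
          + (1 + Real.log δ⁻¹)) / n) + E / Real.sqrt n))
    {W : Weights L d} (hW : wnorm W ≤ R) {b : Fin L → ℝ} (hb : ∀ l, 0 ≤ b l)
    (hpert : PerturbBound σ φ β (inputs S) (inputs S') W b) :
    (∑ i, (loss (net σ W (S' i).1) (S' i).2 - loss (net σ W (S i).1) (S i).2)) / n ≤
      9000 * (specCoef L d n β (2 * wnorm W + R / 2 ^ n) (fun l => b l ^ 2) + confBase L d n δ
        + smallScale L d n β) + 9 / Real.sqrt n * E := by
  have hn1 : (1 : ℝ) ≤ n := by exact_mod_cast (by omega : 1 ≤ n)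
  have hsn : 0 < Real.sqrt n := Real.sqrt_pos.2 (by linarith)
  have hw : 0 ≤ wnorm W := Real.sqrt_nonneg _
  set a := 2 * wnorm W + R / 2 ^ n with ha
  have ha0 : 0 < a := by positivity
  have hc0 := confBase_nonneg L d n δ
  have hs0 := smallScale_nonneg L d n hβ
  obtain ⟨j₀, hj1, hj2, hLam⟩ := exists_switch_scale (n := n) (by omega) hβ
  have hu0 : ∀ l, 0 ≤ relAcc L n β a b l := fun l => by
    have := hb l
    unfold relAcc; positivity
  have hU0 : 0 ≤ totalEntropy L d n β a b :=
    Finset.sum_nonneg fun l _ => mul_nonneg (by positivity) (sq_nonneg _)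
  -- An entropy above `n` makes the leading term of order one, and a difference of losses in `[0,
  -- 1]` is at most one. Otherwise every `relAcc` is at most `2 ^ n`, as the net family requires.
  by_cases hUn : (n : ℝ) < totalEntropy L d n β a b
  · have h1 : (∑ i, (loss (net σ W (S' i).1) (S' i).2 - loss (net σ W (S i).1) (S i).2)) / n
        ≤ 1 := by
      rw [div_le_one (by linarith)]
      have : ∀ i ∈ (Finset.univ : Finset (Fin n)),
          loss (net σ W (S' i).1) (S' i).2 - loss (net σ W (S i).1) (S i).2 ≤ 1 := fun i _ => by
        linarith [(hl01 (net σ W (S' i).1) (S' i).2).2, (hl01 (net σ W (S i).1) (S i).2).1]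
      have h3 := Finset.sum_le_card_nsmul _ _ _ this
      rwa [Finset.card_univ, Fintype.card_fin, nsmul_eq_mul, mul_one] at h3
    have h2 := two_mul_specCoef (d := d) (n := n) hβ ha0.le b
    have h3 : 1 ≤ Real.sqrt (totalEntropy L d n β a b) / Real.sqrt n := by
      rw [one_le_div hsn]
      exact Real.sqrt_le_sqrt hUn.le
    have h4 : 1 * 1 ≤ Lam n β * (Real.sqrt (totalEntropy L d n β a b) / Real.sqrt n) := by
      gcongr
    have h5 : 0 ≤ 9 / Real.sqrt n * E := by positivity
    linarith
  push Not at hUn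
  have hu : ∀ l, relAcc L n β a b l ≤ 2 ^ n := by
    intro l
    have h1 : relAcc L n β a b l ^ 2 ≤ n := by
      refine le_trans ?_ hUn
      have h2 : (1 : ℝ) ≤ (d (l + 1) : ℝ) + d l := by
        have : (1 : ℝ) ≤ d l := by exact_mod_cast hd l l.isLt.le
        have : (0 : ℝ) ≤ d (l + 1) := Nat.cast_nonneg _
        linarith
      refine le_trans (le_mul_of_one_le_left (sq_nonneg _) h2) ?_
      exact Finset.single_le_sum (f := fun l : Fin L => ((d (l + 1) : ℝ) + d l) *
        relAcc L n β a b l ^ 2) (fun l _ => mul_nonneg (by positivity) (sq_nonneg _))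
        (Finset.mem_univ l)
    have e2 : (n : ℝ) ≤ 2 ^ n := by exact_mod_cast Nat.lt_two_pow_self.le
    have e3 : (1 : ℝ) ≤ 2 ^ n := one_le_pow₀ (by norm_num)
    exact le_of_sq_le_sq (by nlinarith) (by positivity)
  have hv := fun j : ℕ => fun hj : j ≤ n => hsel W hW (relAcc L n β a b) hu0 hu j hj
  have hv' : ∀ j : ℕ, ∃ v, j ≤ n → (∀ l, φ l (V v l) ≤ φ l (W l)) ∧
      (∀ l, relAcc L n β a b l * 2 ^ j * spec (V v l - W l) ≤ 2 * frob (W l) + R / 4 ^ n) ∧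
      ∀ m : ℕ, H v ≤ 4100 * (4 * (totalEntropy L d n β a b) * 4 ^ j / 4 ^ m
            + (∑ l : Fin L, ((d (l + 1) : ℝ) + d l) * d l) * m) := by
    intro j
    by_cases hj : j ≤ n
    · obtain ⟨v, h⟩ := hv j hj
      exact ⟨v, fun _ => h⟩
    · obtain ⟨v, -⟩ := hv 0 (Nat.zero_le n)
      exact ⟨v, fun h => absurd h hj⟩
  choose v hvs using hv'
  have happ : ∀ j ≤ n,
      ∑ i, (netLoss σ loss V (some (v j)) (S i) - loss (net σ W (S i).1) (S i).2) ^ 2 +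
      ∑ i, (netLoss σ loss V (some (v j)) (S' i) - loss (net σ W (S' i).1) (S' i).2) ^ 2 ≤
      n * ((1 / 2) ^ j) ^ 2 / 2 := by
    intro j hj
    obtain ⟨h1, h2, -⟩ := hvs j hj
    have h3 := sum_mul_spec_le hLn hL (by omega) hβ hR W (V (v j)) b j h2
    have h4 : (1 / 2 : ℝ) ^ j ≤ 1 := pow_le_one₀ (by norm_num) (by norm_num)
    have h5 : Real.sqrt n * (1 / 2) ^ j / (2 * β) ≤ Real.sqrt n / (2 * β) := by
      gcongr
      exact mul_le_of_le_one_right hsn.le h4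
    have h6 := hpert (V (v j)) h1 (h3.trans h5)
    refine sq_sum_sub_le hβ hlip (h6.trans ?_)
    have h7 : 0 ≤ ∑ l, b l * spec (V (v j) l - W l) :=
      Finset.sum_nonneg fun l _ => mul_nonneg (hb l) (spec_nonneg _)
    gcongr
  -- Both fixed penalties `2 L log (2 n + 1) + log 2` of a link, with `1 + log δ⁻¹`; the constant 4
  -- leaves room for the rest.
  set A : ℝ := 4 * L * Real.log (2 * n + 1 : ℕ) + 4 + Real.log δ⁻¹ with hA
  have hlog2 : Real.log 2 ≤ 0.7 := by have := Real.log_two_lt_d9; linarith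
  have hlog0 : 0 ≤ Real.log (2 * n + 1 : ℕ) := Real.log_natCast_nonneg _
  have hlogδ : 0 ≤ Real.log δ⁻¹ := Real.log_nonneg ((one_le_inv₀ hδ.1).2 hδ.2.le)
  have hLlog : 0 ≤ L * Real.log (2 * n + 1 : ℕ) := by positivity
  have hA0 : 0 ≤ A := by rw [hA]; positivity
  have htel := chain_telescope (by omega : 1 ≤ n)
    (g := fun z : Vec (d 0) × Y => loss (net σ W z.1) z.2)
    (h := fun j => netLoss σ loss V (some (v j)))
    (fun j z => hl01 _ _) (S := S) (S' := S') happ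
    (t := 3 * (Real.sqrt ((A + H (v 0) + 1) / n) + E / Real.sqrt n))
    (T := fun j => 3 * (1 / 2) ^ j *
        (Real.sqrt ((A + (H (v (j + 1)) + H (v j)) + (j + 1)) / n) + E / Real.sqrt n))
    (by
      intro h
      -- The start of the chain is treated as a link to the zero function, the reason for the
      -- additional element of the family.
      have h1 := hch 0 (by omega) (some (v 0)) none
      simp only [netLoss, sub_zero] at h1 h
      refine (h1 h).trans ?_
      rw [pow_zero, mul_one]
      refine mul_le_mul_of_nonneg_left (add_le_add (Real.sqrt_le_sqrt
        (div_le_div_of_nonneg_right ?_ (Nat.cast_nonneg n))) le_rfl) (by positivity)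
      simp only [netPen]
      push_cast at hA hLlog ⊢
      linarith)
    (by
      intro j hj h
      refine (hch j hj (some (v (j + 1))) (some (v j)) h).trans ?_
      refine mul_le_mul_of_nonneg_left (add_le_add (Real.sqrt_le_sqrt
        (div_le_div_of_nonneg_right ?_ (Nat.cast_nonneg n))) le_rfl) (by positivity)
      simp only [netPen]
      push_cast at hA hLlog ⊢
      linarith)
  refine htel.trans ?_
  have hQ0 : 0 ≤ ∑ l : Fin L, ((d (l + 1) : ℝ) + d l) * d l :=
    Finset.sum_nonneg fun l _ => by positivity
  have hsum := chain_sum_le (n := n) j₀ hU0 hQ0 hA0 hE (fun j => H (v j))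
    (fun j hj m => (hvs j hj).2.2 m)
  refine le_trans ?_ (final_arith hn hL hd hβ hδ hj1 hj2 ha0.le b (E := E))
  rw [← hA]
  linarith

end Core

/-! ### Generalization bound from perturbation coefficients. -/

section Generalization

variable {L : ℕ} {d : ℕ → ℕ} {σ : Activations L d} {Y : Type*} [MeasurableSpace Y]

theorem measurable_loss_net (hσ : ∀ l, LipschitzWith 1 (σ l)) {loss : Vec (d L) → Y → ℝ}
    (hlm : Measurable (Function.uncurry loss)) (W : Weights L d) :
    Measurable fun z : Vec (d 0) × Y => loss (net σ W z.1) z.2 :=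
  hlm.comp ((((continuous_feat (fun l => (hσ l).continuous) L le_rfl).comp
    (Continuous.prodMk_right W)).measurable.comp measurable_fst).prodMk measurable_snd)

theorem netPen_nonneg {ι : Type*} {n : ℕ} {H : ι → ℝ} (hH : ∀ v, 0 ≤ H v) (v : Option ι) :
    0 ≤ netPen L n H v := by
  have h2 : 0 ≤ Real.log 2 := Real.log_nonneg (by norm_num)
  have h3 : 0 ≤ Real.log (2 * n + 1 : ℕ) := Real.log_natCast_nonneg _
  cases v with
  | none => exact h2
  | some v =>
    have := hH v
    simp only [netPen]
    positivity

theorem sum_exp_neg_netPen_le {ι : Type*} [Fintype ι] {n : ℕ} {H : ι → ℝ}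
    (h : ∑ v, Real.exp (-(2 * L * Real.log (2 * n + 1 : ℕ) + H v)) ≤ 1) :
    ∑ v, Real.exp (-netPen L n H v) ≤ 1 := by
  have e : Real.exp (-Real.log 2) = 1 / 2 := by
    rw [Real.exp_neg, Real.exp_log (by norm_num), one_div]
  rw [Fintype.sum_option]
  have h1 : ∀ v, Real.exp (-netPen L n H (some v)) =
      1 / 2 * Real.exp (-(2 * L * Real.log (2 * n + 1 : ℕ) + H v)) := fun v => by
    rw [netPen, neg_add, Real.exp_add, e, mul_comm]
  simp_rw [h1, ← Finset.mul_sum]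
  rw [netPen, e]
  linarith

theorem gap_le_one (P : Measure (Vec (d 0) × Y)) [IsProbabilityMeasure P] {n : ℕ}
    {loss : Vec (d L) → Y → ℝ} (hl01 : ∀ u y, loss u y ∈ Icc (0 : ℝ) 1)
    (f : Vec (d 0) → Vec (d L)) (S : Fin n → Vec (d 0) × Y) : gap P loss f S ≤ 1 := by
  have h1 : ∫ z, loss (f z.1) z.2 ∂P ≤ 1 := by
    by_cases hi : Integrable (fun z : Vec (d 0) × Y => loss (f z.1) z.2) P
    · simpa using integral_mono hi (integrable_const (1 : ℝ)) fun z => (hl01 _ _).2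
    · rw [integral_undef hi]; exact zero_le_one
  have h2 : 0 ≤ (∑ i, loss (f (S i).1) (S i).2) / n :=
    div_nonneg (Finset.sum_nonneg fun i _ => (hl01 _ _).1) (Nat.cast_nonneg n)
  unfold gap
  linarith

/-- Uniform generalization bound in terms of the perturbation coefficients of the network on the
pair of samples. -/
theorem exists_generalization_event (P : Measure (Vec (d 0) × Y)) [IsProbabilityMeasure P] {n : ℕ}
    (hn : 2 ≤ n) (hL : 1 ≤ L) (hd : ∀ k ≤ L, 1 ≤ d k) (hσ : ∀ l, LipschitzWith 1 (σ l))
    {β δ R : ℝ} (hβ : 0 < β) (hδ : δ ∈ Ioo (0 : ℝ) 1) (hR : 0 < R)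
    {loss : Vec (d L) → Y → ℝ} (hlm : Measurable (Function.uncurry loss))
    (hl01 : ∀ u y, loss u y ∈ Icc (0 : ℝ) 1)
    (hlip : ∀ y u v, |loss u y - loss v y| ≤ β * ‖u - v‖)
    (φ : (l : Fin L) → Matrix (Fin (d (l + 1))) (Fin (d l)) ℝ → ℝ) (hφ : ∀ l, Continuous (φ l))
    (hφ0 : ∀ l V, φ l 0 ≤ φ l V) :
    ∃ G : Set (Fin n → Vec (d 0) × Y),
      Measure.pi (fun _ : Fin n => P) Gᶜ ≤ ENNReal.ofReal δ ∧
      ∀ S ∈ G, ∀ W : Weights L d, wnorm W ≤ R → ∀ b : (Fin n → Vec (d 0) × Y) → Fin L → ℝ,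
        (∀ S' l, 0 ≤ b S' l) →
        (∀ᵐ S' ∂Measure.pi (fun _ : Fin n => P),
          PerturbBound σ φ β (inputs S) (inputs S') W (b S')) →
        ENNReal.ofReal (gap P loss (net σ W) S) ≤ ENNReal.ofReal 10000 *
          ((∫⁻ S', ENNReal.ofReal (specCoef L d n β (2 * wnorm W + R / 2 ^ n)
              (fun l => b S' l ^ 2)) ∂Measure.pi (fun _ : Fin n => P))
            + ENNReal.ofReal (confBase L d n δ) + ENNReal.ofReal (smallScale L d n β)) := by
  have hc0 := confBase_nonneg L d n δ
  have hs0 := smallScale_nonneg L d n hβ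
  by_cases hLn : n < L
  · refine ⟨univ, by simp, fun S _ W _ b _ _ => ?_⟩
    have h1 := one_le_confBase hn hL hd hδ hLn
    calc ENNReal.ofReal (gap P loss (net σ W) S)
        ≤ ENNReal.ofReal (10000 * confBase L d n δ) :=
          ENNReal.ofReal_le_ofReal ((gap_le_one P hl01 _ S).trans (by linarith))
      _ = ENNReal.ofReal 10000 * ENNReal.ofReal (confBase L d n δ) :=
          ENNReal.ofReal_mul (by norm_num)
      _ ≤ _ := by
          gcongr
          exact le_add_right le_add_self
  push Not at hLn
  obtain ⟨ι, hι, V, H, hH, hsum, hsel⟩ := exists_net_family n hd φ hφ hφ0 hR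
  obtain ⟨G, ξ, hG, hξm, hξ0, hξ1, hch⟩ := exists_chaining_event P (by omega : 1 ≤ n) n
    (netLoss σ loss V)
    (fun v => by
      cases v with
      | none => exact measurable_const
      | some v => exact measurable_loss_net hσ hlm (V v))
    (netPen L n H) (netPen_nonneg hH) (sum_exp_neg_netPen_le hsum) hδ
  refine ⟨G, hG, fun S hS W hW b hb hpert => ?_⟩
  have hw : 0 ≤ wnorm W := Real.sqrt_nonneg _
  have ha0 : 0 ≤ 2 * wnorm W + R / 2 ^ n := by positivity
  have hδ0 := hδ.1.le
  have hsn := one_div_sqrt_le_confBase hn hL hd hδ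
  refine (ofReal_integral_sub_le_lintegral P (by omega : 1 ≤ n) (measurable_loss_net hσ hlm W)
    (fun z => hl01 _ _) S).trans ?_
  set F : (Fin n → Vec (d 0) × Y) → ℝ≥0∞ := fun S' => ENNReal.ofReal (specCoef L d n β
    (2 * wnorm W + R / 2 ^ n) (fun l => b S' l ^ 2)) with hF
  set K : ℝ≥0∞ := ENNReal.ofReal (confBase L d n δ) + ENNReal.ofReal (smallScale L d n β) with hK
  have hpt : ∀ᵐ S' ∂Measure.pi (fun _ : Fin n => P),
      ENNReal.ofReal ((∑ i, (loss (net σ W (S' i).1) (S' i).2 - loss (net σ W (S i).1) (S i).2)) / n)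
        ≤ ENNReal.ofReal 9000 * F S' + (ENNReal.ofReal 9000 * K + ENNReal.ofReal (9 / Real.sqrt n) *
          ENNReal.ofReal (δ * ξ S S')) := by
    filter_upwards [hpert] with S' hS'
    have hE : 0 ≤ δ * ξ S S' := mul_nonneg hδ0 (hξ0 _ _)
    have h1 := empirical_difference_le hn hL hLn hd hβ hδ hR hl01 hlip hsel hE
      (fun j hj v v' => hch S S' j hj v v') hW (hb S') hS'
    refine (ENNReal.ofReal_le_ofReal h1).trans ?_
    have h2 := specCoef_nonneg L d n hβ ha0 (fun l => b S' l ^ 2)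
    rw [ENNReal.ofReal_add (by positivity) (by positivity), ENNReal.ofReal_mul (by norm_num),
      ENNReal.ofReal_add (by positivity) hs0, ENNReal.ofReal_add h2 hc0,
      ENNReal.ofReal_mul (p := 9 / Real.sqrt n) (by positivity), add_assoc (ENNReal.ofReal _),
      mul_add, add_assoc]
  refine (lintegral_mono_ae hpt).trans ?_
  have hmE : Measurable fun S' => ENNReal.ofReal (δ * ξ S S') :=
    ((hξm S).const_mul δ).ennreal_ofReal
  -- The integrals are split with the measurable summand on the right, since no measurability of
  -- `b`, hence of `F`, is available.
  rw [lintegral_add_right _ ((hmE.const_mul _).const_add _), lintegral_add_right _ (hmE.const_mul _),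
    lintegral_const, measure_univ, mul_one, lintegral_const_mul _ hmE,
    lintegral_const_mul' _ _ ENNReal.ofReal_ne_top]
  have h9 : ENNReal.ofReal (9 / Real.sqrt n) * ∫⁻ S', ENNReal.ofReal (δ * ξ S S')
      ∂Measure.pi (fun _ : Fin n => P) ≤ ENNReal.ofReal 1000 * K := by
    calc _ ≤ ENNReal.ofReal (9 / Real.sqrt n) * 1 := by gcongr; exact hξ1 S hS
      _ ≤ ENNReal.ofReal (1000 * confBase L d n δ) := by
          rw [mul_one]
          refine ENNReal.ofReal_le_ofReal ?_
          have : 9 / Real.sqrt n = 9 * (1 / Real.sqrt n) := by ring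
          linarith
      _ = ENNReal.ofReal 1000 * ENNReal.ofReal (confBase L d n δ) :=
          ENNReal.ofReal_mul (by norm_num)
      _ ≤ _ := by gcongr; exact le_self_add
  have h10 : ENNReal.ofReal 10000 = ENNReal.ofReal 9000 + ENNReal.ofReal 1000 := by
    rw [← ENNReal.ofReal_add (by norm_num) (by norm_num)]; norm_num
  rw [add_assoc (∫⁻ S', F S' ∂_), mul_add (ENNReal.ofReal 10000)]
  calc _ ≤ ENNReal.ofReal 9000 * ∫⁻ S', F S' ∂Measure.pi (fun _ : Fin n => P) +
        (ENNReal.ofReal 9000 * K + ENNReal.ofReal 1000 * K) :=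
        add_le_add le_rfl (add_le_add le_rfl h9)
    _ ≤ _ := by
        rw [← add_mul, ← h10]
        refine add_le_add (mul_le_mul_left (ENNReal.ofReal_le_ofReal (by norm_num)) _) le_rfl

end Generalization

/-! ### Rank-free and spectrally normalized bounds. -/

section Bounds

variable {L : ℕ} {d : ℕ → ℕ} {σ : Activations L d} {Y : Type*} [MeasurableSpace Y]

theorem confBase_le_conf {n : ℕ} (hn : 2 ≤ n) {δ : ℝ} (hδ : δ ∈ Ioo (0 : ℝ) 1) :
    confBase L d n δ ≤ conf L d n δ := by
  have h1 : (4 : ℝ) ≤ 2 * n := by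
    have : (2 : ℝ) ≤ n := by exact_mod_cast hn
    linarith
  have h2 : Real.log 4 ≤ Real.log (2 * n) := Real.log_le_log (by norm_num) h1
  have h3 : Real.log 4 = 2 * Real.log 2 := by
    rw [show (4 : ℝ) = 2 ^ 2 by norm_num, Real.log_pow]; norm_num
  have h4 := Real.log_two_gt_d9
  have hδ0 := hδ.1
  unfold confBase conf
  refine Real.sqrt_le_sqrt (div_le_div_of_nonneg_right (add_le_add le_rfl
    (Real.log_le_log (inv_pos.2 hδ0) ?_)) (Nat.cast_nonneg n))
  rw [← one_div]
  gcongr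
  linarith

theorem confBase_le_confSpec {n : ℕ} (hn : 2 ≤ n) (hL : 1 ≤ L) (R : ℝ) {δ : ℝ}
    (hδ : δ ∈ Ioo (0 : ℝ) 1) : confBase L d n δ ≤ confSpec L d n R δ := by
  have hδ0 := hδ.1
  have h1 : (2 : ℝ) ≤ n := by exact_mod_cast hn
  have h2 : Real.log 2 ≤ Real.log (max R 2) := Real.log_le_log (by norm_num) (le_max_right _ _)
  have h3 := Real.log_two_gt_d9
  have h4 : (1 : ℝ) ≤ n * Real.log (max R 2) := by nlinarith
  have h5 : Real.log δ⁻¹ ≤ Real.log (n * Real.log (max R 2) / δ) := by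
    refine Real.log_le_log (inv_pos.2 hδ0) ?_
    rw [← one_div]
    gcongr
  have h6 : 0 ≤ Real.log δ⁻¹ := Real.log_nonneg ((one_le_inv₀ hδ0).2 hδ.2.le)
  have h7 : (1 : ℝ) ≤ L := by exact_mod_cast hL
  unfold confBase confSpec
  refine Real.sqrt_le_sqrt (div_le_div_of_nonneg_right (add_le_add le_rfl ?_) (Nat.cast_nonneg n))
  exact h5.trans (le_mul_of_one_le_left (h6.trans h5) h7)

theorem specCoef_mono {n : ℕ} {β : ℝ} (hβ : 0 < β) {a a' : ℝ} (ha : 0 ≤ a) (h : a ≤ a')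
    {t t' : Fin L → ℝ} (ht : ∀ l, t l ≤ t' l) : specCoef L d n β a t ≤ specCoef L d n β a' t' := by
  have := Lam_pos n β
  unfold specCoef
  have ha' := ha.trans h
  gcongr with l
  exact ht l

theorem specCoef_mul_left (n : ℕ) (β c a : ℝ) (t : Fin L → ℝ) :
    specCoef L d n β (c * a) t = c * specCoef L d n β a t := by
  unfold specCoef; ring

theorem specCoef_mul_sq (n : ℕ) (β a : ℝ) (t : Fin L → ℝ) {x : ℝ} (hx : 0 ≤ x) :
    specCoef L d n β a (fun l => t l * x ^ 2) = specCoef L d n β a t * x := by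
  unfold specCoef
  simp_rw [← mul_assoc, ← Finset.sum_mul]
  rw [Real.sqrt_mul' _ (sq_nonneg x), Real.sqrt_sq hx]
  ring

/-- The larger of `w` and `r` decides, uniformly in `t`. The choice can thus be made before
integrating over `S'`, which avoids splitting an integral of possibly non-measurable functions. -/
theorem specCoef_two_mul_add_le {n : ℕ} {β : ℝ} (hβ : 0 < β) {w r : ℝ} (hw : 0 ≤ w) (hr : 0 ≤ r) :
    (∀ t, specCoef L d n β (2 * w + r) t ≤ 3 * specCoef L d n β w t) ∨
      ∀ t, specCoef L d n β (2 * w + r) t ≤ 3 * specCoef L d n β r t := by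
  rcases le_total r w with h | h
  · refine Or.inl fun t => ?_
    rw [← specCoef_mul_left]
    exact specCoef_mono hβ (by positivity) (by linarith) fun _ => le_rfl
  · refine Or.inr fun t => ?_
    rw [← specCoef_mul_left]
    exact specCoef_mono hβ (by positivity) (by linarith) fun _ => le_rfl

theorem lintegral_specCoef_le_rankFree (P : Measure (Vec (d 0) × Y)) {n : ℕ} {β : ℝ} (hβ : 0 < β)
    (M : Fin L → Weights L d → ℝ → ℝ≥0) (S : Fin n → Vec (d 0) × Y) (W : Weights L d) {a : ℝ}
    (ha : 0 ≤ a) :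
    ∫⁻ S', ENNReal.ofReal (specCoef L d n β a fun l =>
        (M l W (1 / β) * frob (mixedFeat σ W l l.isLt.le (inputs S) (inputs S'))) ^ 2)
        ∂Measure.pi (fun _ : Fin n => P) ≤ rankFree σ P β M S W a := by
  have hΛ := Lam_pos n β
  rw [rankFree, ← lintegral_const_mul' _ _ ENNReal.ofReal_ne_top]
  refine lintegral_mono fun S' => ?_
  have e : specCoef L d n β a (fun l =>
      (M l W (1 / β) * frob (mixedFeat σ W l l.isLt.le (inputs S) (inputs S'))) ^ 2) =
      β * (Lam n β / n * (∑ l : Fin L, ((d (l + 1) + d l : ℕ) : ℝ) * L *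
        frob (mixedFeat σ W l l.isLt.le (inputs S) (inputs S')) ^ 2 * a ^ 2 *
          (M l W (1 / β) : ℝ) ^ 2) ^ (1 / 2 : ℝ)) := by
    have e1 : (∑ l : Fin L, ((d (l + 1) + d l : ℕ) : ℝ) * L *
        frob (mixedFeat σ W l l.isLt.le (inputs S) (inputs S')) ^ 2 * a ^ 2 *
          (M l W (1 / β) : ℝ) ^ 2) = a ^ 2 * ∑ l : Fin L, (L : ℝ) * ((d (l + 1) : ℝ) + d l) *
          (M l W (1 / β) * frob (mixedFeat σ W l l.isLt.le (inputs S) (inputs S'))) ^ 2 := by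
      rw [Finset.mul_sum]
      refine Finset.sum_congr rfl fun l _ => ?_
      push_cast
      ring
    rw [← Real.sqrt_eq_rpow, e1, Real.sqrt_mul (sq_nonneg a), Real.sqrt_sq ha, specCoef]
    ring
  have hterm : ∀ l : Fin L, 0 ≤ ((d (l + 1) + d l : ℕ) : ℝ) * L *
      frob (mixedFeat σ W l l.isLt.le (inputs S) (inputs S')) ^ 2 * a ^ 2 *
        (M l W (1 / β) : ℝ) ^ 2 := fun l => by positivity
  rw [e, ENNReal.ofReal_mul hβ.le, ENNReal.ofReal_mul (by positivity),
    ← ENNReal.ofReal_rpow_of_nonneg (Finset.sum_nonneg fun l _ => hterm l) (by norm_num),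
    ENNReal.ofReal_sum_of_nonneg fun l _ => hterm l]
  gcongr with l
  -- Only the coarsest scale `ε = 1 / β` has been used; the supremum over scales enters here.
  have hsup : (M l W (1 / β) : ℝ≥0∞) ≤ supLip M β l W :=
    le_iSup₂ (f := fun ε (_ : ε ∈ Ioc (0 : ℝ) (1 / β)) => (M l W ε : ℝ≥0∞)) (1 / β)
      ⟨by positivity, le_rfl⟩
  have hf := frob_nonneg (mixedFeat σ W l l.isLt.le (inputs S) (inputs S'))
  rw [ENNReal.ofReal_mul (by positivity), ENNReal.ofReal_mul (by positivity),
    ENNReal.ofReal_mul (by positivity), ENNReal.ofReal_mul (by positivity), ENNReal.ofReal_natCast,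
    ENNReal.ofReal_natCast, ENNReal.ofReal_pow hf, ENNReal.ofReal_pow ha,
    ENNReal.ofReal_pow (NNReal.coe_nonneg _), ENNReal.ofReal_coe_nnreal]
  gcongr

theorem lintegral_specCoef_eq (P : Measure (Vec (d 0) × Y)) {n : ℕ} {β : ℝ} (hβ : 0 < β)
    (S : Fin n → Vec (d 0) × Y) (W : Weights L d) {a : ℝ} (ha : 0 ≤ a) :
    ∫⁻ S', ENNReal.ofReal (specCoef L d n β a fun l =>
        ((∏ i ∈ Finset.univ.erase l, spec (W i)) * frob (mixedInput (inputs S) (inputs S'))) ^ 2)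
        ∂Measure.pi (fun _ : Fin n => P) =
      ENNReal.ofReal (specCoef L d n β a (specProd W)) * expInput P S := by
  rw [expInput, ← lintegral_const_mul' _ _ ENNReal.ofReal_ne_top]
  refine lintegral_congr fun S' => ?_
  simp_rw [mul_pow, ← specProd_eq_sq]
  rw [specCoef_mul_sq n β a (fun l => specProd W l) (frob_nonneg _),
    ENNReal.ofReal_mul (specCoef_nonneg L d n hβ ha _)]

theorem specFloor_nonneg (L n : ℕ) {R : ℝ} (hR : 0 < R) : 0 ≤ specFloor L n R := by
  have : 0 < max R 2 := lt_max_of_lt_left hR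
  unfold specFloor
  positivity

theorem measure_compl_le_of_ae {α : Type*} {mα : MeasurableSpace α} {μ : Measure α} {G A : Set α}
    {c : ℝ≥0∞} (hG : μ Gᶜ ≤ c) (h : ∀ᵐ x ∂μ, x ∈ G → x ∈ A) : μ Aᶜ ≤ c := by
  refine le_trans (measure_mono_ae ?_) hG
  filter_upwards [h] with x hx hA hxG
  exact hA (hx hxG)

/-- The case `φ = frob`: net points of smaller Frobenius norm stay in the ball where the local
Lipschitz constants are valid. -/
theorem rankFree_bound (P : Measure (Vec (d 0) × Y)) [IsProbabilityMeasure P] {n : ℕ}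
    (hn : 2 ≤ n) (hL : 1 ≤ L) (hd : ∀ k ≤ L, 1 ≤ d k) (hσ : ∀ l, LipschitzWith 1 (σ l))
    {β δ R : ℝ} (hβ : 0 < β) (hδ : δ ∈ Ioo (0 : ℝ) 1) (hR : 0 < R)
    {loss : Vec (d L) → Y → ℝ} (hlm : Measurable (Function.uncurry loss))
    (hl01 : ∀ u y, loss u y ∈ Icc (0 : ℝ) 1)
    (hlip : ∀ y u v, |loss u y - loss v y| ≤ β * ‖u - v‖) {M : Fin L → Weights L d → ℝ → ℝ≥0}
    (hM : ∀ᵐ T ∂Measure.pi (fun _ : Fin n => P), IsLocalLipschitz σ (inputs T) R (1 / β) M) :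
    Measure.pi (fun _ : Fin n => P) {S | ∀ W : Weights L d, wnorm W ≤ R →
      ENNReal.ofReal (gap P loss (net σ W) S) ≤ ENNReal.ofReal 60000 *
        (rankFree σ P β M S W (wnorm W) + ENNReal.ofReal (conf L d n δ)
          + ENNReal.ofReal (smallScale L d n β) + rankFree σ P β M S W (R / 2 ^ n))}ᶜ
      ≤ ENNReal.ofReal δ := by
  obtain ⟨G, hG, hgen⟩ := exists_generalization_event P hn hL hd hσ hβ hδ hR hlm hl01 hlip
    (fun _ => frob) (fun _ => continuous_frob)
    (fun l V => by rw [frob_zero]; exact frob_nonneg V)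
  refine measure_compl_le_of_ae hG ?_
  filter_upwards [hM] with S hS hSG W hW
  have hw : 0 ≤ wnorm W := Real.sqrt_nonneg _
  have hr : 0 ≤ R / 2 ^ n := by positivity
  refine (hgen S hSG W hW
    (fun S' l => M l W (1 / β) * frob (mixedFeat σ W l l.isLt.le (inputs S) (inputs S')))
    (fun S' l => mul_nonneg (NNReal.coe_nonneg _) (frob_nonneg _)) ?_).trans ?_
  · filter_upwards [hM] with S' hS'
    exact perturbBound_of_isLocalLipschitz (by omega) hσ hβ hS hS' hW
  have hconf := ENNReal.ofReal_le_ofReal (confBase_le_conf (L := L) (d := d) hn hδ)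
  have key : ∫⁻ S', ENNReal.ofReal (specCoef L d n β (2 * wnorm W + R / 2 ^ n) fun l =>
      (M l W (1 / β) * frob (mixedFeat σ W l l.isLt.le (inputs S) (inputs S'))) ^ 2)
        ∂Measure.pi (fun _ : Fin n => P) ≤
      3 * (rankFree σ P β M S W (wnorm W) + rankFree σ P β M S W (R / 2 ^ n)) := by
    have aux : ∀ c : ℝ, 0 ≤ c → (∀ t : Fin L → ℝ, specCoef L d n β (2 * wnorm W + R / 2 ^ n) t ≤
        3 * specCoef L d n β c t) →
        ∫⁻ S', ENNReal.ofReal (specCoef L d n β (2 * wnorm W + R / 2 ^ n) fun l =>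
          (M l W (1 / β) * frob (mixedFeat σ W l l.isLt.le (inputs S) (inputs S'))) ^ 2)
            ∂Measure.pi (fun _ : Fin n => P) ≤ 3 * rankFree σ P β M S W c := by
      intro c hc h
      refine le_trans ?_ (mul_le_mul_right (lintegral_specCoef_le_rankFree P hβ M S W hc) 3)
      rw [← lintegral_const_mul' _ _ (by norm_num)]
      refine lintegral_mono fun S' => ?_
      refine (ENNReal.ofReal_le_ofReal (h _)).trans ?_
      rw [ENNReal.ofReal_mul (by norm_num), ENNReal.ofReal_ofNat]
    rcases specCoef_two_mul_add_le (L := L) (d := d) (n := n) hβ hw hr with h | h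
    · exact (aux _ hw h).trans (by gcongr; exact le_self_add)
    · exact (aux _ hr h).trans (by gcongr; exact le_add_self)
  set A := rankFree σ P β M S W (wnorm W)
  set B := rankFree σ P β M S W (R / 2 ^ n)
  set c := ENNReal.ofReal (conf L d n δ)
  set s := ENNReal.ofReal (smallScale L d n β)
  simp only [ENNReal.ofReal_ofNat]
  calc _ ≤ 10000 * (3 * (A + B) + c + s) := by gcongr
    _ ≤ 10000 * (6 * (A + B) + 6 * c + 6 * s) := by
        gcongr
        · norm_num
        · exact le_mul_of_one_le_left' (by norm_num)
        · exact le_mul_of_one_le_left' (by norm_num)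
    _ = 60000 * (A + c + s + B) := by ring

/-- The case `φ = spec`: the perturbation coefficients factor into a product of norms of `W` and the
norm of the mixed input, so only the latter is integrated over `S'`. -/
theorem specNorm_bound (P : Measure (Vec (d 0) × Y)) [IsProbabilityMeasure P] {n : ℕ}
    (hn : 2 ≤ n) (hL : 1 ≤ L) (hd : ∀ k ≤ L, 1 ≤ d k) (hσ : ∀ l, LipschitzWith 1 (σ l))
    (h0 : ∀ l, σ l 0 = 0)
    {β δ R : ℝ} (hβ : 0 < β) (hδ : δ ∈ Ioo (0 : ℝ) 1) (hR : 0 < R)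
    {loss : Vec (d L) → Y → ℝ} (hlm : Measurable (Function.uncurry loss))
    (hl01 : ∀ u y, loss u y ∈ Icc (0 : ℝ) 1)
    (hlip : ∀ y u v, |loss u y - loss v y| ≤ β * ‖u - v‖) :
    Measure.pi (fun _ : Fin n => P) {S | ∀ W : Weights L d, wnorm W ≤ R →
      ENNReal.ofReal (gap P loss (net σ W) S) ≤ ENNReal.ofReal 30000 *
        (ENNReal.ofReal (specCoef L d n β (wnorm W) (specProd W)) * expInput P S
          + ENNReal.ofReal (confSpec L d n R δ) + ENNReal.ofReal (smallScale L d n β)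
          + ENNReal.ofReal (specCoef L d n β (R / 2 ^ n)
              (fun l => specProd W l + specFloor L n R)) * expInput P S
          + ENNReal.ofReal (specCoef L d n β (wnorm W)
              (fun _ => specFloor L n R)) * expInput P S)}ᶜ
      ≤ ENNReal.ofReal δ := by
  obtain ⟨G, hG, hgen⟩ := exists_generalization_event P hn hL hd hσ hβ hδ hR hlm hl01 hlip
    (fun _ => spec) (fun _ => continuous_spec)
    (fun l V => by rw [spec_zero]; exact spec_nonneg V)
  refine measure_compl_le_of_ae hG (Filter.Eventually.of_forall fun S hSG W hW => ?_)
  have hw : 0 ≤ wnorm W := Real.sqrt_nonneg _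
  have hr : 0 ≤ R / 2 ^ n := by positivity
  refine (hgen S hSG W hW
    (fun S' l => (∏ i ∈ Finset.univ.erase l, spec (W i)) * frob (mixedInput (inputs S) (inputs S')))
    (fun S' l => mul_nonneg (Finset.prod_nonneg fun i _ => spec_nonneg _) (frob_nonneg _))
    (Filter.Eventually.of_forall fun S' => perturbBound_spec hσ h0 _ _ β W)).trans ?_
  rw [lintegral_specCoef_eq P hβ S W (by positivity)]
  have hconf := ENNReal.ofReal_le_ofReal (confBase_le_confSpec (L := L) (d := d) hn hL R hδ)
  have hfl := specFloor_nonneg L n hR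
  -- The floor `r₀` enters by monotonicity only, here and in the last summand of the bound.
  have hfloor : specCoef L d n β (R / 2 ^ n) (specProd W) ≤
      specCoef L d n β (R / 2 ^ n) (fun l => specProd W l + specFloor L n R) :=
    specCoef_mono hβ hr le_rfl fun l => le_add_of_nonneg_right hfl
  set x := specCoef L d n β (wnorm W) (specProd W) with hx
  set y := specCoef L d n β (R / 2 ^ n) (fun l => specProd W l + specFloor L n R) with hy
  have key : ENNReal.ofReal (specCoef L d n β (2 * wnorm W + R / 2 ^ n) (specProd W)) ≤
      3 * (ENNReal.ofReal x + ENNReal.ofReal y) := by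
    have h3 : ∀ t : ℝ, ENNReal.ofReal (3 * t) = 3 * ENNReal.ofReal t := fun t => by
      rw [ENNReal.ofReal_mul (by norm_num), ENNReal.ofReal_ofNat]
    rcases specCoef_two_mul_add_le (L := L) (d := d) (n := n) hβ hw hr with h | h
    · refine (ENNReal.ofReal_le_ofReal (h _)).trans ?_
      rw [h3]
      gcongr
      exact le_self_add
    · refine (ENNReal.ofReal_le_ofReal ((h _).trans (mul_le_mul_of_nonneg_left hfloor
        (by norm_num)))).trans ?_
      rw [h3]
      gcongr
      exact le_add_self
  set E := expInput P S
  set c := ENNReal.ofReal (confSpec L d n R δ)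
  set s := ENNReal.ofReal (smallScale L d n β)
  simp only [ENNReal.ofReal_ofNat]
  calc _ ≤ 10000 * (3 * (ENNReal.ofReal x + ENNReal.ofReal y) * E + c + s) := by gcongr
    _ ≤ 10000 * (3 * (ENNReal.ofReal x + ENNReal.ofReal y) * E + 3 * c + 3 * s) := by
        gcongr
        · exact le_mul_of_one_le_left' (by norm_num)
        · exact le_mul_of_one_le_left' (by norm_num)
    _ = 30000 * (ENNReal.ofReal x * E + c + s + ENNReal.ofReal y * E) := by ring
    _ ≤ _ := mul_le_mul_right le_self_add _

theorem frob_inputMat_sq {n p : ℕ} (X : Fin n → Vec p) :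
    frob (inputMat X) ^ 2 = ∑ i, ‖X i‖ ^ 2 := by
  rw [inputMat, frob_of_eq_norm_stack, norm_stack_sq]

theorem ae_frob_inputMat_sq_le {p : ℕ} (P : Measure (Vec p × Y)) [IsProbabilityMeasure P] (n : ℕ)
    {B : ℝ} (hB : ∀ᵐ z ∂P, ‖z.1‖ ≤ B) :
    ∀ᵐ S ∂Measure.pi (fun _ : Fin n => P), frob (inputMat (inputs S)) ^ 2 ≤ n * B ^ 2 := by
  have h1 : ∀ᵐ S ∂Measure.pi (fun _ : Fin n => P), ∀ i, ‖(S i).1‖ ≤ B :=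
    ae_all_iff.2 fun i =>
      (measurePreserving_eval (fun _ : Fin n => P) i).quasiMeasurePreserving.ae hB
  filter_upwards [h1] with S hS
  rw [frob_inputMat_sq]
  have h2 := Finset.sum_le_card_nsmul (Finset.univ : Finset (Fin n)) _ _
    fun i _ => pow_le_pow_left₀ (norm_nonneg (inputs S i)) (hS i) 2
  rwa [Finset.card_univ, Fintype.card_fin, nsmul_eq_mul] at h2

theorem expInput_le {p : ℕ} (P : Measure (Vec p × Y)) [IsProbabilityMeasure P] {n : ℕ}
    {B : ℝ} (hB : ∀ᵐ z ∂P, ‖z.1‖ ≤ B) (S : Fin n → Vec p × Y) :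
    expInput P S ≤ ENNReal.ofReal (Real.sqrt (frob (inputMat (inputs S)) ^ 2 + n * B ^ 2)) := by
  have h1 : ∀ᵐ S' ∂Measure.pi (fun _ : Fin n => P),
      ENNReal.ofReal (frob (mixedInput (inputs S) (inputs S'))) ≤
        ENNReal.ofReal (Real.sqrt (frob (inputMat (inputs S)) ^ 2 + n * B ^ 2)) := by
    filter_upwards [ae_frob_inputMat_sq_le P n hB] with S' hS'
    refine ENNReal.ofReal_le_ofReal (Real.le_sqrt_of_sq_le ?_)
    rw [mixedInput, frob_fromCols_sq]
    linarith
  refine (lintegral_mono_ae h1).trans ?_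
  rw [lintegral_const, measure_univ, mul_one]

theorem nonneg_of_ae_norm_le {p : ℕ} (P : Measure (Vec p × Y)) [IsProbabilityMeasure P]
    {B : ℝ} (hB : ∀ᵐ z ∂P, ‖z.1‖ ≤ B) : 0 ≤ B :=
  let ⟨_, h⟩ := hB.exists
  (norm_nonneg _).trans h

theorem ae_sqrt_input_le {p : ℕ} (P : Measure (Vec p × Y)) [IsProbabilityMeasure P] (n : ℕ)
    {B : ℝ} (hB : ∀ᵐ z ∂P, ‖z.1‖ ≤ B) :
    ∀ᵐ S ∂Measure.pi (fun _ : Fin n => P),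
      Real.sqrt (frob (inputMat (inputs S)) ^ 2 + n * B ^ 2) ≤ Real.sqrt (2 * n) * B := by
  have hB0 := nonneg_of_ae_norm_le P hB
  filter_upwards [ae_frob_inputMat_sq_le P n hB] with S hS
  rw [← Real.sqrt_sq hB0, ← Real.sqrt_mul (by positivity), Real.sqrt_sq hB0]
  exact Real.sqrt_le_sqrt (by linarith)

theorem specNorm_bound_of_bounded (P : Measure (Vec (d 0) × Y)) [IsProbabilityMeasure P] {n : ℕ}
    (hn : 2 ≤ n) (hL : 1 ≤ L) (hd : ∀ k ≤ L, 1 ≤ d k) (hσ : ∀ l, LipschitzWith 1 (σ l))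
    (h0 : ∀ l, σ l 0 = 0)
    {β δ R : ℝ} (hβ : 0 < β) (hδ : δ ∈ Ioo (0 : ℝ) 1) (hR : 0 < R)
    {loss : Vec (d L) → Y → ℝ} (hlm : Measurable (Function.uncurry loss))
    (hl01 : ∀ u y, loss u y ∈ Icc (0 : ℝ) 1)
    (hlip : ∀ y u v, |loss u y - loss v y| ≤ β * ‖u - v‖) {B : ℝ} (hB : ∀ᵐ z ∂P, ‖z.1‖ ≤ B) :
    Measure.pi (fun _ : Fin n => P) {S | ∀ W : Weights L d, wnorm W ≤ R →
      gap P loss (net σ W) S ≤ 60000 *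
        (specCoef L d n β (wnorm W) (specProd W) * (Real.sqrt n * B)
          + confSpec L d n R δ + smallScale L d n β
          + specCoef L d n β (R / 2 ^ n) (fun l => specProd W l + specFloor L n R) * (Real.sqrt n * B)
          + specCoef L d n β (wnorm W) (fun _ => specFloor L n R) * (Real.sqrt n * B))}ᶜ
      ≤ ENNReal.ofReal δ := by
  have hB0 := nonneg_of_ae_norm_le P hB
  refine measure_compl_le_of_ae
    (specNorm_bound P hn hL hd hσ h0 hβ hδ hR hlm hl01 hlip) ?_
  filter_upwards [ae_sqrt_input_le P n hB] with S hS hSG W hW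
  have hw : 0 ≤ wnorm W := Real.sqrt_nonneg _
  have hr : 0 ≤ R / 2 ^ n := by positivity
  have h1 := hSG W hW
  have hx := specCoef_nonneg L d n hβ hw (specProd W)
  have hy := specCoef_nonneg L d n hβ hr (fun l => specProd W l + specFloor L n R)
  have hz := specCoef_nonneg L d n hβ hw (fun _ : Fin L => specFloor L n R)
  have hs := smallScale_nonneg L d n hβ
  have hc : 0 ≤ confSpec L d n R δ := Real.sqrt_nonneg _
  have hN : 0 ≤ Real.sqrt n * B := by positivity
  set x := specCoef L d n β (wnorm W) (specProd W)
  set y := specCoef L d n β (R / 2 ^ n) (fun l => specProd W l + specFloor L n R)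
  set z := specCoef L d n β (wnorm W) (fun _ : Fin L => specFloor L n R)
  set c := confSpec L d n R δ
  set s := smallScale L d n β
  set N := Real.sqrt n * B with hNdef
  -- `√(2 n) B ≤ 2 √n B`; this factor two doubles the constant 30000.
  have hE : expInput P S ≤ ENNReal.ofReal (2 * N) := by
    refine (expInput_le P hB S).trans (ENNReal.ofReal_le_ofReal (hS.trans ?_))
    rw [Real.sqrt_mul (by norm_num), hNdef, mul_assoc]
    refine mul_le_mul_of_nonneg_right ?_ hN
    rw [Real.sqrt_le_left (by norm_num)]
    norm_num
  have h2 : ENNReal.ofReal (gap P loss (net σ W) S) ≤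
      ENNReal.ofReal (30000 * (x * (2 * N) + c + s + y * (2 * N) + z * (2 * N))) := by
    refine h1.trans ?_
    rw [ENNReal.ofReal_mul (by norm_num), ENNReal.ofReal_add (by positivity) (by positivity),
      ENNReal.ofReal_add (by positivity) (by positivity), ENNReal.ofReal_add (by positivity) hs,
      ENNReal.ofReal_add (by positivity) hc, ENNReal.ofReal_mul hx, ENNReal.ofReal_mul hy,
      ENNReal.ofReal_mul hz]
    gcongr
  have h3 := (ENNReal.ofReal_le_ofReal_iff (by positivity)).1 h2
  linarith

end Bounds

end DNN

end

/-! ### The main theorem. -/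

theorem mainTheorem7 :
    ∃ C : ℝ, 0 < C ∧
      ∀ (n : ℕ) (_ : 2 ≤ n) (L : ℕ) (_ : 1 ≤ L) (d : ℕ → ℕ) (_ : ∀ k ≤ L, 1 ≤ d k)
        (σ : DNN.Activations L d) (_ : ∀ l, LipschitzWith 1 (σ l))
        (Y : Type*) (_ : MeasurableSpace Y)
        (P : Measure (DNN.Vec (d 0) × Y)) (_ : IsProbabilityMeasure P)
        (β : ℝ) (_ : 0 < β)
        (loss : DNN.Vec (d L) → Y → ℝ) (_ : Measurable (Function.uncurry loss))
        (_ : ∀ u y, loss u y ∈ Icc (0 : ℝ) 1)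
        (_ : ∀ y u v, |loss u y - loss v y| ≤ β * ‖u - v‖)
        (R : ℝ) (_ : 0 < R),
        -- rank-free bound
        (∀ M : Fin L → DNN.Weights L d → ℝ → ℝ≥0,
          (∀ᵐ T ∂Measure.pi (fun _ : Fin n => P),
            DNN.IsLocalLipschitz σ (DNN.inputs T) R (1 / β) M) →
          ∀ δ ∈ Ioo (0 : ℝ) 1,
            Measure.pi (fun _ : Fin n => P)
              {S | ∀ W : DNN.Weights L d, DNN.wnorm W ≤ R →
                ENNReal.ofReal (DNN.gap P loss (DNN.net σ W) S) ≤
                  ENNReal.ofReal C *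
                    (DNN.rankFree σ P β M S W (DNN.wnorm W)
                      + ENNReal.ofReal (DNN.conf L d n δ)
                      + ENNReal.ofReal (DNN.smallScale L d n β)
                      + DNN.rankFree σ P β M S W (R / 2 ^ n))}ᶜ
              ≤ ENNReal.ofReal δ) ∧
        -- bounded inputs: the expected norm of the mixed input matrix
        (∀ B : ℝ, (∀ᵐ z ∂P, ‖z.1‖ ≤ B) →
          (∀ S : Fin n → DNN.Vec (d 0) × Y,
            DNN.expInput P S ≤ ENNReal.ofReal
              (Real.sqrt (DNN.frob (DNN.inputMat (DNN.inputs S)) ^ 2 + n * B ^ 2))) ∧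
          (∀ᵐ S ∂Measure.pi (fun _ : Fin n => P),
            Real.sqrt (DNN.frob (DNN.inputMat (DNN.inputs S)) ^ 2 + n * B ^ 2)
              ≤ Real.sqrt (2 * n) * B)) ∧
        ((∀ l, σ l 0 = 0) →
          -- spectral relaxation of the feature norms
          (∀ (X X' : Fin n → DNN.Vec (d 0)) (W : DNN.Weights L d) (l : Fin L),
            DNN.frob (DNN.mixedFeat σ W l l.isLt.le X X') ≤
              (∏ i ∈ Finset.Iio l, DNN.spec (W i)) * DNN.frob (DNN.mixedInput X X')) ∧
          -- spectrally normalized bound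
          (∀ δ ∈ Ioo (0 : ℝ) 1,
            Measure.pi (fun _ : Fin n => P)
              {S | ∀ W : DNN.Weights L d, DNN.wnorm W ≤ R →
                ENNReal.ofReal (DNN.gap P loss (DNN.net σ W) S) ≤
                  ENNReal.ofReal C *
                    (ENNReal.ofReal (DNN.specCoef L d n β (DNN.wnorm W) (DNN.specProd W))
                        * DNN.expInput P S
                      + ENNReal.ofReal (DNN.confSpec L d n R δ)
                      + ENNReal.ofReal (DNN.smallScale L d n β)
                      + ENNReal.ofReal (DNN.specCoef L d n β (R / 2 ^ n)
                          (fun l => DNN.specProd W l + DNN.specFloor L n R)) * DNN.expInput P S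
                      + ENNReal.ofReal (DNN.specCoef L d n β (DNN.wnorm W)
                          (fun _ => DNN.specFloor L n R)) * DNN.expInput P S)}ᶜ
              ≤ ENNReal.ofReal δ) ∧
          -- spectrally normalized bound of order `n ^ (-1/2)` for bounded inputs
          (∀ B : ℝ, (∀ᵐ z ∂P, ‖z.1‖ ≤ B) → ∀ δ ∈ Ioo (0 : ℝ) 1,
            Measure.pi (fun _ : Fin n => P)
              {S | ∀ W : DNN.Weights L d, DNN.wnorm W ≤ R →
                DNN.gap P loss (DNN.net σ W) S ≤
                  C * (DNN.specCoef L d n β (DNN.wnorm W) (DNN.specProd W) * (Real.sqrt n * B)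
                      + DNN.confSpec L d n R δ
                      + DNN.smallScale L d n β
                      + DNN.specCoef L d n β (R / 2 ^ n)
                          (fun l => DNN.specProd W l + DNN.specFloor L n R) * (Real.sqrt n * B)
                      + DNN.specCoef L d n β (DNN.wnorm W)
                          (fun _ => DNN.specFloor L n R) * (Real.sqrt n * B))}ᶜ
              ≤ ENNReal.ofReal δ)) := by
  -- The largest of the constants of the three bounds, 60000, 30000 and 60000.
  refine ⟨60000, by norm_num, ?_⟩
  intro n hn L hL d hd σ hσ Y _ P _ β hβ loss hlm hl01 hlip R hR
  refine ⟨fun M hM δ hδ => DNN.rankFree_bound P hn hL hd hσ hβ hδ hR hlm hl01 hlip hM,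
    fun B hB => ⟨DNN.expInput_le P hB, DNN.ae_sqrt_input_le P n hB⟩,
    fun h0 => ⟨DNN.frob_mixedFeat_le hσ h0, fun δ hδ => ?_, fun B hB δ hδ =>
      DNN.specNorm_bound_of_bounded P hn hL hd hσ h0 hβ hδ hR hlm hl01 hlip hB⟩⟩
  refine DNN.measure_compl_le_of_ae
    (DNN.specNorm_bound P hn hL hd hσ h0 hβ hδ hR hlm hl01 hlip)
    (Filter.Eventually.of_forall fun S hS W hW => (hS W hW).trans ?_)
  gcongr
  norm_num
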